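/- Let $F$ be a number field with adele ring $\mathbb A$, let $\varphi:\mathbb G_m\to \mathrm{GL}_1$ be a homomorphism of algebraic groups over $F$, and let $G=\mathbb G_a\rtimes_\varphi\mathbb G_m$, with group law $(x,a)(y,b)=(x+\varphi(a)y,\,ab)$; put $N=\mathbb G_a$ and $T=\mathbb G_m$. Fix Haar measures $dx$ on $N(\mathbb A)=\mathbb A$ and $da^\times$ on $T(\mathbb A)=\mathbb A^\times$, and the right Haar measure $dg=dx\,da^\times$ on $G(\mathbb A)$. Let $\psi=\prod_v\psi_v:\mathbb A/F\to\mathbb S^1$ be the standard character ($\psi_v(x)=e^{-2\pi i\,\mathrm{Tr}(x)}$ for $v\mid\infty$, $\psi_v(x)=e^{2\pi i\{\mathrm{Tr}_{F_v/\mathbb Q_p}(x)\}_p}$ for $v\mid p$), and for $n\in F^\times$ let $\psi_n(x)=\psi(nx)$. Let $W=\ker(\varphi:F^\times\to F^\times)$, and let $$\pi_n=\mathrm{Ind}_{N(\mathbb A)\times W}^{G(\mathbb A)}(\psi_n)$$ be the unitarily induced representation, where $\psi_n$ is extended trivially to $W$: $G(\mathbb A)$ acts by right translations on the Hilbert space of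 classes of measurable functions $f:G(\mathbb A)\to\mathbb C$ with $f((x,w)g)=\psi_n(x)f(g)$ for $(x,w)\in N(\mathbb A)\times W$ and $\int_{(N(\mathbb A)\times W)\backslash G(\mathbb A)}|f|^2<\infty$. Quotients carry the right-invariant quotient measures, with counting measure on $G(F)$, on $T(F)$ and on $W$. Let $\varrho$ be the right regular representation of $G(\mathbb A)$ on $\mathcal H=\mathsf L^2(G(F)\backslash G(\mathbb A),dg)$, and let $G(\mathbb A)$ act on $\mathsf L^2(T(F)\backslash T(\mathbb A))$ by right translations through $G(\mathbb A)\to T(\mathbb A)$. Then, for every choice of representatives $n$ of the classes in $F^\times/\varphi(F^\times)$, there is an isomorphism of unitary representations of $G(\mathbb A)$ $$\mathcal H\;\cong\;\mathsf L^2(T(F)\backslash T(\mathbb A))\;\oplus\;\widehat{\bigoplus_{n\in F^\times/\varphi(F^\times)}}\pi_n .$$ Moreover, every irreducible closed subrepresentation of $\mathcal H$ is unitarily equivalent to a closed subrepresentation of $\mathsf L^2(T(F)\backslash T(\mathbb A))$ or of one of the $\pi_n$. -/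

import Mathlib

open MeasureTheory NumberField
open scoped ENNReal

universe u

noncomputable section

/-! ### Homogeneous spaces `H \ G` and their quotient measures -/

section Homogeneous

/-- The space `H \ G` of cosets `Hg`, with the quotient σ-algebra. -/
abbrev RightCosets {G : Type*} [Group G] (H : Subgroup G) : Type _ :=
  Quotient (QuotientGroup.rightRel H)

/-- The right translation `Hx ↦ Hxg` of `H \ G`. -/
def RightCosets.mulRight {G : Type*} [Group G] (H : Subgroup G) (g : G) :
    RightCosets H → RightCosets H :=
  Quotient.map (fun x => x * g) (by
    intro x y h
    have h' := QuotientGroup.rightRel_apply.1 h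
    exact QuotientGroup.rightRel_apply.2 (by simpa [mul_assoc] using h'))

/-- `ν` is the right `G`-invariant measure on `H \ G` which is the quotient of the measure `μG`
on `G` by the measure `μH` on `H`:
`∫_G f(g) dg = ∫_{H \ G} ∫_H f(h g) dh dν` for all measurable `f ≥ 0`. -/
structure IsQuotientMeasure {G : Type*} [Group G] [MeasurableSpace G] (H : Subgroup G)
    (μG : Measure G) (μH : Measure H) (ν : Measure (RightCosets H)) : Prop where
  invariant : ∀ g : G, MeasurePreserving (RightCosets.mulRight H g) ν ν
  weil : ∀ f : G → ℝ≥0∞, Measurable f →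
    ∫⁻ g, f g ∂μG = ∫⁻ q : RightCosets H, ∫⁻ h : H, f ((h : G) * q.out) ∂μH ∂ν

theorem RightCosets.exists_out_eq {G : Type*} [Group G] (H : Subgroup G) (g : G) :
    ∃ h : H, Quotient.out (Quotient.mk (QuotientGroup.rightRel H) g) = h * g := by
  have h1 : (QuotientGroup.rightRel H) g (Quotient.out (Quotient.mk _ g)) :=
    Setoid.symm' _ (Quotient.mk_out (s := QuotientGroup.rightRel H) g)
  exact ⟨⟨_, QuotientGroup.rightRel_apply.1 h1⟩, by simp⟩

theorem RightCosets.mulRight_mk {G : Type*} [Group G] (H : Subgroup G) (g x : G) :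
    RightCosets.mulRight H g (Quotient.mk _ x) = Quotient.mk _ (x * g) := rfl

theorem RightCosets.mulRight_one {G : Type*} [Group G] (H : Subgroup G) :
    RightCosets.mulRight H 1 = id := by
  funext q
  induction q using Quotient.inductionOn with
  | h x => simp [RightCosets.mulRight_mk]

theorem RightCosets.mulRight_mul {G : Type*} [Group G] (H : Subgroup G) (g g' : G) :
    RightCosets.mulRight H (g * g') =
      RightCosets.mulRight H g' ∘ RightCosets.mulRight H g := by
  funext q
  induction q using Quotient.inductionOn with
  | h x => simp [RightCosets.mulRight_mk, mul_assoc]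

end Homogeneous

/-! ### Unitary representations -/

section Rep

/-- A unitary representation given by isometric operators `T g` with `T 1 = 1` and
`T (g g') = T g ∘ T g'`. -/
def unitaryRepOfIsometries {G : Type*} [Group G] {E : Type*} [NormedAddCommGroup E]
    [InnerProductSpace ℂ E] (T : G → E →ₗᵢ[ℂ] E) (h1 : ∀ f, T 1 f = f)
    (hmul : ∀ g g' f, T (g * g') f = T g (T g' f)) : G →* (E ≃ₗᵢ[ℂ] E) where
  toFun g :=
    { toFun := T g
      map_add' := (T g).map_add
      map_smul' := (T g).map_smul
      invFun := T g⁻¹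
      left_inv := fun f => by rw [← hmul, inv_mul_cancel, h1]
      right_inv := fun f => by rw [← hmul, mul_inv_cancel, h1]
      norm_map' := (T g).norm_map }
  map_one' := by ext f; exact h1 f
  map_mul' g g' := by ext f; exact hmul g g' f

/-- The right regular representation `(ϱ(g) f)(x) = f(x g)` of `G` on `L²(H \ G, ν)`. -/
def rightRegular {G : Type*} [Group G] [MeasurableSpace G] (H : Subgroup G)
    {ν : Measure (RightCosets H)}
    (hν : ∀ g : G, MeasurePreserving (RightCosets.mulRight H g) ν ν) :
    G →* (Lp ℂ 2 ν ≃ₗᵢ[ℂ] Lp ℂ 2 ν) :=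
  unitaryRepOfIsometries
    (fun g => Lp.compMeasurePreservingₗᵢ ℂ (RightCosets.mulRight H g) (hν g))
    (by
      intro f
      apply Lp.ext
      refine (Lp.coeFn_compMeasurePreserving f (hν 1)).trans ?_
      rw [RightCosets.mulRight_one]; rfl)
    (by
      intro g g' f
      apply Lp.ext
      refine (Lp.coeFn_compMeasurePreserving f (hν (g * g'))).trans ?_
      refine Filter.EventuallyEq.trans ?_
        (Lp.coeFn_compMeasurePreserving (Lp.compMeasurePreserving _ (hν g') f) (hν g)).symm
      have h := (hν g).quasiMeasurePreserving.ae_eq_comp (Lp.coeFn_compMeasurePreserving f (hν g'))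
      rw [RightCosets.mulRight_mul]
      exact h.symm)

/-- `V` is a closed subspace, invariant under the unitary representation `ρ`. -/
def IsClosedInvariant {G : Type*} [Group G] {E : Type*} [NormedAddCommGroup E]
    [InnerProductSpace ℂ E] (ρ : G →* (E ≃ₗᵢ[ℂ] E)) (V : Submodule ℂ E) : Prop :=
  IsClosed (V : Set E) ∧ ∀ g, ∀ f ∈ V, ρ g f ∈ V

/-- `V` is an irreducible (closed) subrepresentation of `ρ`. -/
def IsIrreducibleSubrep {G : Type*} [Group G] {E : Type*} [NormedAddCommGroup E]
    [InnerProductSpace ℂ E] (ρ : G →* (E ≃ₗᵢ[ℂ] E)) (V : Submodule ℂ E) : Prop :=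
  IsClosedInvariant ρ V ∧ V ≠ ⊥ ∧
    ∀ V' : Submodule ℂ E, V' ≤ V → IsClosedInvariant ρ V' → V' = ⊥ ∨ V' = V

/-- The invariant subspace `V` of `ρ` is unitarily equivalent to a subrepresentation of `σ`: there
is an isometric intertwining map from `V` to the space of `σ`. -/
def EmbedsInRep {G : Type*} [Group G] {E E' : Type*} [NormedAddCommGroup E]
    [InnerProductSpace ℂ E] [NormedAddCommGroup E'] [InnerProductSpace ℂ E']
    (ρ : G →* (E ≃ₗᵢ[ℂ] E)) (V : Submodule ℂ E) (σ : G →* (E' ≃ₗᵢ[ℂ] E')) : Prop :=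
  ∃ J : V →ₗᵢ[ℂ] E', ∀ (g : G) (f f' : V), (f' : E) = ρ g f → J f' = σ g (J f)

end Rep

/-! ### Unitarily induced representations

`Ind_H^G χ`, for a subgroup `H` and a unitary character `χ` of `H`, and a right `G`-invariant
measure `ν` on `H \ G`. -/

section Induced

theorem RightCosets.measurable_comp_out {G : Type*} [Group G] [MeasurableSpace G]
    (H : Subgroup G) {β : Type*} [MeasurableSpace β] {P : G → β} (hP : Measurable P)
    (hinv : ∀ (h : H) (g : G), P (h * g) = P g) :
    Measurable (fun q : RightCosets H => P q.out) := by
  refine measurable_from_quotient.2 ?_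
  have : ((fun q : RightCosets H => P q.out) ∘ Quotient.mk'') = P := by
    funext g
    obtain ⟨h, hh⟩ := RightCosets.exists_out_eq H g
    change P (Quotient.out (Quotient.mk _ g)) = _
    rw [hh, hinv]
  rw [this]
  exact hP

theorem RightCosets.comp_out_mulRight {G : Type*} [Group G] {H : Subgroup G} {β : Type*}
    {P : G → β} (hinv : ∀ (h : H) (g : G), P (h * g) = P g) (g : G) (q : RightCosets H) :
    P (RightCosets.mulRight H g q).out = P (q.out * g) := by
  have hq : RightCosets.mulRight H g q = Quotient.mk _ (q.out * g) := by
    conv_lhs => rw [← Quotient.out_eq q]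
    rfl
  obtain ⟨h, hh⟩ := RightCosets.exists_out_eq H (q.out * g)
  rw [hq, hh, hinv]

theorem norm_equivariant {G : Type*} [Group G] {H : Subgroup G} {χ : H → Circle} {f : G → ℂ}
    (hf : ∀ (h : H) (g : G), f (h * g) = χ h * f g) (h : H) (g : G) : ‖f (h * g)‖ = ‖f g‖ := by
  rw [hf, norm_mul, Circle.norm_coe, one_mul]

theorem integral_comp_of_measurePreserving {X : Type*} [MeasurableSpace X] {μ : Measure X}
    {T : X → X} (hT : MeasurePreserving T μ μ) {f : X → ℂ} (hf : Measurable f) :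
    ∫ x, f (T x) ∂μ = ∫ x, f x ∂μ := by
  conv_rhs => rw [← hT.map_eq]
  rw [integral_map hT.measurable.aemeasurable hf.aestronglyMeasurable]

variable {G : Type*} [Group G] [MeasurableSpace G] (H : Subgroup G) (χ : H → Circle)
  (ν : Measure (RightCosets H))

/-- The measurable functions `f` on `G` such that `f(h g) = χ(h) f(g)` for `h ∈ H`, and for which
`|f|`, as a function on `H \ G`, is square-integrable. -/
def equivariantFunctions : Submodule ℂ (G → ℂ) where
  carrier := {f | Measurable f ∧ (∀ (h : H) (g : G), f (h * g) = χ h * f g) ∧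
    MemLp (fun q : RightCosets H => ‖f q.out‖) 2 ν}
  zero_mem' := by
    refine ⟨measurable_const, by simp, by simp⟩
  add_mem' := by
    rintro f f' ⟨hf, hf1, hf2⟩ ⟨hf', hf1', hf2'⟩
    have heq : ∀ (h : H) (g : G), (f + f') (h * g) = χ h * (f + f') g :=
      fun h g => by simp [hf1, hf1', mul_add]
    refine ⟨hf.add hf', heq, (hf2.add hf2').mono ?_ ?_⟩
    · exact (RightCosets.measurable_comp_out H (P := fun g => ‖(f + f') g‖) (hf.add hf').norm
        (norm_equivariant heq)).aestronglyMeasurable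
    · refine Filter.Eventually.of_forall fun q => ?_
      simp only [Pi.add_apply, Real.norm_eq_abs]
      rw [abs_of_nonneg (norm_nonneg _)]
      exact (norm_add_le _ _).trans (le_abs_self _)
  smul_mem' := by
    rintro c f ⟨hf, hf1, hf2⟩
    refine ⟨hf.const_smul c, fun h g => by simp [hf1, mul_left_comm], ?_⟩
    simp only [Pi.smul_apply, norm_smul]
    exact hf2.const_mul _

/-- The space `equivariantFunctions H χ ν`, to be equipped with the semi-inner product
`⟨f, f'⟩ = ∫_{H \ G} conj (f) f' dν`. -/
def PreInduced : Type _ := equivariantFunctions H χ ν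

instance : AddCommGroup (PreInduced H χ ν) :=
  inferInstanceAs (AddCommGroup (equivariantFunctions H χ ν))

instance : Module ℂ (PreInduced H χ ν) :=
  inferInstanceAs (Module ℂ (equivariantFunctions H χ ν))

variable {H χ ν}

/-- The function on `G` underlying an element of `PreInduced H χ ν`. -/
def PreInduced.fn (f : PreInduced H χ ν) : G → ℂ := Subtype.val f

theorem PreInduced.measurable_fn (f : PreInduced H χ ν) : Measurable f.fn := f.2.1

theorem PreInduced.fn_mul (f : PreInduced H χ ν) (h : H) (g : G) :
    f.fn (h * g) = χ h * f.fn g := f.2.2.1 h g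

theorem PreInduced.memLp (f : PreInduced H χ ν) :
    MemLp (fun q : RightCosets H => ‖f.fn q.out‖) 2 ν := f.2.2.2

theorem PreInduced.fn_add (f f' : PreInduced H χ ν) (g : G) :
    (f + f').fn g = f.fn g + f'.fn g := rfl

theorem PreInduced.fn_smul (c : ℂ) (f : PreInduced H χ ν) (g : G) :
    (c • f).fn g = c * f.fn g := rfl

theorem PreInduced.conj_mul_invariant (f f' : PreInduced H χ ν) (h : H) (g : G) :
    starRingEnd ℂ (f.fn (h * g)) * f'.fn (h * g) = starRingEnd ℂ (f.fn g) * f'.fn g := by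
  have hn : starRingEnd ℂ (χ h : ℂ) * (χ h : ℂ) = 1 := by
    rw [← Complex.normSq_eq_conj_mul_self]; simp
  rw [f.fn_mul, f'.fn_mul, map_mul, mul_mul_mul_comm, hn, one_mul]

theorem PreInduced.measurable_conj_mul (f f' : PreInduced H χ ν) :
    Measurable (fun g => starRingEnd ℂ (f.fn g) * f'.fn g) :=
  (Complex.continuous_conj.measurable.comp f.measurable_fn).mul f'.measurable_fn

theorem PreInduced.measurable_conj_mul_out (f f' : PreInduced H χ ν) :
    Measurable (fun q : RightCosets H => starRingEnd ℂ (f.fn q.out) * f'.fn q.out) :=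
  RightCosets.measurable_comp_out H (PreInduced.measurable_conj_mul f f')
    (PreInduced.conj_mul_invariant f f')

theorem PreInduced.integrable (f f' : PreInduced H χ ν) :
    Integrable (fun q : RightCosets H => starRingEnd ℂ (f.fn q.out) * f'.fn q.out) ν := by
  refine (MemLp.integrable_mul f.memLp f'.memLp).mono
    (PreInduced.measurable_conj_mul_out f f').aestronglyMeasurable ?_
  exact Filter.Eventually.of_forall fun q => by simp

instance : PreInnerProductSpace.Core ℂ (PreInduced H χ ν) where
  inner f f' := ∫ q : RightCosets H, starRingEnd ℂ (f.fn q.out) * f'.fn q.out ∂ν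
  conj_inner_symm f f' := by
    rw [← integral_conj]
    exact integral_congr_ae (Filter.Eventually.of_forall fun q => by simp [mul_comm])
  re_inner_nonneg f := by
    have h : (fun q : RightCosets H => starRingEnd ℂ (f.fn q.out) * f.fn q.out) =
        fun q => ((‖f.fn q.out‖ ^ 2 : ℝ) : ℂ) := by
      funext q
      rw [← Complex.normSq_eq_conj_mul_self, Complex.normSq_eq_norm_sq]
    rw [h, integral_complex_ofReal]
    exact integral_nonneg fun q => by positivity
  add_left f f' f'' := by
    rw [← integral_add (PreInduced.integrable f f'') (PreInduced.integrable f' f'')]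
    exact integral_congr_ae (Filter.Eventually.of_forall fun q => by
      simp [PreInduced.fn_add, add_mul])
  smul_left f f' c := by
    rw [← integral_const_mul]
    exact integral_congr_ae (Filter.Eventually.of_forall fun q => by
      simp [PreInduced.fn_smul, mul_assoc])

instance : SeminormedAddCommGroup (PreInduced H χ ν) :=
  InnerProductSpace.Core.toSeminormedAddCommGroup (𝕜 := ℂ)

instance : InnerProductSpace ℂ (PreInduced H χ ν) := .ofCore _

theorem PreInduced.inner_def (f f' : PreInduced H χ ν) :
    inner ℂ f f' = ∫ q : RightCosets H, starRingEnd ℂ (f.fn q.out) * f'.fn q.out ∂ν := rfl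

/-- Right translation of equivariant functions, `f ↦ f(· g)`. -/
def PreInduced.translate [MeasurableMul G]
    (hν : ∀ g : G, MeasurePreserving (RightCosets.mulRight H g) ν ν) (g : G) :
    PreInduced H χ ν →ₗᵢ[ℂ] PreInduced H χ ν :=
  LinearMap.isometryOfInner
    { toFun := fun f => ⟨fun x => f.fn (x * g), f.measurable_fn.comp (measurable_mul_const g),
        fun h x => by simp only [mul_assoc, f.fn_mul], by
          have h := f.memLp.comp_measurePreserving (hν g)
          have h' : ((fun q : RightCosets H => ‖f.fn q.out‖) ∘ RightCosets.mulRight H g) =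
              fun q => ‖f.fn (q.out * g)‖ := by
            funext q
            exact RightCosets.comp_out_mulRight (P := fun x => ‖f.fn x‖)
              (norm_equivariant f.fn_mul) g q
          rwa [h'] at h⟩
      map_add' := fun _ _ => rfl
      map_smul' := fun _ _ => rfl }
    (by
      intro f f'
      rw [PreInduced.inner_def, PreInduced.inner_def,
        ← integral_comp_of_measurePreserving (hν g) (PreInduced.measurable_conj_mul_out f f')]
      refine integral_congr_ae (Filter.Eventually.of_forall fun q => ?_)
      exact (RightCosets.comp_out_mulRight
        (P := fun x => starRingEnd ℂ (f.fn x) * f'.fn x)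
        (PreInduced.conj_mul_invariant f f') g q).symm)

theorem PreInduced.fn_translate [MeasurableMul G]
    (hν : ∀ g : G, MeasurePreserving (RightCosets.mulRight H g) ν ν) (g : G)
    (f : PreInduced H χ ν) (x : G) : (PreInduced.translate hν g f).fn x = f.fn (x * g) := rfl

theorem PreInduced.ext_fn {f f' : PreInduced H χ ν} (h : ∀ x, f.fn x = f'.fn x) : f = f' :=
  Subtype.ext (funext h)

variable (H χ ν)

/-- The Hilbert space of the unitarily induced representation `Ind_H^G χ`: the functions in
`equivariantFunctions H χ ν` modulo those of norm `0`. -/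
abbrev Induced : Type _ := SeparationQuotient (PreInduced H χ ν)

variable {H ν}

/-- Right translation on `Induced H χ ν`. -/
def Induced.translate [MeasurableMul G]
    (hν : ∀ g : G, MeasurePreserving (RightCosets.mulRight H g) ν ν) (g : G) :
    Induced H χ ν →ₗᵢ[ℂ] Induced H χ ν where
  toLinearMap := (SeparationQuotient.liftCLM
    ((SeparationQuotient.mkCLM ℂ (PreInduced H χ ν)).comp
      (PreInduced.translate (χ := χ) hν g).toContinuousLinearMap)
    (fun f f' h => SeparationQuotient.mk_eq_mk.2
      (h.map (PreInduced.translate (χ := χ) hν g).continuous))).toLinearMap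
  norm_map' f := by
    obtain ⟨f, rfl⟩ := SeparationQuotient.surjective_mk f
    exact (PreInduced.translate (χ := χ) hν g).norm_map f

theorem Induced.translate_mk [MeasurableMul G]
    (hν : ∀ g : G, MeasurePreserving (RightCosets.mulRight H g) ν ν) (g : G)
    (f : PreInduced H χ ν) : Induced.translate χ hν g (SeparationQuotient.mk f) =
      SeparationQuotient.mk (PreInduced.translate hν g f) := rfl

/-- The unitarily induced representation `Ind_H^G χ`: `G` acts by right translations,
`(g · f)(x) = f(x g)`. -/
def inducedRep [MeasurableMul G]
    (hν : ∀ g : G, MeasurePreserving (RightCosets.mulRight H g) ν ν) :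
    G →* (Induced H χ ν ≃ₗᵢ[ℂ] Induced H χ ν) :=
  unitaryRepOfIsometries (Induced.translate χ hν)
    (by
      intro f
      obtain ⟨f, rfl⟩ := SeparationQuotient.surjective_mk f
      rw [Induced.translate_mk]
      exact congrArg _ (PreInduced.ext_fn fun x => by simp [PreInduced.fn_translate]))
    (by
      intro g g' f
      obtain ⟨f, rfl⟩ := SeparationQuotient.surjective_mk f
      simp only [Induced.translate_mk]
      exact congrArg _ (PreInduced.ext_fn fun x => by
        simp [PreInduced.fn_translate, mul_assoc]))

end Induced

/-! ### The group `G = 𝔾_a ⋊_φ 𝔾_m` -/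

section SemidirectGroup

open scoped LaurentPolynomial TensorProduct

/-- A homomorphism `φ : 𝔾_m → GL₁` of algebraic groups over `F`, given by the group homomorphisms
`Rˣ → Rˣ`, natural in the commutative `F`-algebra `R`, on points. -/
structure MultCharacter (F : Type u) [Field F] where
  app : ∀ (R : Type u) [CommRing R] [Algebra F R], Rˣ →* Rˣ
  naturality : ∀ {R S : Type u} [CommRing R] [CommRing S] [Algebra F R] [Algebra F S]
    (f : R →ₐ[F] S) (a : Rˣ),
    Units.map (f : R →* S) (app R a) = app S (Units.map (f : R →* S) a)

theorem MultCharacter.exists_zpow {F : Type u} [Field F] (φ : MultCharacter F) :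
    ∃ d : ℤ, ∀ (R : Type u) [CommRing R] [Algebra F R] (a : Rˣ), φ.app R a = a ^ d := by
  let t : (F[T;T⁻¹])ˣ := (LaurentPolynomial.isUnit_T (R := F) 1).unit
  have ht : (t : F[T;T⁻¹]) = LaurentPolynomial.T 1 := rfl
  have hnat : ∀ {R S : Type u} [CommRing R] [CommRing S] [Algebra F R] [Algebra F S]
    (f : R →ₐ[F] S) (a : Rˣ) (b : Sˣ), f a = b → f (φ.app R a) = φ.app S b := by
    intro R S _ _ _ _ f a b h
    have hb : Units.map (f : R →* S) a = b := Units.ext h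
    rw [← hb, ← φ.naturality]; rfl
  have hg : IsGroupLikeElem F (φ.app _ t : F[T;T⁻¹]) := by
    constructor
    · have := hnat (Bialgebra.counitAlgHom F F[T;T⁻¹]) t 1 (by simp [ht])
      simpa using this
    · let i1 : F[T;T⁻¹] →ₐ[F] F[T;T⁻¹] ⊗[F] F[T;T⁻¹] := Algebra.TensorProduct.includeLeft
      let i2 : F[T;T⁻¹] →ₐ[F] F[T;T⁻¹] ⊗[F] F[T;T⁻¹] := Algebra.TensorProduct.includeRight
      have h1 := hnat i1 t (Units.map (i1 : _ →* _) t) rfl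
      have h2 := hnat i2 t (Units.map (i2 : _ →* _) t) rfl
      have h := hnat (Bialgebra.comulAlgHom F F[T;T⁻¹]) t
        (Units.map (i1 : _ →* _) t * Units.map (i2 : _ →* _) t) (by simp [ht, i1, i2])
      rw [map_mul, Units.val_mul, ← h1, ← h2] at h
      simpa [i1, i2] using h
  obtain ⟨d, hd⟩ := AddMonoidAlgebra.isGroupLikeElem_iff_mem_range_of.1 hg
  refine ⟨Multiplicative.toAdd d, fun R _ _ a => Units.ext ?_⟩
  let e : F[T;T⁻¹] →ₐ[F] R :=
    { LaurentPolynomial.eval₂ (algebraMap F R) a with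
      commutes' := fun r => LaurentPolynomial.eval₂_C (algebraMap F R) a r }
  have he : ∀ n : ℤ, e (LaurentPolynomial.T n) = (a ^ n : Rˣ) := fun n =>
    LaurentPolynomial.eval₂_T (algebraMap F R) a n
  rw [← hnat e t a (by rw [ht, he, zpow_one]), ← hd]
  exact he _

/-- The group `G(R)` of `R`-points of `G = 𝔾_a ⋊_φ 𝔾_m`: pairs `(x, a)` with `x ∈ R`, `a ∈ Rˣ`. -/
@[ext]
structure GPoints {F : Type u} [Field F] (φ : MultCharacter F) (R : Type u) [CommRing R]
    [Algebra F R] where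
  x : R
  a : Rˣ

variable {F : Type u} [Field F] (φ : MultCharacter F)

/-- The group law `(x, a) (y, b) = (x + φ(a) y, a b)`. -/
instance (R : Type u) [CommRing R] [Algebra F R] : Mul (GPoints φ R) :=
  ⟨fun g h => ⟨g.x + φ.app R g.a * h.x, g.a * h.a⟩⟩

instance (R : Type u) [CommRing R] [Algebra F R] : One (GPoints φ R) := ⟨⟨0, 1⟩⟩

instance (R : Type u) [CommRing R] [Algebra F R] : Inv (GPoints φ R) :=
  ⟨fun g => ⟨-(((φ.app R g.a)⁻¹ : Rˣ) * g.x), g.a⁻¹⟩⟩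

@[simp] theorem GPoints.mul_x {R : Type u} [CommRing R] [Algebra F R] (g h : GPoints φ R) :
    (g * h).x = g.x + φ.app R g.a * h.x := rfl

@[simp] theorem GPoints.mul_a {R : Type u} [CommRing R] [Algebra F R] (g h : GPoints φ R) :
    (g * h).a = g.a * h.a := rfl

@[simp] theorem GPoints.one_x {R : Type u} [CommRing R] [Algebra F R] :
    (1 : GPoints φ R).x = 0 := rfl

@[simp] theorem GPoints.one_a {R : Type u} [CommRing R] [Algebra F R] :
    (1 : GPoints φ R).a = 1 := rfl

@[simp] theorem GPoints.inv_x {R : Type u} [CommRing R] [Algebra F R] (g : GPoints φ R) :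
    (g⁻¹).x = -(((φ.app R g.a)⁻¹ : Rˣ) * g.x) := rfl

@[simp] theorem GPoints.inv_a {R : Type u} [CommRing R] [Algebra F R] (g : GPoints φ R) :
    (g⁻¹).a = g.a⁻¹ := rfl

instance (R : Type u) [CommRing R] [Algebra F R] : Group (GPoints φ R) :=
  Group.ofLeftAxioms
    (fun g h k => by
      ext
      · simp [mul_add, mul_assoc, add_assoc]
      · simp [mul_assoc])
    (fun g => by ext <;> simp)
    (fun g => by ext <;> simp)

/-- The projection `G(R) → T(R) = Rˣ`. -/
def GPoints.toTorus (R : Type u) [CommRing R] [Algebra F R] : GPoints φ R →* Rˣ where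
  toFun g := g.a
  map_one' := rfl
  map_mul' _ _ := rfl

/-- The map `G(R) → G(S)` induced by `R → S`. -/
def GPoints.map {R S : Type u} [CommRing R] [Algebra F R] [CommRing S] [Algebra F S]
    (f : R →ₐ[F] S) : GPoints φ R →* GPoints φ S where
  toFun g := ⟨f g.x, Units.map (f : R →* S) g.a⟩
  map_one' := by ext <;> simp
  map_mul' g h := by
    ext
    · simp only [GPoints.mul_x, map_add, map_mul, add_right_inj, ← φ.naturality]
      rfl
    · simp

end SemidirectGroup

/-! ### Adelic points -/

section Adelic

variable (F : Type u) [Field F] [NumberField F]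

/-- The adele ring `𝔸_F`. -/
abbrev Adeles : Type u := AdeleRing (𝓞 F) F

instance : MeasurableSpace (Adeles F) := borel _

instance : BorelSpace (Adeles F) := ⟨rfl⟩

/-- The group of ideles `T(𝔸_F) = 𝔸_Fˣ`, with the usual topology of the group of units (not
the subspace topology of `𝔸_F`) and its Borel σ-algebra. -/
def Ideles : Type u := (Adeles F)ˣ

instance : CommGroup (Ideles F) := inferInstanceAs (CommGroup (Adeles F)ˣ)

instance : TopologicalSpace (Ideles F) := inferInstanceAs (TopologicalSpace (Adeles F)ˣ)

instance : IsTopologicalGroup (Ideles F) := inferInstanceAs (IsTopologicalGroup (Adeles F)ˣ)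

instance : MeasurableSpace (Ideles F) := borel _

instance : BorelSpace (Ideles F) := ⟨rfl⟩

/-- `F^× → 𝔸_F^×`. -/
def principalIdele : Fˣ →* Ideles F := Units.map (algebraMap F (Adeles F) : F →* Adeles F)

/-- `T(F)` as a subgroup of `T(𝔸_F)`. -/
def principalIdeles : Subgroup (Ideles F) := (principalIdele F).range

/-- The trace `F_∞ = ∏_{v ∣ ∞} F_v → ℝ`. -/
def infiniteTrace (x : InfiniteAdeleRing F) : ℝ :=
  ∑ v : InfinitePlace F, v.mult * (InfinitePlace.Completion.extensionEmbedding v (x v)).re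

/-- For a finite adele `x`, an element `y ∈ F` such that `x - y` is integral at all finite
places. -/
def finiteAdelePolarPart (x : IsDedekindDomain.FiniteAdeleRing (𝓞 F) F) : F :=
  Classical.epsilon fun y : F => ∀ v : IsDedekindDomain.HeightOneSpectrum (𝓞 F),
    (x - algebraMap F _ y) v ∈ v.adicCompletionIntegers F

/-- The standard character `ψ = ∏_v ψ_v` of `𝔸_F / F`. Here `ψ_v(x) = exp(-2πi Tr(x))` at the
infinite places and `ψ_v(x) = exp(2πi {Tr_{F_v / ℚ_p} x}_p)` at the finite places `v ∣ p`, where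
`{·}_p` is the `p`-adic fractional part. Since `ψ_v` is trivial on the integers of `F_v` for finite
`v`, and since `∑_p {q}_p ≡ q` modulo `ℤ` for `q ∈ ℚ`, the product of the finite components at
`x` is `exp(2πi Tr_{F / ℚ} y)` for any `y ∈ F` such that `x - y` is integral at all finite
places. -/
def standardCharacter (x : Adeles F) : Circle :=
  Circle.exp (2 * Real.pi *
    ((Algebra.trace ℚ F (finiteAdelePolarPart F x.2) : ℝ) - infiniteTrace F x.1))

variable {F} (φ : MultCharacter F)

/-- The group `G(𝔸_F)`. -/
abbrev GAdelic : Type u := GPoints φ (Adeles F)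

/-- The idele `a` of `(x, a) ∈ G(𝔸_F)`. -/
def GAdelic.idele (g : GAdelic φ) : Ideles F := g.a

/-- The product topology on `G(𝔸_F) = 𝔸_F × 𝔸_F^×`. -/
instance : TopologicalSpace (GAdelic φ) :=
  TopologicalSpace.induced (fun g => (g.x, GAdelic.idele φ g)) inferInstance

instance : MeasurableSpace (GAdelic φ) := borel _

instance : BorelSpace (GAdelic φ) := ⟨rfl⟩

theorem GAdelic.continuous_pair :
    Continuous (fun g : GAdelic φ => (g.x, GAdelic.idele φ g)) := continuous_induced_dom

theorem GAdelic.continuous_x : Continuous (fun g : GAdelic φ => g.x) :=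
  continuous_fst.comp (GAdelic.continuous_pair φ)

theorem GAdelic.continuous_idele : Continuous (GAdelic.idele φ) :=
  continuous_snd.comp (GAdelic.continuous_pair φ)

theorem GAdelic.continuous_app :
    Continuous (fun a : Ideles F => (φ.app (Adeles F) a : Adeles F)) := by
  obtain ⟨d, hd⟩ := φ.exists_zpow
  have h : (fun a : Ideles F => (φ.app (Adeles F) a : Adeles F)) =
      Units.val ∘ fun a : (Adeles F)ˣ => a ^ d := by
    funext a
    exact congrArg Units.val (hd _ a)
  rw [h]
  exact Units.continuous_val.comp (continuous_zpow d)

theorem GAdelic.continuous_of {X : Type*} [TopologicalSpace X] {f : X → GAdelic φ}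
    (h1 : Continuous fun y => (f y).x) (h2 : Continuous fun y => GAdelic.idele φ (f y)) :
    Continuous f :=
  continuous_induced_rng.2 (h1.prodMk h2)

theorem GAdelic.continuous_mul_left (g : GAdelic φ) : Continuous (fun h : GAdelic φ => g * h) :=
  GAdelic.continuous_of φ
    (continuous_const.add (continuous_const.mul (GAdelic.continuous_x φ)))
    ((continuous_const_mul (GAdelic.idele φ g)).comp (GAdelic.continuous_idele φ))

theorem GAdelic.continuous_mul_right (g : GAdelic φ) : Continuous (fun h : GAdelic φ => h * g) :=
  GAdelic.continuous_of φ
    ((GAdelic.continuous_x φ).add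
      (((GAdelic.continuous_app φ).comp (GAdelic.continuous_idele φ)).mul continuous_const))
    ((continuous_mul_const (GAdelic.idele φ g)).comp (GAdelic.continuous_idele φ))

instance : MeasurableMul (GAdelic φ) where
  measurable_const_mul g := (GAdelic.continuous_mul_left φ g).measurable
  measurable_mul_const g := (GAdelic.continuous_mul_right φ g).measurable

/-- The right Haar measure `dg = dx da^×` on `G(𝔸_F)`. -/
def rightHaar (μN : Measure (Adeles F)) (μT : Measure (Ideles F)) : Measure (GAdelic φ) :=
  (μN.prod μT).map fun p => ⟨p.1, p.2⟩

/-- `G(F)` as a subgroup of `G(𝔸_F)`. -/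
def rationalPoints : Subgroup (GAdelic φ) :=
  (GPoints.map φ (Algebra.ofId F (Adeles F))).range

/-- `W = ker (φ : F^× → F^×)`. -/
def kernelW : Subgroup Fˣ := (φ.app F).ker

/-- The subgroup `N(𝔸_F) × W = {(x, w)}` of `G(𝔸_F)`. -/
def subgroupNW : Subgroup (GAdelic φ) :=
  Subgroup.comap (GPoints.toTorus φ (Adeles F)) ((kernelW φ).map (principalIdele F))

/-- The Haar measure on `N(𝔸_F) × W`, the product of `dx` and the counting measure. -/
def haarNW (μN : Measure (Adeles F)) : Measure (subgroupNW φ) :=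
  Measure.sum fun w : kernelW φ =>
    μN.map fun x => ⟨⟨x, principalIdele F w⟩, Subgroup.mem_map_of_mem _ w.2⟩

/-- The character `(x, w) ↦ ψ_n(x) = ψ(n x)` of `N(𝔸_F) × W`. -/
def characterNW (n : Fˣ) (h : subgroupNW φ) : Circle :=
  standardCharacter F (algebraMap F (Adeles F) n * h.1.x)

/-- The representation of `G(𝔸_F)` on `L²(T(F) \ T(𝔸_F))` through `G(𝔸_F) → T(𝔸_F)`. -/
def torusRep {ν : Measure (RightCosets (principalIdeles F))}
    (hν : ∀ b : Ideles F, MeasurePreserving (RightCosets.mulRight (principalIdeles F) b) ν ν) :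
    GAdelic φ →* (Lp ℂ 2 ν ≃ₗᵢ[ℂ] Lp ℂ 2 ν) :=
  (rightRegular (principalIdeles F) hν).comp (GPoints.toTorus φ (Adeles F))

end Adelic

end

noncomputable section

section AdeleTopology

open IsDedekindDomain HeightOneSpectrum

variable (F : Type u) [Field F] [NumberField F]

theorem NumberField.countable : Countable F :=
  (Module.finBasis ℚ F).equivFun.injective.countable

theorem NumberField.countable_heightOneSpectrum : Countable (HeightOneSpectrum (𝓞 F)) := by
  have := NumberField.countable F
  have : Countable (𝓞 F) := RingOfIntegers.coe_injective.countable
  have h : ∀ I : Ideal (𝓞 F), ∃ s : Finset (𝓞 F), Ideal.span (s : Set (𝓞 F)) = I :=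
    fun I => (isNoetherianRing_iff_ideal_fg _).1 inferInstance I
  choose s hs using h
  have hinj : Function.Injective fun v : HeightOneSpectrum (𝓞 F) => s v.asIdeal := by
    intro v w h
    ext1
    rw [← hs v.asIdeal, ← hs w.asIdeal]
    exact congrArg (fun t : Finset (𝓞 F) => Ideal.span (t : Set (𝓞 F))) h
  exact hinj.countable

variable {F}

theorem valued_algebraMap (v : HeightOneSpectrum (𝓞 F)) (k : F) :
    Valued.v (algebraMap F (v.adicCompletion F) k) = v.valuation F k := by
  rw [algebraMap_adicCompletion]
  exact valuedAdicCompletion_eq_valuation' v k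

theorem algebraMap_mem_adicCompletionIntegers (v : HeightOneSpectrum (𝓞 F)) (a : 𝓞 F) :
    algebraMap F (v.adicCompletion F) a ∈ v.adicCompletionIntegers F := by
  rw [mem_adicCompletionIntegers, valued_algebraMap]
  exact valuation_le_one v a

/-- An element of `O_v` is approximated by algebraic integers. -/
theorem exists_ringOfIntegers_valued_sub_le (v : HeightOneSpectrum (𝓞 F)) {x : v.adicCompletion F}
    (hx : x ∈ v.adicCompletionIntegers F) {c : 𝓞 F} (hc : c ≠ 0) :
    ∃ a : 𝓞 F, Valued.v (x - algebraMap F (v.adicCompletion F) a) ≤ v.intValuation c := by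
  have hc' : algebraMap F (v.adicCompletion F) c ≠ 0 := by simpa using hc
  have hvc : Valued.v (algebraMap F (v.adicCompletion F) c) = v.intValuation c := by
    rw [valued_algebraMap]; exact valuation_of_algebraMap v c
  obtain ⟨k, hk⟩ : ∃ k : F, Valued.v (x - algebraMap F (v.adicCompletion F) k) ≤
      v.intValuation c := by
    have hopen : IsOpen ((fun y : v.adicCompletion F =>
        (x - y) * (algebraMap F (v.adicCompletion F) c)⁻¹) ⁻¹'
          (v.adicCompletionIntegers F : Set (v.adicCompletion F))) :=
      (Valued.isOpen_valuationSubring _).preimage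
        ((continuous_const.sub continuous_id).mul continuous_const)
    obtain ⟨k, hk⟩ := (HeightOneSpectrum.denseRange_algebraMap F v).exists_mem_open hopen
      ⟨x, by
        change (x - x) * _ ∈ v.adicCompletionIntegers F
        rw [sub_self, zero_mul]
        exact zero_mem _⟩
    refine ⟨k, ?_⟩
    have hk' : Valued.v ((x - algebraMap F (v.adicCompletion F) k) *
      (algebraMap F (v.adicCompletion F) c)⁻¹) ≤ 1 := hk
    rw [map_mul, map_inv₀, ← div_eq_mul_inv] at hk'
    rw [← hvc]
    exact (div_le_one₀ (zero_lt_iff.2 ((Valuation.ne_zero_iff _).2 hc'))).1 hk'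
  have hk1 : v.valuation F k ≤ 1 := by
    rw [← valued_algebraMap]
    have : algebraMap F (v.adicCompletion F) k = x - (x - algebraMap F (v.adicCompletion F) k) := by
      ring
    rw [this]
    exact (Valuation.map_sub _ _ _).trans (max_le hx (hk.trans (v.intValuation_le_one c)))
  obtain ⟨a, ha⟩ := v.exists_valuation_sub_lt_of_integer hk1
    (Units.mk0 (v.intValuation c) (v.intValuation_ne_zero c hc))
  refine ⟨a, ?_⟩
  have : x - algebraMap F (v.adicCompletion F) a =
      (x - algebraMap F (v.adicCompletion F) k) - algebraMap F (v.adicCompletion F) (a - k) := by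
    rw [map_sub]; ring
  rw [this]
  refine (Valuation.map_sub _ _ _).trans (max_le hk ?_)
  rw [valued_algebraMap]
  exact ha.le

theorem finite_residueField_adicCompletionIntegers (v : HeightOneSpectrum (𝓞 F)) :
    Finite (IsLocalRing.ResidueField (v.adicCompletionIntegers F)) := by
  let i : 𝓞 F →+* v.adicCompletionIntegers F :=
    ((algebraMap F (v.adicCompletion F)).comp (algebraMap (𝓞 F) F)).codRestrict
      (v.adicCompletionIntegers F).toSubring (algebraMap_mem_adicCompletionIntegers v)
  let r := (IsLocalRing.residue (v.adicCompletionIntegers F)).comp i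
  have hmem : ∀ y : v.adicCompletionIntegers F, Valued.v (y : v.adicCompletion F) < 1 →
      IsLocalRing.residue (v.adicCompletionIntegers F) y = 0 := by
    intro y hy
    rw [IsLocalRing.residue_eq_zero_iff, IsLocalRing.mem_maximalIdeal, mem_nonunits_iff,
      adicCompletionIntegers.isUnit_iff_valued_eq_one]
    exact hy.ne
  obtain ⟨c, hc⟩ := v.intValuation_exists_uniformizer
  have hc0 : c ≠ 0 := by
    rintro rfl
    rw [map_zero] at hc
    exact WithZero.exp_ne_zero hc.symm
  have hlt : v.intValuation c < 1 := by
    rw [hc]; decide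
  have hr : Function.Surjective r := by
    intro y
    obtain ⟨y, rfl⟩ := IsLocalRing.residue_surjective y
    obtain ⟨a, ha⟩ := exists_ringOfIntegers_valued_sub_le v y.2 hc0
    refine ⟨a, ?_⟩
    have := hmem (y - i a) (ha.trans_lt hlt)
    rw [map_sub, sub_eq_zero] at this
    exact this.symm
  have hker : RingHom.ker r ≠ ⊥ := by
    intro h
    have hcr : c ∈ RingHom.ker r := by
      refine hmem (i c) ?_
      change Valued.v (algebraMap F (v.adicCompletion F) c) < 1
      rw [valued_algebraMap]
      exact (valuation_of_algebraMap v c).trans_lt hlt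
    rw [h] at hcr
    exact hc0 hcr
  have := Ideal.finiteQuotientOfFreeOfNeBot _ hker
  exact Finite.of_equiv _ (RingHom.quotientKerEquivOfSurjective hr).toEquiv

instance compactSpace_adicCompletionIntegers (v : HeightOneSpectrum (𝓞 F)) :
    CompactSpace (v.adicCompletionIntegers F) := by
  refine (Valued.integer.compactSpace_iff_completeSpace_and_isDiscreteValuationRing_and_finite_residueField
    (K := v.adicCompletion F) (Γ₀ := WithZero (Multiplicative ℤ))).2 ⟨?_,
      inferInstanceAs (IsDiscreteValuationRing (v.adicCompletionIntegers F)),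
      finite_residueField_adicCompletionIntegers v⟩
  exact (Valued.isClosed_valuationSubring (v.adicCompletion F)).completeSpace_coe

theorem finite_setOf_intValuation_lt_one {m : 𝓞 F} (hm : m ≠ 0) :
    {v : HeightOneSpectrum (𝓞 F) | v.intValuation m < 1}.Finite := by
  have := Ideal.finite_factors (I := Ideal.span {m}) (by simpa using hm)
  simpa only [intValuation_lt_one_iff_dvd] using this

/-- Every finite adele is the sum of an element of `F` and an everywhere integral adele. -/
theorem exists_sub_algebraMap_mem_adicCompletionIntegers (x : FiniteAdeleRing (𝓞 F) F) :
    ∃ y : F, ∀ v : HeightOneSpectrum (𝓞 F),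
      (x - algebraMap F _ y) v ∈ v.adicCompletionIntegers F := by
  classical
  obtain ⟨m, hm0, hm⟩ : ∃ m : 𝓞 F, m ≠ 0 ∧ ∀ v : HeightOneSpectrum (𝓞 F),
      x v * algebraMap F (v.adicCompletion F) m ∈ v.adicCompletionIntegers F := by
    have hfin : {v : HeightOneSpectrum (𝓞 F) | ¬ x v ∈ v.adicCompletionIntegers F}.Finite := x.2
    choose b hb hxb using fun v : HeightOneSpectrum (𝓞 F) =>
      adicCompletion.mul_nonZeroDivisor_mem_adicCompletionIntegers v (x v)
    refine ⟨∏ v ∈ hfin.toFinset, b v,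
      Finset.prod_ne_zero_iff.2 fun v _ => nonZeroDivisors.ne_zero (hb v), fun v => ?_⟩
    by_cases hv : x v ∈ v.adicCompletionIntegers F
    · exact mul_mem hv (algebraMap_mem_adicCompletionIntegers v _)
    · rw [← Finset.mul_prod_erase _ _ (hfin.mem_toFinset.2 hv), RingOfIntegers.coe_eq_algebraMap,
        map_mul, map_mul, ← mul_assoc]
      exact mul_mem (hxb v) (algebraMap_mem_adicCompletionIntegers v _)
  have hT := finite_setOf_intValuation_lt_one hm0
  choose a ha using fun v => exists_ringOfIntegers_valued_sub_le v (hm v) hm0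
  choose e he using fun v : HeightOneSpectrum (𝓞 F) =>
    WithZero.exists_exp_neg_natCast_lt (v.intValuation_ne_zero m hm0)
  obtain ⟨r, hr⟩ := IsDedekindDomain.exists_forall_sub_mem_ideal
    (s := hT.toFinset) (fun v => v.asIdeal) e (fun v _ => v.prime)
    (fun v _ w _ h hvw => h (HeightOneSpectrum.ext hvw)) (fun v => a v)
  have hmF : (algebraMap (𝓞 F) F m) ≠ 0 := by simpa using hm0
  refine ⟨algebraMap (𝓞 F) F r / algebraMap (𝓞 F) F m, fun v => ?_⟩
  have hm' : algebraMap F (v.adicCompletion F) (algebraMap (𝓞 F) F m) ≠ 0 := by simpa using hm0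
  have hvm : Valued.v (algebraMap F (v.adicCompletion F) m) = v.intValuation m := by
    rw [valued_algebraMap]; exact valuation_of_algebraMap v m
  have hx : (x - algebraMap F _ (algebraMap (𝓞 F) F r / algebraMap (𝓞 F) F m)) v =
      (x v * algebraMap F (v.adicCompletion F) m - algebraMap F (v.adicCompletion F) r) *
        (algebraMap F (v.adicCompletion F) m)⁻¹ := by
    have h1 : (x - algebraMap F _ (algebraMap (𝓞 F) F r / algebraMap (𝓞 F) F m)) v =
      x v - algebraMap F (v.adicCompletion F) (algebraMap (𝓞 F) F r / algebraMap (𝓞 F) F m) := rfl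
    rw [h1, map_div₀]
    field_simp
  rw [hx, mem_adicCompletionIntegers, map_mul, map_inv₀, ← div_eq_mul_inv]
  refine (div_le_one₀ (zero_lt_iff.2 ((Valuation.ne_zero_iff _).2 hm'))).2 ?_
  rw [hvm]
  by_cases hv : v.intValuation m < 1
  · have h2 : v.intValuation (r - a v) ≤ v.intValuation m :=
      ((v.intValuation_le_pow_iff_mem _ _).2 (hr v (hT.mem_toFinset.2 hv))).trans (he v).le
    have h3 : x v * algebraMap F (v.adicCompletion F) m - algebraMap F (v.adicCompletion F) r =
        (x v * algebraMap F (v.adicCompletion F) m - algebraMap F (v.adicCompletion F) (a v)) -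
          algebraMap F (v.adicCompletion F) ((r - a v : 𝓞 F) : F) := by
      rw [show ((r - a v : 𝓞 F) : F) = (r : F) - (a v : F) from map_sub _ _ _, map_sub]
      ring
    rw [h3]
    refine (Valuation.map_sub _ _ _).trans (max_le (ha v) ?_)
    rw [valued_algebraMap]
    exact (valuation_of_algebraMap v _).trans_le h2
  · have h1 : v.intValuation m = 1 := le_antisymm (v.intValuation_le_one m) (not_lt.1 hv)
    rw [h1]
    exact sub_mem (hm v) (algebraMap_mem_adicCompletionIntegers v r)

end AdeleTopology
section AdeleTopology

open IsDedekindDomain HeightOneSpectrum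

variable (F : Type u) [Field F] [NumberField F]

instance secondCountableTopology_adicCompletion (v : HeightOneSpectrum (𝓞 F)) :
    SecondCountableTopology (v.adicCompletion F) := by
  have := NumberField.countable F
  have h1 : (uniformity (v.adicCompletion F)).IsCountablyGenerated :=
    @EMetric.instIsCountablyGeneratedUniformity (v.adicCompletion F)
      (HeightOneSpectrum.instNormedFieldValuedAdicCompletion F v).toPseudoMetricSpace.toPseudoEMetricSpace
  have h2 : TopologicalSpace.SeparableSpace (v.adicCompletion F) :=
    ⟨⟨_, Set.countable_range _, HeightOneSpectrum.denseRange_algebraMap F v⟩⟩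
  exact UniformSpace.secondCountable_of_separable _

theorem isOpenEmbedding_integralFiniteAdeles :
    Topology.IsOpenEmbedding (fun x : (v : HeightOneSpectrum (𝓞 F)) → v.adicCompletionIntegers F =>
      (RestrictedProduct.structureMap (fun v : HeightOneSpectrum (𝓞 F) => v.adicCompletion F)
        (fun v => (v.adicCompletionIntegers F : Set (v.adicCompletion F))) Filter.cofinite x :
          FiniteAdeleRing (𝓞 F) F)) :=
  RestrictedProduct.isOpenEmbedding_structureMap fun _ => Valued.isOpen_valuationSubring _

/-- The integral finite adeles. -/
def integralFiniteAdeles : Set (FiniteAdeleRing (𝓞 F) F) :=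
  {x | ∀ v, x v ∈ v.adicCompletionIntegers F}

theorem range_integralFiniteAdeles :
    Set.range (fun x : (v : HeightOneSpectrum (𝓞 F)) → v.adicCompletionIntegers F =>
      (RestrictedProduct.structureMap (fun v : HeightOneSpectrum (𝓞 F) => v.adicCompletion F)
        (fun v => (v.adicCompletionIntegers F : Set (v.adicCompletion F))) Filter.cofinite x :
          FiniteAdeleRing (𝓞 F) F)) = integralFiniteAdeles F := by
  ext x
  constructor
  · rintro ⟨y, rfl⟩ v
    exact (y v).2
  · intro h
    exact ⟨fun v => ⟨x v, h v⟩, rfl⟩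

theorem isOpen_integralFiniteAdeles : IsOpen (integralFiniteAdeles F) := by
  rw [← range_integralFiniteAdeles]
  exact (isOpenEmbedding_integralFiniteAdeles F).isOpen_range

theorem isCompact_integralFiniteAdeles : IsCompact (integralFiniteAdeles F) := by
  rw [← range_integralFiniteAdeles]
  exact isCompact_range (isOpenEmbedding_integralFiniteAdeles F).continuous

instance : SecondCountableTopology (FiniteAdeleRing (𝓞 F) F) := by
  have := NumberField.countable F
  have := NumberField.countable_heightOneSpectrum F
  have h0 : SecondCountableTopology (integralFiniteAdeles F) := by
    rw [← range_integralFiniteAdeles]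
    exact (isOpenEmbedding_integralFiniteAdeles F).toIsEmbedding.toHomeomorph.symm.secondCountableTopology
  have h1 : ∀ y : F, SecondCountableTopology
      ((Homeomorph.addRight (algebraMap F (FiniteAdeleRing (𝓞 F) F) y)) ''
        integralFiniteAdeles F) := fun y =>
    ((Homeomorph.addRight (algebraMap F (FiniteAdeleRing (𝓞 F) F) y)).image
      (integralFiniteAdeles F)).symm.secondCountableTopology
  refine TopologicalSpace.secondCountableTopology_of_countable_cover
    (U := fun y : F => (Homeomorph.addRight (algebraMap F (FiniteAdeleRing (𝓞 F) F) y)) ''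
        integralFiniteAdeles F)
    (fun y => (Homeomorph.isOpenMap _) _ (isOpen_integralFiniteAdeles F)) ?_
  refine Set.eq_univ_of_forall fun x => ?_
  obtain ⟨y, hy⟩ := exists_sub_algebraMap_mem_adicCompletionIntegers x
  exact Set.mem_iUnion.2 ⟨y, _, hy, by simp⟩

instance : T2Space (FiniteAdeleRing (𝓞 F) F) :=
  inferInstanceAs (T2Space (RestrictedProduct
    (fun v : HeightOneSpectrum (𝓞 F) => v.adicCompletion F)
    (fun v => (v.adicCompletionIntegers F : Set (v.adicCompletion F))) Filter.cofinite))

instance : LocallyCompactSpace (FiniteAdeleRing (𝓞 F) F) := by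
  have : Fact (∀ v : HeightOneSpectrum (𝓞 F),
      IsOpen (v.adicCompletionIntegers F : Set (v.adicCompletion F))) :=
    ⟨fun _ ↦ Valued.isOpen_valuationSubring _⟩
  exact inferInstanceAs (LocallyCompactSpace (RestrictedProduct
    (fun v : HeightOneSpectrum (𝓞 F) => v.adicCompletion F)
    (fun v => (v.adicCompletionIntegers F : Set (v.adicCompletion F))) Filter.cofinite))

instance (v : InfinitePlace F) : SecondCountableTopology v.Completion :=
  (InfinitePlace.Completion.isometry_extensionEmbedding v).isEmbedding.isInducing.secondCountableTopology

instance : T2Space (InfiniteAdeleRing F) :=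
  inferInstanceAs (T2Space ((v : InfinitePlace F) → v.Completion))

instance : SecondCountableTopology (InfiniteAdeleRing F) :=
  inferInstanceAs (SecondCountableTopology ((v : InfinitePlace F) → v.Completion))

instance : T2Space (Adeles F) :=
  inferInstanceAs (T2Space (InfiniteAdeleRing F × FiniteAdeleRing (𝓞 F) F))

instance : LocallyCompactSpace (Adeles F) :=
  inferInstanceAs (LocallyCompactSpace (InfiniteAdeleRing F × FiniteAdeleRing (𝓞 F) F))

instance : SecondCountableTopology (Adeles F) :=
  inferInstanceAs (SecondCountableTopology (InfiniteAdeleRing F × FiniteAdeleRing (𝓞 F) F))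

theorem polishSpace_of_locallyCompact (G : Type*) [AddCommGroup G] [TopologicalSpace G]
    [IsTopologicalAddGroup G] [T2Space G] [LocallyCompactSpace G] [SecondCountableTopology G] :
    PolishSpace G := by
  let := IsTopologicalAddGroup.rightUniformSpace G
  have := isUniformAddGroup_of_addCommGroup (G := G)
  have : (uniformity G).IsCountablyGenerated := IsUniformAddGroup.uniformity_countably_generated
  have : CompleteSpace G := IsRightUniformAddGroup.completeSpace_of_weaklyLocallyCompactSpace
  infer_instance

instance : PolishSpace (Adeles F) := polishSpace_of_locallyCompact _

instance : SecondCountableTopology (Ideles F) :=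
  have : SecondCountableTopology (Adeles F)ᵐᵒᵖ :=
    MulOpposite.opHomeomorph.symm.secondCountableTopology
  (Units.isEmbedding_embedProduct (M := Adeles F)).secondCountableTopology

instance : LocallyCompactSpace (Ideles F) :=
  (Units.isClosedEmbedding_embedProduct (α := Adeles F)).locallyCompactSpace

theorem exists_infiniteAdele_bound : ∃ R : ℝ, ∀ x : InfiniteAdeleRing F, ∃ a : 𝓞 F,
    ∀ v : InfinitePlace F, ‖(x - algebraMap F (InfiniteAdeleRing F) a) v‖ ≤ R := by
  classical
  obtain ⟨R, hR⟩ := (ZSpan.fundamentalDomain_isBounded (mixedEmbedding.latticeBasis F)).exists_norm_le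
  refine ⟨R, fun x => ?_⟩
  have hfl := (ZSpan.floor (mixedEmbedding.latticeBasis F)
    (InfiniteAdeleRing.ringEquiv_mixedSpace F x)).2
  rw [mixedEmbedding.mem_span_latticeBasis] at hfl
  obtain ⟨a, ha⟩ := hfl
  refine ⟨a, fun v => ?_⟩
  have hn := hR _ (ZSpan.fract_mem_fundamentalDomain (mixedEmbedding.latticeBasis F)
    (InfiniteAdeleRing.ringEquiv_mixedSpace F x))
  have he : ZSpan.fract (mixedEmbedding.latticeBasis F) (InfiniteAdeleRing.ringEquiv_mixedSpace F x)
      = InfiniteAdeleRing.ringEquiv_mixedSpace F (x - algebraMap F (InfiniteAdeleRing F) a) := by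
    rw [map_sub, ← InfiniteAdeleRing.mixedEmbedding_eq_algebraMap_comp, ZSpan.fract_apply, ← ha]
    rfl
  rw [he] at hn
  generalize x - algebraMap F (InfiniteAdeleRing F) a = y at hn ⊢
  refine le_trans ?_ hn
  rcases v.isReal_or_isComplex with hv | hv
  · refine le_trans (le_of_eq ?_) ((norm_le_pi_norm _ (⟨v, hv⟩ : {w // InfinitePlace.IsReal w})).trans (norm_fst_le _))
    exact ((InfinitePlace.Completion.isometry_extensionEmbeddingOfIsReal hv).norm_map_of_map_zero
      (map_zero _) _).symm
  · refine le_trans (le_of_eq ?_) ((norm_le_pi_norm _ (⟨v, hv⟩ : {w // InfinitePlace.IsComplex w})).trans (norm_snd_le _))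
    exact ((InfinitePlace.Completion.isometry_extensionEmbedding v).norm_map_of_map_zero
      (map_zero _) _).symm

/-- A compact set of adeles which meets all cosets of `F`. -/
theorem exists_isCompact_adeles : ∃ K : Set (Adeles F), IsCompact K ∧
    ∀ x : Adeles F, ∃ ξ : F, x - algebraMap F (Adeles F) ξ ∈ K := by
  obtain ⟨R, hR⟩ := exists_infiniteAdele_bound F
  have hB : IsCompact (Set.univ.pi fun v : InfinitePlace F => Metric.closedBall (0 : v.Completion) R) := by
    refine isCompact_univ_pi fun v => ?_
    have h := (InfinitePlace.Completion.isometry_extensionEmbedding v)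
    have := h.isClosedEmbedding.isCompact_preimage (isCompact_closedBall (0 : ℂ) R)
    rwa [← map_zero (InfinitePlace.Completion.extensionEmbedding v), h.preimage_closedBall] at this
  refine ⟨(Set.univ.pi fun v : InfinitePlace F => Metric.closedBall (0 : v.Completion) R) ×ˢ
    integralFiniteAdeles F, hB.prod (isCompact_integralFiniteAdeles F), fun x => ?_⟩
  obtain ⟨y, hy⟩ := exists_sub_algebraMap_mem_adicCompletionIntegers x.2
  obtain ⟨a, ha⟩ := hR (x.1 - algebraMap F _ y)
  refine ⟨y + a, ?_, ?_⟩
  · intro v _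
    rw [mem_closedBall_zero_iff]
    have : (x - algebraMap F (Adeles F) (y + a)).1 = x.1 - algebraMap F _ y - algebraMap F _ a := by
      rw [sub_sub, ← map_add]; rfl
    rw [this]
    exact ha v
  · intro v
    have : (x - algebraMap F (Adeles F) (y + a)).2 v =
        (x.2 - algebraMap F _ y) v - algebraMap F (v.adicCompletion F) a := by
      have h1 : (x - algebraMap F (Adeles F) (y + a)).2 v =
        x.2 v - algebraMap F (v.adicCompletion F) (y + a) := rfl
      have h2 : (x.2 - algebraMap F _ y) v = x.2 v - algebraMap F (v.adicCompletion F) y := rfl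
      rw [h1, h2, map_add, sub_sub]
    rw [this]
    exact sub_mem (hy v) (algebraMap_mem_adicCompletionIntegers v a)

variable {F}

theorem mem_range_of_forall_mem_adicCompletionIntegers {ξ : F}
    (h : ∀ v : HeightOneSpectrum (𝓞 F), algebraMap F (v.adicCompletion F) ξ ∈
      v.adicCompletionIntegers F) : ∃ a : 𝓞 F, (a : F) = ξ := by
  obtain ⟨a, ha⟩ := HeightOneSpectrum.mem_integers_of_valuation_le_one F ξ fun v => by
    rw [← valued_algebraMap]; exact h v
  exact ⟨a, ha⟩

variable (F)

theorem exists_isOpen_adeles : ∃ V : Set (Adeles F), IsOpen V ∧ 0 ∈ V ∧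
    ∀ ξ : F, algebraMap F (Adeles F) ξ ∈ V → ξ = 0 := by
  refine ⟨(Set.univ.pi fun v : InfinitePlace F => Metric.ball (0 : v.Completion) 1) ×ˢ
    integralFiniteAdeles F, ?_, ⟨?_, ?_⟩, ?_⟩
  · exact (isOpen_set_pi Set.finite_univ fun v _ => Metric.isOpen_ball).prod
      (isOpen_integralFiniteAdeles F)
  · intro v _
    exact Metric.mem_ball_self one_pos
  · exact fun v => zero_mem _
  · rintro ξ ⟨h1, h2⟩
    obtain ⟨a, rfl⟩ := mem_range_of_forall_mem_adicCompletionIntegers h2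
    by_contra ha
    have ha' : a ≠ 0 := by rintro rfl; exact ha rfl
    have hv : ∀ v : InfinitePlace F, v a < 1 := by
      intro v
      have := h1 v trivial
      rw [mem_ball_zero_iff] at this
      exact (InfinitePlace.Completion.norm_coe v _).symm.trans_lt this
    obtain ⟨w⟩ : Nonempty (InfinitePlace F) := inferInstance
    exact absurd (InfinitePlace.one_le_of_lt_one (w := w) ha' fun z _ => hv z) (not_le.2 (hv w))

end AdeleTopology

section StandardCharacter

open IsDedekindDomain HeightOneSpectrum

variable {F : Type u} [Field F] [NumberField F]

theorem infiniteTrace_add (x y : InfiniteAdeleRing F) :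
    infiniteTrace F (x + y) = infiniteTrace F x + infiniteTrace F y := by
  simp only [infiniteTrace, ← Finset.sum_add_distrib]
  refine Finset.sum_congr rfl fun v _ => ?_
  rw [show (x + y) v = x v + y v from rfl, map_add, Complex.add_re, mul_add]

theorem infiniteTrace_algebraMap (ξ : F) :
    infiniteTrace F (algebraMap F _ ξ) = (Algebra.trace ℚ F ξ : ℝ) := by
  classical
  have h := congrArg Complex.re (trace_eq_sum_embeddings (K := ℚ) ℂ (x := ξ))
  rw [Complex.re_sum, eq_ratCast, Complex.ratCast_re] at h
  rw [h, infiniteTrace, ← (RingHom.equivRatAlgHom (R := F) (S := ℂ)).sum_comp,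
    ← Finset.sum_fiberwise_of_maps_to (t := Finset.univ) (g := InfinitePlace.mk)
      (fun _ _ => Finset.mem_univ _)]
  refine Finset.sum_congr rfl fun v _ => ?_
  have hv : InfinitePlace.Completion.extensionEmbedding v (algebraMap F (InfiniteAdeleRing F) ξ v) =
      v.embedding ξ :=
    InfinitePlace.Completion.extensionEmbedding_coe v _
  rw [hv, Finset.sum_congr rfl (g := fun _ => (v.embedding ξ).re), Finset.sum_const,
    InfinitePlace.card_filter_mk_eq, nsmul_eq_mul]
  intro φ hφ
  have hφ' : InfinitePlace.mk φ = InfinitePlace.mk v.embedding := by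
    rw [(Finset.mem_filter.1 hφ).2, InfinitePlace.mk_embedding]
  change (φ ξ).re = _
  rcases InfinitePlace.mk_eq_iff.1 hφ' with h | h
  · rw [h]
  · rw [← h, ComplexEmbedding.conjugate_coe_eq, Complex.conj_re]

theorem continuous_infiniteTrace : Continuous (infiniteTrace F) := by
  refine continuous_finsetSum _ fun v _ => continuous_const.mul (Complex.continuous_re.comp
    ((InfinitePlace.Completion.isometry_extensionEmbedding v).continuous.comp ?_))
  exact continuous_apply (A := fun v : InfinitePlace F => v.Completion) v

theorem exists_int_trace_eq (a : 𝓞 F) : ∃ m : ℤ, Algebra.trace ℚ F a = m := by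
  obtain ⟨m, hm⟩ := IsIntegrallyClosed.isIntegral_iff.1
    (Algebra.isIntegral_trace (L := ℚ) a.isIntegral_coe)
  exact ⟨m, by rw [← hm]; simp⟩

/-- `ψ(x)` may be computed from any polar part of `x`. -/
theorem standardCharacter_eq (x : Adeles F) (y : F)
    (hy : ∀ v : HeightOneSpectrum (𝓞 F), (x.2 - algebraMap F _ y) v ∈ v.adicCompletionIntegers F) :
    standardCharacter F x =
      Circle.exp (2 * Real.pi * ((Algebra.trace ℚ F y : ℝ) - infiniteTrace F x.1)) := by
  have hp : ∀ v : HeightOneSpectrum (𝓞 F),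
      (x.2 - algebraMap F _ (finiteAdelePolarPart F x.2)) v ∈ v.adicCompletionIntegers F :=
    Classical.epsilon_spec (exists_sub_algebraMap_mem_adicCompletionIntegers x.2)
  obtain ⟨a, ha⟩ := mem_range_of_forall_mem_adicCompletionIntegers
    (ξ := finiteAdelePolarPart F x.2 - y) fun v => by
      have h : algebraMap F (v.adicCompletion F) (finiteAdelePolarPart F x.2 - y) =
          (x.2 - algebraMap F _ y) v -
            (x.2 - algebraMap F _ (finiteAdelePolarPart F x.2)) v := by
        have h1 : (x.2 - algebraMap F _ y) v = x.2 v - algebraMap F (v.adicCompletion F) y := rfl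
        have h2 : (x.2 - algebraMap F _ (finiteAdelePolarPart F x.2)) v =
          x.2 v - algebraMap F (v.adicCompletion F) (finiteAdelePolarPart F x.2) := rfl
        rw [h1, h2, map_sub]; ring
      rw [h]
      exact sub_mem (hy v) (hp v)
  obtain ⟨m, hm⟩ := exists_int_trace_eq a
  rw [ha, map_sub] at hm
  have hm' : (Algebra.trace ℚ F (finiteAdelePolarPart F x.2) : ℝ) - Algebra.trace ℚ F y = m := by
    exact_mod_cast hm
  refine Circle.exp_eq_exp.2 ⟨m, ?_⟩
  rw [← hm']; ring

theorem standardCharacter_algebraMap (ξ : F) :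
    standardCharacter F (algebraMap F (Adeles F) ξ) = 1 := by
  rw [standardCharacter_eq _ ξ fun v => ?_]
  · have h : (algebraMap F (Adeles F) ξ).1 = algebraMap F (InfiniteAdeleRing F) ξ := rfl
    rw [h, infiniteTrace_algebraMap, sub_self, mul_zero, Circle.exp_zero]
  · have h : (algebraMap F (Adeles F) ξ).2 = algebraMap F _ ξ := rfl
    rw [h, sub_self]
    exact zero_mem _

theorem standardCharacter_add (x y : Adeles F) :
    standardCharacter F (x + y) = standardCharacter F x * standardCharacter F y := by
  obtain ⟨p, hp⟩ := exists_sub_algebraMap_mem_adicCompletionIntegers x.2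
  obtain ⟨q, hq⟩ := exists_sub_algebraMap_mem_adicCompletionIntegers y.2
  rw [standardCharacter_eq x p hp, standardCharacter_eq y q hq, ← Circle.exp_add,
    standardCharacter_eq (x + y) (p + q) fun v => ?_]
  · have h : (x + y).1 = x.1 + y.1 := rfl
    rw [h, infiniteTrace_add, map_add]
    congr 1
    push_cast
    ring
  · have h : ((x + y).2 - algebraMap F _ (p + q)) v =
        (x.2 - algebraMap F _ p) v + (y.2 - algebraMap F _ q) v := by
      have h1 : (x + y).2 - algebraMap F _ (p + q) =
          (x.2 - algebraMap F _ p) + (y.2 - algebraMap F _ q) := by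
        rw [show (x + y).2 = x.2 + y.2 from rfl, map_add]; ring
      rw [h1]; rfl
    rw [h]
    exact add_mem (hp v) (hq v)

theorem standardCharacter_zero : standardCharacter F 0 = 1 := by
  rw [← map_zero (algebraMap F (Adeles F)), standardCharacter_algebraMap]

theorem continuous_standardCharacter : Continuous (standardCharacter F) := by
  refine continuous_iff_continuousAt.2 fun x₀ => ?_
  obtain ⟨p, hp⟩ := exists_sub_algebraMap_mem_adicCompletionIntegers x₀.2
  have hc : Continuous fun x : Adeles F =>
      Circle.exp (2 * Real.pi * ((Algebra.trace ℚ F p : ℝ) - infiniteTrace F x.1)) :=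
    Circle.exp.continuous.comp (continuous_const.mul (continuous_const.sub
      (continuous_infiniteTrace.comp continuous_fst)))
  refine hc.continuousAt.congr ?_
  have hs : Continuous fun x : Adeles F => x.2 - x₀.2 := continuous_snd.sub continuous_const
  have hopen := (isOpen_integralFiniteAdeles F).preimage hs
  filter_upwards [hopen.mem_nhds (x := x₀) (by
    change x₀.2 - x₀.2 ∈ integralFiniteAdeles F
    rw [sub_self]; exact fun v => zero_mem _)] with x hx
  refine (standardCharacter_eq x p fun v => ?_).symm
  have h : (x.2 - algebraMap F _ p) v = (x.2 - x₀.2) v + (x₀.2 - algebraMap F _ p) v := by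
    have : x.2 - algebraMap F _ p = (x.2 - x₀.2) + (x₀.2 - algebraMap F _ p) := by ring
    rw [this]; rfl
  rw [h]
  exact add_mem (hx v) (hp v)

theorem eq_zero_of_forall_infiniteTrace_mul_eq_zero {w : InfiniteAdeleRing F}
    (h : ∀ z : F, infiniteTrace F (algebraMap F _ z * w) = 0) : w = 0 := by
  classical
  have h' : ∀ z : InfiniteAdeleRing F, infiniteTrace F (z * w) = 0 := by
    have hd := InfiniteAdeleRing.denseRange_algebraMap F
    have hc : Continuous fun z => infiniteTrace F (z * w) :=
      continuous_infiniteTrace.comp (continuous_id.mul continuous_const)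
    have := hd.equalizer hc (continuous_const (y := (0 : ℝ))) (funext h)
    exact fun z => congrFun this z
  funext v
  by_contra hv
  have hv' : w v ≠ 0 := hv
  let e : InfiniteAdeleRing F :=
    (Pi.single v (w v)⁻¹ : (v : InfinitePlace F) → v.Completion)
  have h1 := h' e
  rw [infiniteTrace, Finset.sum_eq_single v] at h1
  · have h2 : (e * w) v = 1 := by
      change (Pi.single v (w v)⁻¹ : (v : InfinitePlace F) → v.Completion) v * w v = 1
      rw [Pi.single_eq_same, inv_mul_cancel₀ hv']
    rw [h2, map_one, Complex.one_re, mul_one] at h1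
    exact InfinitePlace.mult_ne_zero (by exact_mod_cast h1)
  · intro u _ hu
    have h2 : (e * w) u = 0 := by
      change (Pi.single v (w v)⁻¹ : (v : InfinitePlace F) → v.Completion) u * w u = 0
      rw [Pi.single_eq_of_ne hu, zero_mul]
    rw [h2, map_zero, Complex.zero_re, mul_zero]
  · simp

/-- The lattice dual to `𝓞 F` for the trace pairing on `F_∞` is contained in `F`. -/
theorem exists_algebraMap_eq_of_forall_infiniteTrace {w : InfiniteAdeleRing F}
    (h : ∀ a : 𝓞 F, ∃ m : ℤ, infiniteTrace F (algebraMap F _ a * w) = m) :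
    ∃ y : F, algebraMap F _ y = w := by
  classical
  let b := integralBasis F
  choose k hk using fun i => h (RingOfIntegers.basis F i)
  let y : F := ∑ i, (k i : ℚ) • b.traceDual i
  refine ⟨y, ?_⟩
  rw [eq_comm, ← sub_eq_zero]
  refine eq_zero_of_forall_infiniteTrace_mul_eq_zero fun z => ?_
  let T : F →+ ℝ :=
    { toFun := fun z => infiniteTrace F (algebraMap F _ z * (w - algebraMap F _ y))
      map_zero' := by
        rw [map_zero, zero_mul, ← map_zero (algebraMap F _), infiniteTrace_algebraMap]; simp
      map_add' := fun a c => by rw [map_add, add_mul, infiniteTrace_add] }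
  have hT : T.toRatLinearMap = 0 := by
    refine b.ext fun i => ?_
    have hw : infiniteTrace F (algebraMap F _ (b i) * w) = k i := by
      rw [integralBasis_apply]; exact hk i
    have hy : Algebra.trace ℚ F (b i * y) = k i := by
      simp only [y, Finset.mul_sum, map_sum, mul_smul_comm, map_smul,
        Module.Basis.trace_mul_traceDual]
      simp
    have hs : infiniteTrace F (algebraMap F _ (b i) * w) =
        infiniteTrace F (algebraMap F _ (b i) * (w - algebraMap F _ y)) +
          infiniteTrace F (algebraMap F _ (b i * y)) := by
      rw [← infiniteTrace_add, map_mul]; congr 1; ring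
    rw [hw, infiniteTrace_algebraMap, hy] at hs
    change infiniteTrace F (algebraMap F _ (b i) * (w - algebraMap F _ y)) = 0
    simpa using hs
  exact DFunLike.congr_fun hT z

variable (F) in
/-- A common denominator for the trace dual of `𝓞 F`. -/
theorem exists_mul_mem_of_forall_trace : ∃ D : 𝓞 F, D ≠ 0 ∧ ∀ q : F,
    (∀ a : 𝓞 F, ∃ m : ℤ, Algebra.trace ℚ F (a * q) = m) → ∃ c : 𝓞 F, (c : F) = D * q := by
  classical
  let b := integralBasis F
  obtain ⟨D, hD⟩ := IsLocalization.exist_integer_multiples_of_finset (nonZeroDivisors (𝓞 F))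
    (Finset.univ.image fun i => b.traceDual i)
  choose e he using fun i => hD (b.traceDual i) (Finset.mem_image_of_mem _ (Finset.mem_univ i))
  refine ⟨D, nonZeroDivisors.ne_zero D.2, fun q hq => ?_⟩
  choose k hk using fun i => hq (RingOfIntegers.basis F i)
  refine ⟨∑ i, k i * e i, ?_⟩
  have hq' : q = ∑ i, (k i : ℚ) • b.traceDual i := by
    conv_lhs => rw [← b.traceDual.sum_repr q]
    refine Finset.sum_congr rfl fun i _ => ?_
    rw [Module.Basis.traceDual_repr_apply, Algebra.traceForm_apply, mul_comm, ← hk i,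
      integralBasis_apply]
  rw [hq', Finset.mul_sum, RingOfIntegers.coe_eq_algebraMap, map_sum]
  refine Finset.sum_congr rfl fun i _ => ?_
  rw [map_mul, he i, Algebra.smul_def, map_intCast, Algebra.smul_def (k i : ℚ), map_intCast]
  ring

/-- The annihilator of `F` with respect to `ψ` is `F`. -/
theorem exists_algebraMap_eq_of_standardCharacter_eq_one {x : Adeles F}
    (h : ∀ n : F, standardCharacter F (algebraMap F _ n * x) = 1) :
    ∃ ξ : F, algebraMap F _ ξ = x := by
  have hsub : ∀ {x : Adeles F} (ξ : F),
      (∀ n : F, standardCharacter F (algebraMap F _ n * x) = 1) →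
      ∀ n : F, standardCharacter F (algebraMap F _ n * (x - algebraMap F _ ξ)) = 1 := by
    intro x ξ hx n
    have h1 := hx n
    have h2 : algebraMap F (Adeles F) n * x =
      algebraMap F _ n * (x - algebraMap F _ ξ) + algebraMap F _ (n * ξ) := by
      rw [map_mul]; ring
    rwa [h2, standardCharacter_add, standardCharacter_algebraMap, mul_one] at h1
  have hint : ∀ {r : ℝ}, Circle.exp (2 * Real.pi * r) = 1 → ∃ m : ℤ, r = m := by
    intro r hr
    obtain ⟨m, hm⟩ := Circle.exp_eq_one.1 hr
    refine ⟨m, ?_⟩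
    have := Real.pi_pos
    rw [mul_comm] at hm
    exact mul_right_cancel₀ (by positivity) hm
  obtain ⟨p, hp⟩ := exists_sub_algebraMap_mem_adicCompletionIntegers x.2
  have h1 := hsub p h
  obtain ⟨y, hy⟩ : ∃ y : F, algebraMap F (InfiniteAdeleRing F) y = (x - algebraMap F _ p).1 := by
    refine exists_algebraMap_eq_of_forall_infiniteTrace fun a => ?_
    have h2 := h1 a
    rw [standardCharacter_eq _ 0 fun v => ?_] at h2
    · obtain ⟨m, hm⟩ := hint h2
      refine ⟨-m, ?_⟩
      rw [map_zero, Rat.cast_zero, zero_sub] at hm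
      rw [Int.cast_neg, ← hm, neg_neg]
      rfl
    · rw [map_zero, sub_zero]
      have h3 : (algebraMap F (Adeles F) a * (x - algebraMap F _ p)).2 v =
        algebraMap F (v.adicCompletion F) a * (x.2 - algebraMap F _ p) v := rfl
      rw [h3]
      exact mul_mem (algebraMap_mem_adicCompletionIntegers v a) (hp v)
  have h2 := hsub y h1
  set z := x - algebraMap F (Adeles F) p - algebraMap F (Adeles F) y with hz
  have hz1 : z.1 = 0 := by
    have : z.1 = (x - algebraMap F (Adeles F) p).1 - algebraMap F (InfiniteAdeleRing F) y := rfl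
    rw [this, hy, sub_self]
  obtain ⟨D, hD0, hD⟩ := exists_mul_mem_of_forall_trace F
  have hDn : ∀ (n : F) (v : HeightOneSpectrum (𝓞 F)),
      algebraMap F (v.adicCompletion F) (D * n) * z.2 v ∈ v.adicCompletionIntegers F := by
    intro n
    obtain ⟨q, hq⟩ := exists_sub_algebraMap_mem_adicCompletionIntegers
      (algebraMap F (Adeles F) n * z).2
    have hqv : ∀ v : HeightOneSpectrum (𝓞 F),
        algebraMap F (v.adicCompletion F) n * z.2 v - algebraMap F (v.adicCompletion F) q ∈
          v.adicCompletionIntegers F := hq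
    obtain ⟨c, hc⟩ := hD q fun a => by
      have h3 := h2 (a * n)
      rw [standardCharacter_eq _ (a * q) fun v => ?_] at h3
      · obtain ⟨m, hm⟩ := hint h3
        have h4 : (algebraMap F (Adeles F) (a * n) * z).1 = algebraMap F _ 0 := by
          rw [map_zero]
          change algebraMap F (InfiniteAdeleRing F) (a * n) * z.1 = 0
          rw [hz1, mul_zero]
        rw [h4, infiniteTrace_algebraMap, map_zero, Rat.cast_zero, sub_zero] at hm
        exact ⟨m, by exact_mod_cast hm⟩
      · have h4 : ((algebraMap F (Adeles F) (a * n) * z).2 - algebraMap F _ (a * q)) v =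
            algebraMap F (v.adicCompletion F) (a * n) * z.2 v -
              algebraMap F (v.adicCompletion F) (a * q) := rfl
        rw [h4, map_mul, map_mul, mul_assoc, ← mul_sub]
        exact mul_mem (algebraMap_mem_adicCompletionIntegers v a) (hqv v)
    intro v
    have h5 : algebraMap F (v.adicCompletion F) (D * n) * z.2 v =
        algebraMap F (v.adicCompletion F) D *
          (algebraMap F (v.adicCompletion F) n * z.2 v - algebraMap F (v.adicCompletion F) q) +
        algebraMap F (v.adicCompletion F) c := by
      rw [hc, map_mul, map_mul]; ring
    rw [h5]
    exact add_mem (mul_mem (algebraMap_mem_adicCompletionIntegers v D) (hqv v))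
      (algebraMap_mem_adicCompletionIntegers v c)
  have hz2 : z.2 = 0 := by
    refine FiniteAdeleRing.ext F fun v => ?_
    by_contra hv
    have hv0 : z.2 v ≠ 0 := hv
    have hDF : (D : F) ≠ 0 := by simpa using hD0
    obtain ⟨n, hn⟩ := valuation_surjective F v
      ((Valued.v (algebraMap F (v.adicCompletion F) D * z.2 v))⁻¹ * WithZero.exp 1)
    have h6 : Valued.v (algebraMap F (v.adicCompletion F) n *
        (algebraMap F (v.adicCompletion F) D * z.2 v)) ≤ 1 := by
      have h7 := hDn n v
      rwa [mul_comm (D : F) n, map_mul, mul_assoc] at h7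
    rw [Valuation.map_mul, valued_algebraMap, hn, mul_right_comm, inv_mul_cancel₀, one_mul] at h6
    · exact absurd h6 (by decide)
    · simpa [hv0] using hDF
  refine ⟨p + y, ?_⟩
  have : z = 0 := Prod.ext hz1 hz2
  rw [hz, sub_sub, sub_eq_zero] at this
  rw [this, map_add]

end StandardCharacter

section FundamentalSets

/-- A countable group acting measurably on a space covered by the translates of a well-ordered
countable family of sets, each of which meets every orbit at most once, has a measurable strict
fundamental domain. -/
theorem exists_strict_fundamentalDomain {Γ X ι : Type*} [Group Γ] [Countable Γ] [MeasurableSpace X]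
    [LinearOrder ι] [WellFoundedLT ι] [Countable ι] (act : Γ → X → X)
    (hmul : ∀ γ δ x, act (γ * δ) x = act γ (act δ x)) (hmeas : ∀ γ, Measurable (act γ))
    (U : ι → Set X) (hU : ∀ i, MeasurableSet (U i))
    (hinj : ∀ i x γ, x ∈ U i → act γ x ∈ U i → γ = 1) (hcov : ∀ x, ∃ i γ, act γ x ∈ U i) :
    ∃ D ⊆ ⋃ i, U i, MeasurableSet D ∧ ∀ x, ∃! γ, act γ x ∈ D := by
  refine ⟨⋃ i, U i \ ⋃ j : {j // j < i}, ⋃ γ, act γ ⁻¹' U j, ?_, ?_, fun x => ?_⟩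
  · exact Set.iUnion_mono fun i => Set.sdiff_subset
  · exact MeasurableSet.iUnion fun i => (hU i).diff
      (MeasurableSet.iUnion fun j => MeasurableSet.iUnion fun γ => hmeas γ (hU j))
  · obtain ⟨i, hi, hmin⟩ := WellFounded.has_min (wellFounded_lt (α := ι))
      {i | ∃ γ, act γ x ∈ U i} (hcov x)
    obtain ⟨γ, hγ⟩ := hi
    have hγD : act γ x ∈ U i \ ⋃ j : {j // j < i}, ⋃ γ, act γ ⁻¹' U j := by
      refine ⟨hγ, fun h => ?_⟩
      obtain ⟨⟨j, hj⟩, h⟩ := Set.mem_iUnion.1 h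
      obtain ⟨δ, h⟩ := Set.mem_iUnion.1 h
      exact hmin j ⟨δ * γ, by rw [hmul]; exact h⟩ hj
    refine ⟨γ, Set.mem_iUnion.2 ⟨i, hγD⟩, fun δ hδ => ?_⟩
    obtain ⟨j, hj, hjmin⟩ := Set.mem_iUnion.1 hδ
    have hact : ∀ γ δ : Γ, act (δ * γ⁻¹) (act γ x) = act δ x := fun γ δ => by
      rw [← hmul, inv_mul_cancel_right]
    have hij : j = i := by
      refine le_antisymm (not_lt.1 fun h => hjmin ?_) (not_lt.1 fun h => hmin j ⟨δ, hj⟩ h)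
      exact Set.mem_iUnion.2 ⟨⟨i, h⟩, Set.mem_iUnion.2 ⟨γ * δ⁻¹, by
        rw [Set.mem_preimage, hact]; exact hγ⟩⟩
    subst hij
    have := hinj j (act γ x) (δ * γ⁻¹) hγ (by rwa [hact])
    rwa [mul_inv_eq_one] at this

variable {F : Type u} [Field F] [NumberField F]

/-- A measurable set of representatives of `𝔸 / F`. -/
def IsAdeleDomain (D : Set (Adeles F)) : Prop :=
  MeasurableSet D ∧ ∀ x, ∃! ξ : F, algebraMap F (Adeles F) ξ + x ∈ D

/-- A measurable set of representatives of `F^× \ 𝔸^×`. -/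
def IsIdeleDomain (E : Set (Ideles F)) : Prop :=
  MeasurableSet E ∧ ∀ a, ∃! γ : Fˣ, principalIdele F γ * a ∈ E

theorem exists_isAdeleDomain (μN : Measure (Adeles F)) [IsFiniteMeasureOnCompacts μN] :
    ∃ D : Set (Adeles F), IsAdeleDomain D ∧ μN D < ∞ := by
  have : Countable (Multiplicative F) := NumberField.countable F
  obtain ⟨K, hK, hKF⟩ := exists_isCompact_adeles F
  obtain ⟨V, hV, hV0, hVF⟩ := exists_isOpen_adeles F
  have hsub : ∀ᶠ p : Adeles F × Adeles F in nhds (0, 0), p.1 - p.2 ∈ V :=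
    (continuous_sub.tendsto (0, 0)).eventually (by simpa using hV.mem_nhds hV0)
  rw [nhds_prod_eq] at hsub
  obtain ⟨W, hW, hWV⟩ := (Filter.eventually_prod_self_iff (r := fun x y => x - y ∈ V)).1 hsub
  obtain ⟨W₁, hW₁, hW₁o, hW₁0⟩ := mem_nhds_iff.1 hW
  obtain ⟨W₂, hW₂0, hW₂o, hW₂f⟩ := μN.exists_isOpen_measure_lt_top (0 : Adeles F)
  let B := W₁ ∩ W₂
  have hB : IsOpen B := hW₁o.inter hW₂o
  have hopen : ∀ t : Adeles F, IsOpen ((fun x => x - t) ⁻¹' B) := fun t =>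
    hB.preimage (continuous_id.sub continuous_const)
  have hfin : ∀ t ∈ K, ∃ U ∈ nhds t, U ⊆ (fun x => x - t) ⁻¹' B ∧ IsOpen U ∧ μN U < ∞ := by
    intro t _
    obtain ⟨U, hU0, hUo, hUf⟩ := μN.exists_isOpen_measure_lt_top t
    refine ⟨U ∩ (fun x => x - t) ⁻¹' B, Filter.inter_mem (hUo.mem_nhds hU0)
      ((hopen t).mem_nhds ?_), Set.inter_subset_right, hUo.inter (hopen t),
        (measure_mono Set.inter_subset_left).trans_lt hUf⟩
    change t - t ∈ B
    rw [sub_self]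
    exact ⟨hW₁0, hW₂0⟩
  choose! U hUn hUB hUo hUf using hfin
  obtain ⟨T, hTK, hT⟩ := hK.elim_nhds_subcover U hUn
  let e := T.equivFin
  obtain ⟨D, hDU, hDm, hD⟩ := exists_strict_fundamentalDomain (Γ := Multiplicative F)
    (X := Adeles F) (ι := Fin T.card) (fun ξ x => algebraMap F _ ξ.toAdd + x)
    (fun γ δ x => by rw [toAdd_mul, map_add, add_assoc])
    (fun γ => measurable_const_add _) (fun i => U (e.symm i))
    (fun i => (hUo _ (hTK _ (e.symm i).2)).measurableSet)
    (fun i x γ hx hγ => by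
      have h1 := hUB _ (hTK _ (e.symm i).2) hx
      have h2 := hUB _ (hTK _ (e.symm i).2) hγ
      have h3 := hVF γ.toAdd (by
        have := hWV _ (hW₁ h2.1) _ (hW₁ h1.1)
        simpa using this)
      exact Multiplicative.toAdd.injective h3)
    (fun x => by
      obtain ⟨ξ, hξ⟩ := hKF x
      obtain ⟨t, ht, h⟩ := Set.mem_iUnion₂.1 (hT hξ)
      refine ⟨e ⟨t, ht⟩, Multiplicative.ofAdd (-ξ), ?_⟩
      rw [Equiv.symm_apply_apply, toAdd_ofAdd, map_neg, neg_add_eq_sub]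
      exact h)
  refine ⟨D, ⟨hDm, fun x => ?_⟩, ((measure_mono hDU).trans (measure_iUnion_le _)).trans_lt (by
    rw [tsum_fintype]
    exact ENNReal.sum_lt_top.2 fun i _ => hUf _ (hTK _ (e.symm i).2))⟩
  obtain ⟨γ, hγ, huniq⟩ := hD x
  exact ⟨γ.toAdd, hγ, fun ξ hξ => congrArg Multiplicative.toAdd
    (huniq (Multiplicative.ofAdd ξ) hξ)⟩

theorem exists_isIdeleDomain : ∃ E : Set (Ideles F), IsIdeleDomain E := by
  have := NumberField.countable F
  have : Countable Fˣ := Units.val_injective.countable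
  obtain ⟨V, hV, hV0, hVF⟩ := exists_isOpen_adeles F
  have hval : Continuous fun a : Ideles F => Units.val (α := Adeles F) a - 1 :=
    (Units.continuous_val (M := Adeles F)).sub continuous_const
  have hdiv : ∀ᶠ p : Ideles F × Ideles F in nhds (1, 1),
      Units.val (α := Adeles F) (p.1 / p.2) - 1 ∈ V := by
    refine (((hval.comp continuous_div').tendsto (1, 1))).eventually (hV.mem_nhds ?_)
    change Units.val (α := Adeles F) ((1 / 1 : Ideles F)) - 1 ∈ V
    rw [div_one]
    convert hV0
    exact sub_self (1 : Adeles F)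
  rw [nhds_prod_eq] at hdiv
  obtain ⟨W, hW, hWV⟩ := (Filter.eventually_prod_self_iff
    (r := fun a b : Ideles F => Units.val (α := Adeles F) (a / b) - 1 ∈ V)).1 hdiv
  obtain ⟨W₁, hW₁, hW₁o, hW₁0⟩ := mem_nhds_iff.1 hW
  obtain ⟨t, ht⟩ := TopologicalSpace.exists_dense_seq (Ideles F)
  have hopen : ∀ t : Ideles F, IsOpen ((fun x => x * t⁻¹) ⁻¹' W₁) := fun t =>
    hW₁o.preimage (continuous_id.mul continuous_const)
  obtain ⟨D, -, hDm, hD⟩ := exists_strict_fundamentalDomain (Γ := Fˣ) (X := Ideles F) (ι := ℕ)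
    (fun γ x => principalIdele F γ * x) (fun γ δ x => by rw [map_mul, mul_assoc])
    (fun γ => (continuous_const.mul continuous_id).measurable)
    (fun i => (fun x => x * (t i)⁻¹) ⁻¹' W₁) (fun i => (hopen _).measurableSet)
    (fun i x γ hx hγ => by
      have h := hWV _ (hW₁ hγ) _ (hW₁ hx)
      have h1 : principalIdele F γ * x * (t i)⁻¹ / (x * (t i)⁻¹) = principalIdele F γ := by
        rw [div_eq_mul_inv, mul_assoc (principalIdele F γ), mul_assoc, mul_inv_cancel, mul_one]
      rw [h1] at h
      have h2 := hVF ((γ : F) - 1) (by rw [map_sub, map_one]; exact h)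
      exact Units.ext (sub_eq_zero.1 h2))
    (fun x => by
      have hinv : IsOpen ((fun s => x * s⁻¹) ⁻¹' W₁) :=
        hW₁o.preimage (continuous_const.mul continuous_inv)
      obtain ⟨_, hs, ⟨i, rfl⟩⟩ := ht.inter_open_nonempty _ hinv ⟨x, by
        change x * x⁻¹ ∈ W₁
        rw [mul_inv_cancel]
        exact hW₁0⟩
      refine ⟨i, 1, ?_⟩
      rw [map_one, one_mul]
      exact hs)
  exact ⟨D, hDm, hD⟩

end FundamentalSets

variable (F : Type u) [Field F] [NumberField F] in
theorem exists_standardCharacter_ne_one : ∃ t, standardCharacter F t ≠ 1 := by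
  have hd : (Module.finrank ℚ F : ℝ) ≠ 0 := by exact_mod_cast Module.finrank_pos.ne'
  let q : F := algebraMap ℚ F (1 / (2 * Module.finrank ℚ F))
  let t : Adeles F := ((algebraMap F (InfiniteAdeleRing F) q, 0) :
    InfiniteAdeleRing F × IsDedekindDomain.FiniteAdeleRing (𝓞 F) F)
  refine ⟨t, ?_⟩
  rw [standardCharacter_eq t 0 fun v => ?_]
  · intro h
    obtain ⟨m, hm⟩ := Circle.exp_eq_one.1 h
    change 2 * Real.pi * (((Algebra.trace ℚ F 0 : ℚ) : ℝ) -
      infiniteTrace F (algebraMap F (InfiniteAdeleRing F) q)) = _ at hm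
    rw [infiniteTrace_algebraMap, Algebra.trace_algebraMap, map_zero, nsmul_eq_mul] at hm
    push_cast at hm
    field_simp at hm
    have h2 : ((2 * m + 1 : ℤ) : ℝ) = 0 := by push_cast; linarith
    have h3 : 2 * m + 1 = 0 := by exact_mod_cast h2
    omega
  · rw [map_zero, sub_zero]
    exact zero_mem _

section AdeleProb

variable {F : Type u} [Field F] [NumberField F] (μN : Measure (Adeles F))

/-- The normalised restriction of the Haar measure of `𝔸` to a set of representatives of
`𝔸 / F`. -/
def adeleProb (D : Set (Adeles F)) : Measure (Adeles F) := (μN D)⁻¹ • μN.restrict D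

variable {D D' : Set (Adeles F)}

variable (F) in
/-- The principal adeles, as an additive group. -/
abbrev principalAdeles : AddSubgroup (Adeles F) := (algebraMap F (Adeles F)).range.toAddSubgroup

variable (F) in
theorem countable_principalAdeles : Countable (principalAdeles F) := by
  have := NumberField.countable F
  exact Set.countable_coe_iff.2 (Set.countable_range (algebraMap F (Adeles F)))

theorem IsAdeleDomain.isAddFundamentalDomain (hD : IsAdeleDomain D) :
    IsAddFundamentalDomain (principalAdeles F) D μN := by
  refine IsAddFundamentalDomain.mk' hD.1.nullMeasurableSet fun x => ?_
  obtain ⟨ξ, hξ, huniq⟩ := hD.2 x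
  refine ⟨⟨_, ξ, rfl⟩, hξ, ?_⟩
  rintro ⟨_, η, rfl⟩ hη
  exact Subtype.ext (congrArg (algebraMap F (Adeles F)) (huniq η hη))

variable {μN} [μN.IsAddHaarMeasure]

theorem IsAdeleDomain.measure_ne_zero (hD : IsAdeleDomain D) : μN D ≠ 0 := by
  have := NumberField.countable F
  intro h0
  have h : (⋃ ξ : F, (fun x => algebraMap F (Adeles F) ξ + x) ⁻¹' D) = Set.univ :=
    Set.eq_univ_of_forall fun x => Set.mem_iUnion.2 (hD.2 x).exists
  have h1 : μN (⋃ ξ : F, (fun x => algebraMap F (Adeles F) ξ + x) ⁻¹' D) = 0 :=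
    measure_iUnion_null fun ξ => by rw [measure_preimage_add]; exact h0
  rw [h] at h1
  exact (Measure.measure_univ_ne_zero.2 (NeZero.ne μN)) h1

theorem isProbabilityMeasure_adeleProb (hD : IsAdeleDomain D) (hfin : μN D < ∞) :
    IsProbabilityMeasure (adeleProb μN D) := by
  constructor
  rw [adeleProb, Measure.smul_apply, Measure.restrict_apply_univ, smul_eq_mul]
  exact ENNReal.inv_mul_cancel hD.measure_ne_zero hfin.ne

variable {f : Adeles F → ℂ}

theorem IsAdeleDomain.setIntegral_eq (hD : IsAdeleDomain D) (hD' : IsAdeleDomain D')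
    (hf : ∀ (ξ : F) x, f (algebraMap F (Adeles F) ξ + x) = f x) :
    ∫ x in D, f x ∂μN = ∫ x in D', f x ∂μN := by
  have := countable_principalAdeles F
  refine (hD.isAddFundamentalDomain μN).setIntegral_eq (hD'.isAddFundamentalDomain μN) ?_
  rintro ⟨_, ξ, rfl⟩ x
  exact hf ξ x

theorem IsAdeleDomain.measure_eq (hD : IsAdeleDomain D) (hD' : IsAdeleDomain D') :
    μN D = μN D' := by
  have := countable_principalAdeles F
  exact (hD.isAddFundamentalDomain μN).measure_eq (hD'.isAddFundamentalDomain μN)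

theorem integral_adeleProb_comp (hD : IsAdeleDomain D) (hfin : μN D < ∞)
    (e : Adeles F ≃ₜ Adeles F) (he : IsAdeleDomain (e.symm ⁻¹' D)) {k : ℝ≥0∞}
    (hk : μN.map e = k • μN)
    (hf : ∀ (ξ : F) x, f (algebraMap F (Adeles F) ξ + x) = f x) :
    ∫ x, f (e x) ∂(adeleProb μN D) = ∫ x, f x ∂(adeleProb μN D) := by
  have hpre : e ⁻¹' (e.symm ⁻¹' D) = D := by
    ext x; simp
  have hk1 : k = 1 := by
    have h1 : μN.map e (e.symm ⁻¹' D) = μN (e ⁻¹' (e.symm ⁻¹' D)) :=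
      Measure.map_apply e.continuous.measurable he.1
    rw [hpre, hk, Measure.smul_apply, smul_eq_mul, he.measure_eq hD] at h1
    exact (ENNReal.mul_eq_right hD.measure_ne_zero hfin.ne).1 h1
  rw [hk1, one_smul] at hk
  have hmp : MeasurePreserving e μN μN := ⟨e.continuous.measurable, hk⟩
  rw [adeleProb, integral_smul_measure, integral_smul_measure]
  congr 1
  rw [hD.setIntegral_eq he hf,
    ← hmp.setIntegral_preimage_emb e.toMeasurableEquiv.measurableEmbedding f, hpre]

/-- Integrals of `F`-periodic functions over `𝔸 / F` are invariant under translation. -/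
theorem integral_adeleProb_add_right (hD : IsAdeleDomain D) (hfin : μN D < ∞)
    (hf : ∀ (ξ : F) x, f (algebraMap F (Adeles F) ξ + x) = f x) (t : Adeles F) :
    ∫ x, f (x + t) ∂(adeleProb μN D) = ∫ x, f x ∂(adeleProb μN D) := by
  refine integral_adeleProb_comp hD hfin (Homeomorph.addRight t) ⟨?_, fun x => ?_⟩ (k := 1) ?_ hf
  · exact (Homeomorph.addRight t).symm.continuous.measurable hD.1
  · change ∃! ξ : F, algebraMap F (Adeles F) ξ + x + -t ∈ D
    simpa only [add_assoc] using hD.2 (x + -t)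
  · rw [one_smul]; exact map_add_right_eq_self μN t

/-- Integrals of `F`-periodic functions over `𝔸 / F` are invariant under dilation by `F^×`. -/
theorem integral_adeleProb_mul_left (hD : IsAdeleDomain D) (hfin : μN D < ∞)
    (hf : ∀ (ξ : F) x, f (algebraMap F (Adeles F) ξ + x) = f x) (c : Fˣ) :
    ∫ x, f (algebraMap F (Adeles F) c * x) ∂(adeleProb μN D) = ∫ x, f x ∂(adeleProb μN D) := by
  let e' : Adeles F ≃+ Adeles F :=
    { toFun := fun x => algebraMap F (Adeles F) c * x
      invFun := fun x => algebraMap F (Adeles F) ((c⁻¹ : Fˣ) : F) * x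
      left_inv := fun x => by beta_reduce; rw [← mul_assoc, ← map_mul]; simp
      right_inv := fun x => by beta_reduce; rw [← mul_assoc, ← map_mul]; simp
      map_add' := fun x y => mul_add _ x y }
  have hc : Continuous e' := continuous_const.mul continuous_id
  have hc' : Continuous e'.symm := continuous_const.mul continuous_id
  have hH : (μN.map e').IsAddHaarMeasure := e'.isAddHaarMeasure_map μN hc hc'
  have := Measure.isAddLeftInvariant_eq_smul (μN.map e') μN
  refine integral_adeleProb_comp hD hfin ⟨e'.toEquiv, hc, hc'⟩ ⟨?_, fun x => ?_⟩
    (k := ((μN.map e').addHaarScalarFactor μN : ℝ≥0∞)) this hf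
  · exact hc'.measurable hD.1
  · obtain ⟨ξ, hξ, huniq⟩ := hD.2 (algebraMap F (Adeles F) ((c⁻¹ : Fˣ) : F) * x)
    have h : ∀ η : F, (algebraMap F (Adeles F) ((c⁻¹ : Fˣ) : F) * (algebraMap F (Adeles F) η + x)) =
        algebraMap F (Adeles F) (((c⁻¹ : Fˣ) : F) * η) +
          algebraMap F (Adeles F) ((c⁻¹ : Fˣ) : F) * x := fun η => by rw [mul_add, map_mul]
    refine ⟨c * ξ, ?_, fun η hη => ?_⟩
    · change algebraMap F (Adeles F) ((c⁻¹ : Fˣ) : F) * (algebraMap F (Adeles F) (c * ξ) + x) ∈ D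
      rw [h, Units.inv_mul_cancel_left]
      exact hξ
    · have h1 : algebraMap F (Adeles F) ((c⁻¹ : Fˣ) : F) * (algebraMap F (Adeles F) η + x) ∈ D := hη
      rw [h] at h1
      rw [← huniq _ h1, Units.mul_inv_cancel_left]

theorem integral_adeleProb_character (hD : IsAdeleDomain D) (hfin : μN D < ∞) (n : F)
    [Decidable (n = 0)] :
    ∫ x, (standardCharacter F (algebraMap F (Adeles F) n * x) : ℂ) ∂(adeleProb μN D) =
      if n = 0 then 1 else 0 := by
  have := isProbabilityMeasure_adeleProb hD hfin
  split_ifs with hn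
  · simp [hn, standardCharacter_zero]
  · obtain ⟨t, ht⟩ : ∃ t, standardCharacter F (algebraMap F (Adeles F) n * t) ≠ 1 := by
      obtain ⟨t, ht⟩ := exists_standardCharacter_ne_one F
      refine ⟨algebraMap F (Adeles F) n⁻¹ * t, ?_⟩
      rwa [← mul_assoc, ← map_mul, mul_inv_cancel₀ hn, map_one, one_mul]
    have hper : ∀ (ξ : F) x,
        (standardCharacter F (algebraMap F (Adeles F) n * (algebraMap F (Adeles F) ξ + x)) : ℂ) =
          standardCharacter F (algebraMap F (Adeles F) n * x) := fun ξ x => by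
      rw [mul_add, ← map_mul, standardCharacter_add, standardCharacter_algebraMap, one_mul]
    have h := integral_adeleProb_add_right hD hfin (f := fun x =>
      (standardCharacter F (algebraMap F (Adeles F) n * x) : ℂ)) hper t
    simp_rw [mul_add, standardCharacter_add, Circle.coe_mul] at h
    rw [integral_mul_const] at h
    have h1 : (standardCharacter F (algebraMap F (Adeles F) n * t) : ℂ) ≠ 1 := fun h' =>
      ht (Circle.ext h')
    by_contra h0
    exact h1 (mul_left_cancel₀ h0 (h.trans (mul_one _).symm))

end AdeleProb

theorem lintegral_enorm_sq_eq_eLpNorm {X E : Type*} [MeasurableSpace X] {μ : Measure X}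
    [NormedAddCommGroup E] (f : X → E) :
    ∫⁻ x, ‖f x‖ₑ ^ 2 ∂μ = eLpNorm f 2 μ ^ 2 := by
  have h := eLpNorm_nnreal_pow_eq_lintegral (f := f) (μ := μ) (p := 2) (by norm_num)
  norm_num at h
  exact h.symm

theorem enorm_Lp_sq {X : Type*} [MeasurableSpace X] {μ : Measure X} (f : Lp ℂ 2 μ) :
    ‖f‖ₑ ^ 2 = ∫⁻ x, ‖f x‖ₑ ^ 2 ∂μ := by
  rw [lintegral_enorm_sq_eq_eLpNorm, Lp.enorm_def]

theorem enorm_sq_eq_ofReal {E : Type*} [SeminormedAddCommGroup E] (x : E) :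
    ‖x‖ₑ ^ 2 = ENNReal.ofReal (‖x‖ ^ 2) := by
  rw [ENNReal.ofReal_pow (norm_nonneg _), ofReal_norm]

theorem memLp_two_iff_lintegral {X E : Type*} [MeasurableSpace X] {μ : Measure X}
    [NormedAddCommGroup E] {f : X → E}
    (hf : AEStronglyMeasurable f μ) : MemLp f 2 μ ↔ ∫⁻ x, ‖f x‖ₑ ^ 2 ∂μ < ∞ := by
  rw [lintegral_enorm_sq_eq_eLpNorm, ENNReal.pow_lt_top_iff, MemLp]
  simp [hf]

section Fourier

variable {F : Type u} [Field F] [NumberField F]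

variable (F) in
/-- The compact group `𝔸 / F`. -/
abbrev AdeleQuotient : Type u := Adeles F ⧸ principalAdeles F

instance : CompactSpace (AdeleQuotient F) := by
  obtain ⟨K, hK, hKF⟩ := exists_isCompact_adeles F
  have h : (QuotientAddGroup.mk '' K : Set (AdeleQuotient F)) = Set.univ := by
    refine Set.eq_univ_of_forall fun q => ?_
    obtain ⟨x, rfl⟩ := QuotientAddGroup.mk_surjective q
    obtain ⟨ξ, hξ⟩ := hKF x
    refine ⟨_, hξ, ?_⟩
    rw [QuotientAddGroup.eq]
    exact ⟨ξ, by ring⟩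
  exact ⟨h ▸ hK.image continuous_quotient_mk'⟩

theorem continuous_standardCharacter_mul (n : F) :
    Continuous fun x : Adeles F => standardCharacter F (algebraMap F (Adeles F) n * x) :=
  continuous_standardCharacter.comp (continuous_const.mul continuous_id)

theorem standardCharacter_mul_add (n ξ : F) (x : Adeles F) :
    standardCharacter F (algebraMap F (Adeles F) n * (algebraMap F (Adeles F) ξ + x)) =
      standardCharacter F (algebraMap F (Adeles F) n * x) := by
  rw [mul_add, ← map_mul, standardCharacter_add, standardCharacter_algebraMap, one_mul]

instance isClosed_principalAdeles : IsClosed (principalAdeles F : Set (Adeles F)) := by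
  have h : (principalAdeles F : Set (Adeles F)) =
      ⋂ n : F, {x | standardCharacter F (algebraMap F (Adeles F) n * x) = 1} := by
    ext x
    rw [Set.mem_iInter]
    constructor
    · rintro ⟨ξ, rfl⟩ n
      change standardCharacter F (algebraMap F (Adeles F) n * algebraMap F (Adeles F) ξ) = 1
      rw [← map_mul, standardCharacter_algebraMap]
    · exact fun h => exists_algebraMap_eq_of_standardCharacter_eq_one h
  rw [h]
  exact isClosed_iInter fun n => isClosed_eq (continuous_standardCharacter_mul n) continuous_const

/-- The character `ψ_n` of `𝔸 / F`. -/
def quotientCharacter (n : F) : C(AdeleQuotient F, ℂ) where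
  toFun q := Quotient.liftOn' q
    (fun x => (standardCharacter F (algebraMap F (Adeles F) n * x) : ℂ)) (by
      intro x y hxy
      obtain ⟨ξ, hξ⟩ := QuotientAddGroup.leftRel_apply.1 hxy
      have : y = algebraMap F (Adeles F) ξ + x := by
        rw [← sub_eq_iff_eq_add, ← neg_add_eq_sub]; exact hξ.symm
      rw [this, standardCharacter_mul_add])
  continuous_toFun := Continuous.quotient_liftOn'
    (continuous_subtype_val.comp (continuous_standardCharacter_mul n)) _

theorem quotientCharacter_mk (n : F) (x : Adeles F) :
    quotientCharacter n (QuotientAddGroup.mk x : AdeleQuotient F) =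
      standardCharacter F (algebraMap F (Adeles F) n * x) := rfl

theorem quotientCharacter_zero : quotientCharacter (0 : F) = 1 := by
  ext q
  obtain ⟨x, rfl⟩ := QuotientAddGroup.mk_surjective q
  rw [quotientCharacter_mk, map_zero, zero_mul, standardCharacter_zero]; rfl

theorem quotientCharacter_add (m n : F) :
    quotientCharacter (m + n) = quotientCharacter m * quotientCharacter n := by
  ext q
  obtain ⟨x, rfl⟩ := QuotientAddGroup.mk_surjective q
  rw [ContinuousMap.mul_apply]
  simp only [quotientCharacter_mk]
  rw [map_add, add_mul, standardCharacter_add, Circle.coe_mul]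

theorem standardCharacter_neg (x : Adeles F) :
    (standardCharacter F (-x) : ℂ) = starRingEnd ℂ (standardCharacter F x) := by
  have h : standardCharacter F (-x) = (standardCharacter F x)⁻¹ := by
    rw [eq_inv_iff_mul_eq_one, ← standardCharacter_add, neg_add_cancel, standardCharacter_zero]
  rw [h, Circle.coe_inv_eq_conj]

theorem quotientCharacter_neg (n : F) :
    quotientCharacter (-n) = star (quotientCharacter n) := by
  ext q
  obtain ⟨x, rfl⟩ := QuotientAddGroup.mk_surjective q
  rw [ContinuousMap.star_apply]
  simp only [quotientCharacter_mk]
  rw [map_neg, neg_mul, standardCharacter_neg]; rfl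

variable (F) in
/-- The star subalgebra of `C(𝔸 / F, ℂ)` generated by the characters `ψ_n`. -/
def quotientCharacterSubalgebra : StarSubalgebra ℂ C(AdeleQuotient F, ℂ) where
  toSubalgebra := Algebra.adjoin ℂ (Set.range quotientCharacter)
  star_mem' := by
    change Algebra.adjoin ℂ (Set.range (quotientCharacter (F := F))) ≤
      star (Algebra.adjoin ℂ (Set.range (quotientCharacter (F := F))))
    refine Algebra.adjoin_le ?_
    rintro - ⟨n, rfl⟩
    exact Algebra.subset_adjoin ⟨-n, quotientCharacter_neg n⟩

theorem span_quotientCharacter_closure_eq_top :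
    (Submodule.span ℂ (Set.range (quotientCharacter (F := F)))).topologicalClosure = ⊤ := by
  have hspan : Subalgebra.toSubmodule (quotientCharacterSubalgebra F).toSubalgebra =
      Submodule.span ℂ (Set.range (quotientCharacter (F := F))) := by
    apply Algebra.adjoin_eq_span_of_subset
    refine Set.Subset.trans ?_ Submodule.subset_span
    intro x hx
    refine Submonoid.closure_induction (fun _ => id) ⟨0, quotientCharacter_zero⟩ ?_ hx
    rintro - - - - ⟨m, rfl⟩ ⟨n, rfl⟩
    exact ⟨m + n, quotientCharacter_add m n⟩
  rw [← hspan]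
  refine congr_arg (Subalgebra.toSubmodule <| StarSubalgebra.toSubalgebra ·)
    (ContinuousMap.starSubalgebra_topologicalClosure_eq_top_of_separatesPoints
      (quotientCharacterSubalgebra F) ?_)
  intro p q hpq
  obtain ⟨x, rfl⟩ := QuotientAddGroup.mk_surjective p
  obtain ⟨y, rfl⟩ := QuotientAddGroup.mk_surjective q
  by_contra! h
  refine hpq (QuotientAddGroup.eq.2 (exists_algebraMap_eq_of_standardCharacter_eq_one fun n => ?_))
  have h1 := h _ ⟨quotientCharacter n, Algebra.subset_adjoin ⟨n, rfl⟩, rfl⟩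
  simp only [quotientCharacter_mk] at h1
  rw [mul_add, standardCharacter_add, ← Circle.ext h1, ← standardCharacter_add, ← mul_add,
    neg_add_cancel, mul_zero, standardCharacter_zero]

variable {μN : Measure (Adeles F)} {D : Set (Adeles F)} [μN.IsAddHaarMeasure]

variable (μN D) in
/-- The probability measure on `𝔸 / F`. -/
def quotientProb : Measure (AdeleQuotient F) :=
  (adeleProb μN D).map QuotientAddGroup.mk

theorem measurable_adeleQuotient_mk :
    Measurable (QuotientAddGroup.mk : Adeles F → AdeleQuotient F) := measurable_quotient_mk''

theorem isProbabilityMeasure_quotientProb (hD : IsAdeleDomain D) (hfin : μN D < ∞) :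
    IsProbabilityMeasure (quotientProb μN D) := by
  have := isProbabilityMeasure_adeleProb hD hfin
  exact Measure.isProbabilityMeasure_map measurable_adeleQuotient_mk.aemeasurable

/-- Parseval's identity on `𝔸 / F`. -/
theorem tsum_enorm_quotientCharacter (hD : IsAdeleDomain D) (hfin : μN D < ∞)
    {f : AdeleQuotient F → ℂ} (hf : MemLp f 2 (quotientProb μN D)) :
    ∑' n : F, ‖∫ q, f q * starRingEnd ℂ (quotientCharacter n q) ∂(quotientProb μN D)‖ₑ ^ 2 =
      ∫⁻ q, ‖f q‖ₑ ^ 2 ∂(quotientProb μN D) := by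
  classical
  have := isProbabilityMeasure_quotientProb hD hfin
  let e : F → Lp ℂ 2 (quotientProb μN D) := fun n =>
    ContinuousMap.toLp (E := ℂ) 2 (quotientProb μN D) ℂ (quotientCharacter n)
  have horth : Orthonormal ℂ e := by
    rw [orthonormal_iff_ite]
    intro i j
    rw [ContinuousMap.inner_toLp]
    have h : ∀ q, quotientCharacter j q * starRingEnd ℂ (quotientCharacter i q) =
        quotientCharacter (j - i) q := fun q => by
      rw [sub_eq_add_neg, quotientCharacter_add, quotientCharacter_neg]; rfl
    simp_rw [h]
    rw [quotientProb, integral_map measurable_adeleQuotient_mk.aemeasurable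
      (quotientCharacter (j - i)).continuous.aestronglyMeasurable]
    simp_rw [quotientCharacter_mk]
    rw [integral_adeleProb_character hD hfin]
    simp only [sub_eq_zero, eq_comm]
  have hsp : ⊤ ≤ (Submodule.span ℂ (Set.range e)).topologicalClosure := by
    have h := (ContinuousMap.toLp_denseRange ℂ (quotientProb μN D) ℂ
      (p := 2) (by simp)).topologicalClosure_map_submodule
      (span_quotientCharacter_closure_eq_top (F := F))
    rw [Submodule.map_span, ← Set.range_comp] at h
    exact h.ge
  let b := HilbertBasis.mk horth hsp
  have hb : ∀ n, b n = e n := fun n => congrFun (HilbertBasis.coe_mk horth hsp) n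
  have hpar : HasSum (fun n => ‖inner ℂ (b n) (hf.toLp f)‖ ^ 2) (‖hf.toLp f‖ ^ 2) := by
    have h := b.hasSum_inner_mul_inner (hf.toLp f) (hf.toLp f)
    have h1 : ∀ n, inner ℂ (hf.toLp f) (b n) * inner ℂ (b n) (hf.toLp f) =
        ((‖inner ℂ (b n) (hf.toLp f)‖ ^ 2 : ℝ) : ℂ) := fun n => by
      rw [← inner_conj_symm, Complex.conj_mul']; push_cast; rfl
    have h2 : inner ℂ (hf.toLp f) (hf.toLp f) = ((‖hf.toLp f‖ ^ 2 : ℝ) : ℂ) := by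
      rw [inner_self_eq_norm_sq_to_K]; push_cast; rfl
    simp_rw [h1, h2] at h
    exact Complex.hasSum_ofReal.1 h
  have hc : ∀ n, inner ℂ (b n) (hf.toLp f) =
      ∫ q, f q * starRingEnd ℂ (quotientCharacter n q) ∂(quotientProb μN D) := fun n => by
    rw [hb, L2.inner_def]
    refine integral_congr_ae ?_
    filter_upwards [hf.coeFn_toLp, ContinuousMap.coeFn_toLp (E := ℂ) (p := 2) (𝕜 := ℂ)
      (quotientProb μN D) (quotientCharacter n)] with q h1 h2
    rw [h1, h2]
    rfl
  have hrhs : ∫⁻ q, ‖f q‖ₑ ^ 2 ∂(quotientProb μN D) = ‖hf.toLp f‖ₑ ^ 2 := by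
    rw [enorm_Lp_sq]
    refine lintegral_congr_ae ?_
    filter_upwards [hf.coeFn_toLp] with q h1
    rw [h1]
  rw [hrhs, enorm_sq_eq_ofReal, ← hpar.tsum_eq, ENNReal.ofReal_tsum_of_nonneg (fun n => sq_nonneg _) hpar.summable]
  exact tsum_congr fun n => by rw [hc, enorm_sq_eq_ofReal]

/-- Parseval's identity for `F`-periodic functions on `𝔸`. -/
theorem tsum_enorm_integral_adeleProb (hD : IsAdeleDomain D) (hfin : μN D < ∞)
    {f : Adeles F → ℂ} (hf : Measurable f) (hper : ∀ (ξ : F) x, f (algebraMap F _ ξ + x) = f x)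
    (h2 : ∫⁻ x, ‖f x‖ₑ ^ 2 ∂(adeleProb μN D) < ∞) :
    ∑' n : F, ‖∫ x, f x * starRingEnd ℂ (standardCharacter F (algebraMap F _ n * x) : ℂ)
      ∂(adeleProb μN D)‖ₑ ^ 2 = ∫⁻ x, ‖f x‖ₑ ^ 2 ∂(adeleProb μN D) := by
  let g : AdeleQuotient F → ℂ := fun q => Quotient.liftOn' q f (by
    intro x y hxy
    obtain ⟨ξ, hξ⟩ := QuotientAddGroup.leftRel_apply.1 hxy
    have : y = algebraMap F (Adeles F) ξ + x := by
      rw [← sub_eq_iff_eq_add, ← neg_add_eq_sub]; exact hξ.symm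
    rw [this, hper])
  have hg : Measurable g := measurable_from_quotient.2 hf
  have h1 : ∫⁻ q, ‖g q‖ₑ ^ 2 ∂(quotientProb μN D) = ∫⁻ x, ‖f x‖ₑ ^ 2 ∂(adeleProb μN D) := by
    rw [quotientProb, lintegral_map (by fun_prop) measurable_adeleQuotient_mk]
    rfl
  have hgm : MemLp g 2 (quotientProb μN D) :=
    (memLp_two_iff_lintegral hg.aestronglyMeasurable).2 (h1 ▸ h2)
  rw [← h1, ← tsum_enorm_quotientCharacter hD hfin hgm]
  refine tsum_congr fun n => ?_
  rw [quotientProb, integral_map measurable_adeleQuotient_mk.aemeasurable]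
  · rfl
  · exact (hg.mul (Complex.continuous_conj.comp
      (quotientCharacter n).continuous).measurable).aestronglyMeasurable

end Fourier

section QuotientMeasures

theorem lintegral_indicator_one_mul {X : Type*} [MeasurableSpace X] {μ : Measure X} {s : Set X}
    (hs : MeasurableSet s) (f : X → ℝ≥0∞) :
    ∫⁻ x, s.indicator 1 x * f x ∂μ = ∫⁻ x in s, f x ∂μ := by
  rw [← lintegral_indicator hs]
  refine lintegral_congr fun x => ?_
  by_cases h : x ∈ s <;> simp [h]

/-- A group is parametrised by the products `c⁻¹ w`, for `w` in a subgroup and `c` in a set of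
representatives of the cosets. -/
def cosetProdEquiv {A : Type*} [CommGroup A] (W : Subgroup A) : (A ⧸ W) × W ≃ A :=
  Equiv.ofBijective (fun p => p.1.out⁻¹ * p.2) (by
    constructor
    · rintro ⟨c, w⟩ ⟨c', w'⟩ h
      have h : c.out⁻¹ * (w : A) = c'.out⁻¹ * w' := h
      have hc : c = c' := by
        rw [← QuotientGroup.out_eq' c, ← QuotientGroup.out_eq' c', QuotientGroup.eq]
        have : c.out⁻¹ * c'.out = w' * (w : A)⁻¹ := by
          rw [eq_mul_inv_iff_mul_eq, mul_right_comm, h, mul_right_comm, inv_mul_cancel, one_mul]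
        rw [this]
        exact W.mul_mem w'.2 (W.inv_mem w.2)
      subst hc
      exact Prod.ext rfl (Subtype.ext (mul_left_cancel h))
    · intro δ
      obtain ⟨h, hh⟩ := QuotientGroup.mk_out_eq_mul W δ⁻¹
      refine ⟨(QuotientGroup.mk δ⁻¹, h), ?_⟩
      change ((QuotientGroup.mk δ⁻¹ : A ⧸ W).out)⁻¹ * (h : A) = δ
      rw [hh, mul_inv, inv_inv, inv_mul_cancel_right])

theorem cosetProdEquiv_apply {A : Type*} [CommGroup A] (W : Subgroup A) (p : (A ⧸ W) × W) :
    cosetProdEquiv W p = p.1.out⁻¹ * p.2 := rfl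

variable {F : Type u} [Field F] [NumberField F] {φ : MultCharacter F}
  {μN : Measure (Adeles F)} {μT : Measure (Ideles F)} {D : Set (Adeles F)} {E : Set (Ideles F)}

variable (φ) in
/-- The point `(x, a)` of `G(𝔸)`. -/
def GAdelic.of (x : Adeles F) (a : Ideles F) : GAdelic φ := ⟨x, a⟩

theorem GAdelic.continuous_of_pair :
    Continuous fun p : Adeles F × Ideles F => GAdelic.of φ p.1 p.2 :=
  GAdelic.continuous_of φ continuous_fst continuous_snd

theorem GAdelic.measurable_of_pair :
    Measurable fun p : Adeles F × Ideles F => GAdelic.of φ p.1 p.2 :=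
  GAdelic.continuous_of_pair.measurable

theorem lintegral_rightHaar [μN.IsAddHaarMeasure] [μT.IsHaarMeasure] {P : GAdelic φ → ℝ≥0∞}
    (hP : Measurable P) :
    ∫⁻ g, P g ∂(rightHaar φ μN μT) = ∫⁻ a, ∫⁻ x, P (GAdelic.of φ x a) ∂μN ∂μT := by
  have h : rightHaar φ μN μT = (μN.prod μT).map fun p => GAdelic.of φ p.1 p.2 := rfl
  rw [h, lintegral_map hP GAdelic.measurable_of_pair,
    lintegral_prod_symm (fun p => P (GAdelic.of φ p.1 p.2))
      (hP.comp GAdelic.measurable_of_pair).aemeasurable]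

theorem IsIdeleDomain.tsum_indicator (hE : IsIdeleDomain E) (a : Ideles F) :
    ∑' γ : Fˣ, E.indicator (1 : Ideles F → ℝ≥0∞) (principalIdele F γ * a) = 1 := by
  obtain ⟨γ, hγ, huniq⟩ := hE.2 a
  rw [tsum_eq_single γ]
  · simp [hγ]
  · intro δ hδ
    exact Set.indicator_of_notMem (fun h => hδ (huniq δ h)) _

theorem IsAdeleDomain.tsum_indicator (hD : IsAdeleDomain D) (x : Adeles F) :
    ∑' ξ : F, D.indicator (1 : Adeles F → ℝ≥0∞) (algebraMap F _ ξ + x) = 1 := by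
  obtain ⟨γ, hγ, huniq⟩ := hD.2 x
  rw [tsum_eq_single γ]
  · simp [hγ]
  · intro δ hδ
    exact Set.indicator_of_notMem (fun h => hδ (huniq δ h)) _

theorem lintegral_adeleProb [μN.IsAddHaarMeasure] (hD : IsAdeleDomain D) (hfin : μN D < ∞)
    (P : Adeles F → ℝ≥0∞) :
    ∫⁻ x in D, P x ∂μN = μN D * ∫⁻ x, P x ∂(adeleProb μN D) := by
  rw [adeleProb, lintegral_smul_measure, smul_eq_mul, ← mul_assoc,
    ENNReal.mul_inv_cancel hD.measure_ne_zero hfin.ne, one_mul]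

instance : Nontrivial (Adeles F) := by
  obtain ⟨t, ht⟩ := exists_standardCharacter_ne_one F
  exact ⟨t, 0, fun h => ht (by rw [h, standardCharacter_zero])⟩

/-- The group `T(F)` is parametrised by `Fˣ`. -/
def principalIdelesEquiv : Fˣ ≃ principalIdeles F :=
  (MonoidHom.ofInjective (f := principalIdele F)
    (Units.map_injective (algebraMap F (Adeles F)).injective)).toEquiv

/-- The group `G(F)` is parametrised by `F × Fˣ`. -/
def rationalPointsEquiv : F × Fˣ ≃ rationalPoints φ :=
  Equiv.ofBijective (fun p => ⟨GAdelic.of φ (algebraMap F _ p.1) (principalIdele F p.2),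
      ⟨⟨p.1, p.2⟩, rfl⟩⟩) (by
    constructor
    · rintro ⟨ξ, γ⟩ ⟨ξ', γ'⟩ h
      have h := Subtype.ext_iff.1 h
      have h1 : algebraMap F (Adeles F) ξ = algebraMap F _ ξ' := congrArg GPoints.x h
      have h2 : principalIdele F γ = principalIdele F γ' := congrArg GPoints.a h
      exact Prod.ext ((algebraMap F (Adeles F)).injective h1)
        (Units.map_injective (algebraMap F (Adeles F)).injective h2)
    · rintro ⟨_, ⟨⟨ξ, γ⟩, rfl⟩⟩
      exact ⟨(ξ, γ), rfl⟩)

theorem rationalPointsEquiv_mul (p : F × Fˣ) (g : GAdelic φ) :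
    (rationalPointsEquiv (φ := φ) p : GAdelic φ) * g =
      GAdelic.of φ (algebraMap F _ p.1 + algebraMap F _ (φ.app F p.2 : F) * g.x)
        (principalIdele F p.2 * GAdelic.idele φ g) := by
  have h : (φ.app (Adeles F) (principalIdele F p.2) : Adeles F) =
      algebraMap F _ (φ.app F p.2 : F) :=
    (congrArg Units.val (φ.naturality (Algebra.ofId F (Adeles F)) p.2)).symm
  rw [← h]
  rfl

theorem lintegral_rightCosets_principalIdeles {νT : Measure (RightCosets (principalIdeles F))}
    (hνT : IsQuotientMeasure (principalIdeles F) μT Measure.count νT) (hE : IsIdeleDomain E)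
    {P : RightCosets (principalIdeles F) → ℝ≥0∞} (hP : Measurable P) :
    ∫⁻ q, P q ∂νT = ∫⁻ a in E, P (Quotient.mk _ a) ∂μT := by
  have hm : Measurable fun a : Ideles F => E.indicator 1 a *
      P (Quotient.mk (QuotientGroup.rightRel (principalIdeles F)) a) :=
    (measurable_one.indicator hE.1).mul (hP.comp measurable_quotient_mk'')
  have h := hνT.weil _ hm
  rw [lintegral_indicator_one_mul hE.1] at h
  rw [h]
  refine lintegral_congr fun q => ?_
  have hm' : Measurable fun h : principalIdeles F => E.indicator 1 (h * q.out) *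
      P (Quotient.mk (QuotientGroup.rightRel (principalIdeles F)) (h * q.out)) :=
    hm.comp (measurable_subtype_coe.mul_const _)
  rw [lintegral_count' hm']
  have hq : ∀ h : principalIdeles F,
      Quotient.mk (QuotientGroup.rightRel (principalIdeles F)) (h * q.out) = q := fun h => by
    conv_rhs => rw [← Quotient.out_eq q]
    refine Quotient.sound (QuotientGroup.rightRel_apply.2 ?_)
    simp
  simp_rw [hq]
  rw [ENNReal.tsum_mul_right, ← principalIdelesEquiv.tsum_eq]
  have := hE.tsum_indicator q.out
  exact ((congrArg (· * P q) this).trans (one_mul _)).symm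

theorem lintegral_rightCosets_rationalPoints [μN.IsAddHaarMeasure] [μT.IsHaarMeasure]
    {νG : Measure (RightCosets (rationalPoints φ))}
    (hνG : IsQuotientMeasure (rationalPoints φ) (rightHaar φ μN μT) Measure.count νG)
    (hD : IsAdeleDomain D) (hfin : μN D < ∞) (hE : IsIdeleDomain E)
    {P : RightCosets (rationalPoints φ) → ℝ≥0∞} (hP : Measurable P) :
    ∫⁻ q, P q ∂νG =
      μN D * ∫⁻ a in E, ∫⁻ x, P (Quotient.mk _ (GAdelic.of φ x a)) ∂(adeleProb μN D) ∂μT := by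
  have hm : Measurable fun g : GAdelic φ => E.indicator 1 (GAdelic.idele φ g) *
      (D.indicator 1 g.x * P (Quotient.mk (QuotientGroup.rightRel (rationalPoints φ)) g)) :=
    ((measurable_one.indicator hE.1).comp (GAdelic.continuous_idele φ).measurable).mul
      (((measurable_one.indicator hD.1).comp (GAdelic.continuous_x φ).measurable).mul
        (hP.comp measurable_quotient_mk''))
  have h := hνG.weil _ hm
  rw [lintegral_rightHaar hm] at h
  have h1 : ∀ a : Ideles F, ∫⁻ x, E.indicator 1 (GAdelic.idele φ (GAdelic.of φ x a)) *
      (D.indicator 1 (GAdelic.of φ x a).x *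
        P (Quotient.mk (QuotientGroup.rightRel (rationalPoints φ)) (GAdelic.of φ x a))) ∂μN =
      E.indicator 1 a * (μN D * ∫⁻ x, P (Quotient.mk (QuotientGroup.rightRel (rationalPoints φ))
        (GAdelic.of φ x a)) ∂(adeleProb μN D)) := fun a => by
    rw [← lintegral_adeleProb hD hfin, ← lintegral_indicator_one_mul hD.1]
    exact lintegral_const_mul' (E.indicator 1 a) _ (by by_cases h : a ∈ E <;> simp [h])
  simp_rw [h1] at h
  rw [lintegral_indicator_one_mul hE.1, lintegral_const_mul' _ _ hfin.ne] at h
  rw [h]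
  refine lintegral_congr fun q => ?_
  have hm' : Measurable fun h : rationalPoints φ =>
      E.indicator 1 (GAdelic.idele φ (h * q.out)) * (D.indicator 1 ((h : GAdelic φ) * q.out).x *
        P (Quotient.mk (QuotientGroup.rightRel (rationalPoints φ)) (h * q.out))) :=
    hm.comp (measurable_subtype_coe.mul_const _)
  rw [lintegral_count' hm']
  have hq : ∀ h : rationalPoints φ,
      Quotient.mk (QuotientGroup.rightRel (rationalPoints φ)) (h * q.out) = q := fun h => by
    conv_rhs => rw [← Quotient.out_eq q]
    refine Quotient.sound (QuotientGroup.rightRel_apply.2 ?_)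
    simp
  simp only [hq]
  rw [← rationalPointsEquiv.tsum_eq]
  simp only [rationalPointsEquiv_mul]
  change _ = ∑' p : F × Fˣ, E.indicator 1 (principalIdele F p.2 * GAdelic.idele φ q.out) *
    (D.indicator 1 (algebraMap F _ p.1 + algebraMap F _ (φ.app F p.2 : F) * q.out.x) * P q)
  rw [ENNReal.tsum_prod (f := fun ξ γ => E.indicator (1 : Ideles F → ℝ≥0∞)
    (principalIdele F γ * GAdelic.idele φ q.out) * (D.indicator 1
      (algebraMap F _ ξ + algebraMap F _ (φ.app F γ : F) * q.out.x) * P q)), ENNReal.tsum_comm]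
  symm
  calc _ = ∑' γ : Fˣ, E.indicator (1 : Ideles F → ℝ≥0∞)
        (principalIdele F γ * GAdelic.idele φ q.out) * P q := tsum_congr fun γ => by
        rw [ENNReal.tsum_mul_left, ENNReal.tsum_mul_right, hD.tsum_indicator, one_mul]
    _ = P q := by rw [ENNReal.tsum_mul_right, hE.tsum_indicator, one_mul]

theorem lintegral_rightCosets_subgroupNW [μN.IsAddHaarMeasure] [μT.IsHaarMeasure]
    {νW : Measure (RightCosets (subgroupNW φ))}
    (hνW : IsQuotientMeasure (subgroupNW φ) (rightHaar φ μN μT) (haarNW φ μN) νW)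
    (hD : IsAdeleDomain D) (hfin : μN D < ∞) (hE : IsIdeleDomain E)
    {P : GAdelic φ → ℝ≥0∞} (hP : Measurable P)
    (hinv : ∀ (h : subgroupNW φ) g, P (h * g) = P g) :
    ∫⁻ q : RightCosets (subgroupNW φ), P q.out ∂νW =
      ∑' c : Fˣ ⧸ kernelW φ, ∫⁻ a in E, P (GAdelic.of φ 0 (principalIdele F c.out * a)) ∂μT := by
  have := NumberField.countable F
  have : Countable Fˣ := Units.val_injective.countable
  have : Countable (Fˣ ⧸ kernelW φ) := Quotient.countable
  let w (c : Fˣ ⧸ kernelW φ) : Ideles F → ℝ≥0∞ := fun a =>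
    E.indicator 1 (principalIdele F c.out⁻¹ * a)
  have hw : ∀ c, Measurable (w c) := fun c =>
    (measurable_one.indicator hE.1).comp (measurable_const_mul _)
  have hmk : Measurable fun a : Ideles F => P (GAdelic.of φ 0 a) :=
    hP.comp (GAdelic.measurable_of_pair.comp (measurable_const.prodMk measurable_id))
  have hx : ∀ x a, P (GAdelic.of φ x a) = P (GAdelic.of φ 0 a) := fun x a => by
    have h : GAdelic.of φ x a = GAdelic.of φ x 1 * GAdelic.of φ 0 a := by
      refine GPoints.ext ?_ ?_
      · change x = x + _ * (0 : Adeles F)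
        rw [mul_zero, add_zero]
      · exact (one_mul a).symm
    rw [h]
    exact hinv ⟨_, ⟨1, (kernelW φ).one_mem, map_one _⟩⟩ _
  have hm : Measurable fun g : GAdelic φ =>
      (D.indicator 1 g.x * P g) * ∑' c, w c (GAdelic.idele φ g) :=
    (((measurable_one.indicator hD.1).comp (GAdelic.continuous_x φ).measurable).mul hP).mul
      (Measurable.tsum fun c => (hw c).comp (GAdelic.continuous_idele φ).measurable)
  have h := hνW.weil _ hm
  have hL : ∫⁻ g : GAdelic φ, (D.indicator 1 g.x * P g) * ∑' c, w c (GAdelic.idele φ g)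
      ∂(rightHaar φ μN μT) = μN D * ∑' c : Fˣ ⧸ kernelW φ,
        ∫⁻ a in E, P (GAdelic.of φ 0 (principalIdele F c.out * a)) ∂μT := by
    rw [lintegral_rightHaar hm]
    calc _ = ∫⁻ a, ∑' c, μN D * (w c a * P (GAdelic.of φ 0 a)) ∂μT := by
          refine lintegral_congr fun a => ?_
          have : ∀ x, (D.indicator 1 (GAdelic.of φ x a).x * P (GAdelic.of φ x a)) *
              ∑' c, w c (GAdelic.idele φ (GAdelic.of φ x a)) =
              D.indicator 1 x * (P (GAdelic.of φ 0 a) * ∑' c, w c a) := fun x => by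
            rw [hx, mul_assoc]; rfl
          simp_rw [this]
          rw [lintegral_indicator_one_mul hD.1, setLIntegral_const, mul_comm,
            ENNReal.tsum_mul_left, ENNReal.tsum_mul_right, mul_comm (P _)]
      _ = ∑' c, μN D * ∫⁻ a, w c a * P (GAdelic.of φ 0 a) ∂μT := by
          have hc : ∀ c, AEMeasurable (fun a => μN D * (w c a * P (GAdelic.of φ 0 a))) μT :=
            fun c => (((hw c).mul hmk).const_mul _).aemeasurable
          rw [lintegral_tsum hc]
          simp_rw [lintegral_const_mul' _ _ hfin.ne]
      _ = _ := by
          rw [ENNReal.tsum_mul_left]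
          congr 1
          refine tsum_congr fun c => ?_
          rw [← lintegral_mul_left_eq_self _ (principalIdele F c.out),
            ← lintegral_indicator_one_mul hE.1]
          refine lintegral_congr fun a => ?_
          simp only [w]
          rw [map_inv, inv_mul_cancel_left]
  have hR : ∀ q : RightCosets (subgroupNW φ),
      ∫⁻ h : subgroupNW φ, (D.indicator 1 ((h : GAdelic φ) * q.out).x * P (h * q.out)) *
        ∑' c, w c (GAdelic.idele φ (h * q.out)) ∂(haarNW φ μN) = μN D * P q.out := fun q => by
    have hmem : ∀ (δ : kernelW φ) (x : Adeles F),
        GAdelic.of φ x (principalIdele F δ) ∈ subgroupNW φ := fun δ x =>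
      ⟨δ, δ.2, rfl⟩
    have hmeas : ∀ δ : kernelW φ, Measurable fun x : Adeles F =>
        (⟨GAdelic.of φ x (principalIdele F δ), hmem δ x⟩ : subgroupNW φ) := fun δ =>
      Measurable.subtype_mk
        (GAdelic.measurable_of_pair.comp (measurable_id.prodMk measurable_const))
    have hH : haarNW φ μN = Measure.sum fun δ : kernelW φ => μN.map fun x : Adeles F =>
      (⟨GAdelic.of φ x (principalIdele F δ), hmem δ x⟩ : subgroupNW φ) := rfl
    rw [hH, lintegral_sum_measure]
    calc _ = ∑' δ : kernelW φ, μN D * P q.out *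
          ∑' c, w c (principalIdele F δ * GAdelic.idele φ q.out) := by
          refine tsum_congr fun δ => ?_
          have hm' : Measurable fun h : subgroupNW φ =>
              (D.indicator 1 ((h : GAdelic φ) * q.out).x * P (h * q.out)) *
                ∑' c, w c (GAdelic.idele φ (h * q.out)) :=
            hm.comp (measurable_subtype_coe.mul_const _)
          rw [lintegral_map hm' (hmeas δ)]
          have : ∀ x, (D.indicator 1 (GAdelic.of φ x (principalIdele F δ) * q.out).x *
              P (GAdelic.of φ x (principalIdele F δ) * q.out)) *
              ∑' c, w c (GAdelic.idele φ (GAdelic.of φ x (principalIdele F δ) * q.out)) =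
              D.indicator 1 (x + φ.app (Adeles F) (principalIdele F δ) * q.out.x) *
                (P q.out * ∑' c, w c (principalIdele F δ * GAdelic.idele φ q.out)) := fun x => by
            rw [hinv ⟨_, hmem δ x⟩, mul_assoc]; rfl
          simp_rw [this]
          rw [lintegral_add_right_eq_self (μ := μN) (fun x => D.indicator 1 x *
            (P q.out * ∑' c, w c (principalIdele F δ * GAdelic.idele φ q.out))),
            lintegral_indicator_one_mul hD.1, setLIntegral_const]
          ring
      _ = μN D * P q.out * ∑' δ : kernelW φ, ∑' c : Fˣ ⧸ kernelW φ,
            E.indicator 1 (principalIdele F (c.out⁻¹ * δ) * GAdelic.idele φ q.out) := by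
          rw [ENNReal.tsum_mul_left]
          simp only [w, map_mul, mul_assoc]
      _ = μN D * P q.out := by
          rw [ENNReal.tsum_comm, ← ENNReal.tsum_prod (f := fun (c : Fˣ ⧸ kernelW φ)
            (δ : kernelW φ) => E.indicator (1 : Ideles F → ℝ≥0∞) (principalIdele F (c.out⁻¹ * δ) * GAdelic.idele φ q.out))]
          have := (cosetProdEquiv (kernelW φ)).tsum_eq (fun γ =>
            E.indicator (1 : Ideles F → ℝ≥0∞) (principalIdele F γ * GAdelic.idele φ q.out))
          simp only [cosetProdEquiv_apply] at this
          rw [this, hE.tsum_indicator, mul_one]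
  rw [hL] at h
  simp_rw [hR] at h
  rw [lintegral_const_mul' _ _ hfin.ne] at h
  exact ((ENNReal.mul_right_inj hD.measure_ne_zero hfin.ne).1 h).symm

end QuotientMeasures

section FourierCoefficients

variable {F : Type u} [Field F] [NumberField F] {φ : MultCharacter F}
  {μN : Measure (Adeles F)} {μT : Measure (Ideles F)} {D : Set (Adeles F)} {E : Set (Ideles F)}
  {νG : Measure (RightCosets (rationalPoints φ))}

variable (φ) in
/-- The class of `(x, a)` in `G(F) \ G(𝔸)`. -/
def cosetOf (x : Adeles F) (a : Ideles F) : RightCosets (rationalPoints φ) :=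
  Quotient.mk _ (GAdelic.of φ x a)

theorem measurable_cosetOf : Measurable fun p : Ideles F × Adeles F => cosetOf φ p.2 p.1 :=
  measurable_quotient_mk''.comp (GAdelic.measurable_of_pair.comp measurable_swap)

theorem rationalPoints_mk_mul (h : rationalPoints φ) (g : GAdelic φ) :
    (Quotient.mk _ (h * g) : RightCosets (rationalPoints φ)) = Quotient.mk _ g := by
  refine Quotient.sound (QuotientGroup.rightRel_apply.2 ?_)
  simp

theorem cosetOf_eq (ξ : F) (γ : Fˣ) (x : Adeles F) (a : Ideles F) :
    cosetOf φ (algebraMap F _ ξ + algebraMap F _ (φ.app F γ : F) * x) (principalIdele F γ * a) =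
      cosetOf φ x a := by
  rw [cosetOf, cosetOf, ← rationalPoints_mk_mul (rationalPointsEquiv (ξ, γ)) (GAdelic.of φ x a),
    rationalPointsEquiv_mul]
  rfl

theorem cosetOf_add (ξ : F) (x : Adeles F) (a : Ideles F) :
    cosetOf φ (algebraMap F _ ξ + x) a = cosetOf φ x a := by
  have h := cosetOf_eq (φ := φ) ξ 1 x a
  rwa [map_one, map_one, Units.val_one, map_one, one_mul, one_mul] at h

theorem cosetOf_mul (γ : Fˣ) (x : Adeles F) (a : Ideles F) :
    cosetOf φ (algebraMap F _ (φ.app F γ : F) * x) (principalIdele F γ * a) = cosetOf φ x a := by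
  have h := cosetOf_eq (φ := φ) 0 γ x a
  rwa [map_zero, zero_add] at h

theorem mulRight_cosetOf (g : GAdelic φ) (x : Adeles F) (a : Ideles F) :
    RightCosets.mulRight (rationalPoints φ) g (cosetOf φ x a) =
      cosetOf φ (x + φ.app (Adeles F) a * g.x) (a * GAdelic.idele φ g) := rfl

theorem eq_smul_map_cosetOf [μN.IsAddHaarMeasure] [μT.IsHaarMeasure]
    (hνG : IsQuotientMeasure (rationalPoints φ) (rightHaar φ μN μT) Measure.count νG)
    (hD : IsAdeleDomain D) (hfin : μN D < ∞) (hE : IsIdeleDomain E) :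
    νG = μN D • ((μT.restrict E).prod (adeleProb μN D)).map fun p => cosetOf φ p.2 p.1 := by
  have := isProbabilityMeasure_adeleProb hD hfin
  refine Measure.ext_of_lintegral _ fun P hP => ?_
  rw [lintegral_rightCosets_rationalPoints hνG hD hfin hE hP, lintegral_smul_measure,
    lintegral_map hP measurable_cosetOf, lintegral_prod (fun p => P (cosetOf φ p.2 p.1))
      (hP.comp measurable_cosetOf).aemeasurable]
  rfl

/-- The Fourier coefficient `∫_{𝔸 / F} f(x, a) conj (ψ_n(x)) dx` of a function on
`G(F) \ G(𝔸)`. -/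
def adelicCoeff (μ : Measure (Adeles F)) (f : RightCosets (rationalPoints φ) → ℂ) (n : F)
    (a : Ideles F) : ℂ :=
  ∫ x, f (cosetOf φ x a) *
    starRingEnd ℂ (standardCharacter F (algebraMap F (Adeles F) n * x) : ℂ) ∂μ

theorem measurable_conj_standardCharacter (n : F) : Measurable fun x : Adeles F =>
    starRingEnd ℂ (standardCharacter F (algebraMap F (Adeles F) n * x) : ℂ) :=
  (Complex.continuous_conj.comp
    (continuous_subtype_val.comp (continuous_standardCharacter_mul n))).measurable

theorem measurable_adelicCoeff {μ : Measure (Adeles F)} [SFinite μ]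
    {f : RightCosets (rationalPoints φ) → ℂ} (hf : Measurable f) (n : F) :
    Measurable (adelicCoeff μ f n) := by
  have h : StronglyMeasurable fun p : Ideles F × Adeles F => f (cosetOf φ p.2 p.1) *
      starRingEnd ℂ (standardCharacter F (algebraMap F (Adeles F) n * p.2) : ℂ) :=
    ((hf.comp measurable_cosetOf).mul
      ((measurable_conj_standardCharacter n).comp measurable_snd)).stronglyMeasurable
  exact h.integral_prod_right'.measurable

variable [μN.IsAddHaarMeasure]

theorem adelicCoeff_principalIdele_mul (hD : IsAdeleDomain D) (hfin : μN D < ∞)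
    (f : RightCosets (rationalPoints φ) → ℂ) (n : F) (γ : Fˣ) (a : Ideles F) :
    adelicCoeff (adeleProb μN D) f n (principalIdele F γ * a) =
      adelicCoeff (adeleProb μN D) f (n * φ.app F γ) a := by
  rw [adelicCoeff, ← integral_adeleProb_mul_left hD hfin (f := fun x =>
    f (cosetOf φ x (principalIdele F γ * a)) *
      starRingEnd ℂ (standardCharacter F (algebraMap F (Adeles F) n * x) : ℂ))
    (fun ξ x => by simp only [cosetOf_add, standardCharacter_mul_add]) (φ.app F γ), adelicCoeff]
  simp only [cosetOf_mul, map_mul, mul_assoc]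

theorem adelicCoeff_mulRight (hD : IsAdeleDomain D) (hfin : μN D < ∞)
    (f : RightCosets (rationalPoints φ) → ℂ) (n : F) (g : GAdelic φ) (a : Ideles F) :
    adelicCoeff (adeleProb μN D) (f ∘ RightCosets.mulRight (rationalPoints φ) g) n a =
      standardCharacter F (algebraMap F (Adeles F) n * (φ.app (Adeles F) a * g.x)) *
        adelicCoeff (adeleProb μN D) f n (a * GAdelic.idele φ g) := by
  have h : ∀ x, standardCharacter F (algebraMap F (Adeles F) n * (φ.app (Adeles F) a * g.x)) *
      (f (cosetOf φ (x + φ.app (Adeles F) a * g.x) (a * GAdelic.idele φ g)) *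
        starRingEnd ℂ (standardCharacter F (algebraMap F (Adeles F) n *
          (x + φ.app (Adeles F) a * g.x)) : ℂ)) =
      f (cosetOf φ (x + φ.app (Adeles F) a * g.x) (a * GAdelic.idele φ g)) *
        starRingEnd ℂ (standardCharacter F (algebraMap F (Adeles F) n * x) : ℂ) := fun x => by
    rw [mul_add, standardCharacter_add, Circle.coe_mul, map_mul]
    have : ∀ z : Circle, (z : ℂ) * starRingEnd ℂ (z : ℂ) = 1 := fun z => by
      rw [Complex.mul_conj, Circle.normSq_coe, Complex.ofReal_one]
    linear_combination f (cosetOf φ (x + φ.app (Adeles F) a * g.x) (a * GAdelic.idele φ g)) *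
        starRingEnd ℂ (standardCharacter F (algebraMap F (Adeles F) n * x) : ℂ) *
      this (standardCharacter F (algebraMap F (Adeles F) n * (φ.app (Adeles F) a * g.x)))
  rw [adelicCoeff, adelicCoeff, ← integral_adeleProb_add_right hD hfin (f := fun x =>
    f (cosetOf φ x (a * GAdelic.idele φ g)) *
      starRingEnd ℂ (standardCharacter F (algebraMap F (Adeles F) n * x) : ℂ))
    (fun ξ x => by simp only [cosetOf_add, standardCharacter_mul_add])
    (φ.app (Adeles F) a * g.x), ← integral_const_mul]
  refine integral_congr_ae (Filter.Eventually.of_forall fun x => ?_)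
  beta_reduce
  rw [h, Function.comp_apply, mulRight_cosetOf]

variable [μT.IsHaarMeasure]

theorem ae_ae_cosetOf
    (hνG : IsQuotientMeasure (rationalPoints φ) (rightHaar φ μN μT) Measure.count νG)
    (hD : IsAdeleDomain D) (hfin : μN D < ∞) (hE : IsIdeleDomain E)
    {p : RightCosets (rationalPoints φ) → Prop} (h : ∀ᵐ q ∂νG, p q) :
    ∀ᵐ a ∂(μT.restrict E), ∀ᵐ x ∂(adeleProb μN D), p (cosetOf φ x a) := by
  have := isProbabilityMeasure_adeleProb hD hfin
  rw [eq_smul_map_cosetOf hνG hD hfin hE, Measure.ae_ennreal_smul_measure_iff hD.measure_ne_zero] at h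
  exact Measure.ae_ae_of_ae_prod (ae_of_ae_map measurable_cosetOf.aemeasurable h)

theorem ae_memLp_cosetOf
    (hνG : IsQuotientMeasure (rationalPoints φ) (rightHaar φ μN μT) Measure.count νG)
    (hD : IsAdeleDomain D) (hfin : μN D < ∞) (hE : IsIdeleDomain E)
    {f : RightCosets (rationalPoints φ) → ℂ} (hf : Measurable f) (h2 : MemLp f 2 νG) :
    ∀ᵐ a ∂(μT.restrict E), MemLp (fun x => f (cosetOf φ x a)) 2 (adeleProb μN D) := by
  have := isProbabilityMeasure_adeleProb hD hfin
  have h := (memLp_two_iff_lintegral hf.aestronglyMeasurable).1 h2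
  have hm : Measurable fun p : Ideles F × Adeles F => ‖f (cosetOf φ p.2 p.1)‖ₑ ^ 2 :=
    (hf.comp measurable_cosetOf).enorm.pow_const 2
  rw [lintegral_rightCosets_rationalPoints hνG hD hfin hE (hf.enorm.pow_const 2)] at h
  have h' := ENNReal.lt_top_of_mul_ne_top_right h.ne hD.measure_ne_zero
  filter_upwards [ae_lt_top hm.lintegral_prod_right' h'.ne] with a ha
  exact (memLp_two_iff_lintegral (hf.comp
    (measurable_cosetOf.comp measurable_prodMk_left)).aestronglyMeasurable).2 ha

end FourierCoefficients

section DirectSum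

/-- A family of linear maps whose squared norms add up to the squared norm gives an isometry into
the Hilbert sum. -/
theorem exists_linearIsometry_hilbertSum {L H₀ ι : Type*} {H : ι → Type*} [NormedAddCommGroup L]
    [InnerProductSpace ℂ L] [NormedAddCommGroup H₀] [InnerProductSpace ℂ H₀]
    [∀ i, NormedAddCommGroup (H i)] [∀ i, InnerProductSpace ℂ (H i)]
    (T₀ : L →ₗ[ℂ] H₀) (T : ∀ i, L →ₗ[ℂ] H i)
    (h : ∀ f, ‖f‖ₑ ^ 2 = ‖T₀ f‖ₑ ^ 2 + ∑' i, ‖T i f‖ₑ ^ 2) :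
    ∃ U : L →ₗᵢ[ℂ] WithLp 2 (H₀ × lp H 2), ∀ f, (U f).fst = T₀ f ∧ ∀ i, (U f).snd i = T i f := by
  have hsum : ∀ f, HasSum (fun i => ‖T i f‖ ^ 2) (‖f‖ ^ 2 - ‖T₀ f‖ ^ 2) := fun f => by
    have h1 := h f
    simp only [enorm_sq_eq_ofReal] at h1
    have hne : ∑' i, ENNReal.ofReal (‖T i f‖ ^ 2) ≠ ∞ := fun h2 => by
      rw [h2, add_top] at h1
      exact ENNReal.ofReal_ne_top h1
    have hs : Summable fun i => ‖T i f‖ ^ 2 := by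
      have := ENNReal.summable_toReal hne
      simpa only [ENNReal.toReal_ofReal (sq_nonneg _)] using this
    rw [← ENNReal.ofReal_tsum_of_nonneg (fun _ => sq_nonneg _) hs,
      ← ENNReal.ofReal_add (sq_nonneg _) (tsum_nonneg fun _ => sq_nonneg _),
      ENNReal.ofReal_eq_ofReal_iff (sq_nonneg _)
        (add_nonneg (sq_nonneg _) (tsum_nonneg fun _ => sq_nonneg _))] at h1
    rw [h1, add_sub_cancel_left]
    exact hs.hasSum
  have hmem : ∀ f, Memℓp (fun i => T i f) 2 := fun f => by
    refine memℓp_gen ?_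
    simpa using (hsum f).summable
  let U₀ : L →ₗ[ℂ] WithLp 2 (H₀ × lp H 2) :=
    { toFun := fun f => WithLp.toLp 2 (T₀ f, ⟨fun i => T i f, hmem f⟩)
      map_add' := fun f g => by
        rw [← WithLp.toLp_add, Prod.mk_add_mk, map_add]
        congr 2
        ext i
        exact map_add (T i) f g
      map_smul' := fun c f => by
        rw [RingHom.id_apply, ← WithLp.toLp_smul, Prod.smul_mk, map_smul]
        congr 2
        ext i
        exact map_smul (T i) c f }
  refine ⟨⟨U₀, fun f => ?_⟩, fun f => ⟨rfl, fun i => rfl⟩⟩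
  rw [← sq_eq_sq₀ (norm_nonneg _) (norm_nonneg _), WithLp.prod_norm_sq_eq_of_L2]
  have h1 := lp.norm_rpow_eq_tsum (p := 2) (by norm_num) (U₀ f).snd
  simp only [ENNReal.toReal_ofNat, Real.rpow_ofNat] at h1
  rw [h1]
  have h2 : ∑' i, ‖(U₀ f).snd i‖ ^ 2 = ‖f‖ ^ 2 - ‖T₀ f‖ ^ 2 := (hsum f).tsum_eq
  rw [h2]
  exact add_sub_cancel _ _

theorem tsum_eq_zero_add_tsum_units {K : Type*} [Field K] (u : K → ℝ≥0∞) :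
    ∑' x, u x = u 0 + ∑' x : Kˣ, u x := by
  classical
  rw [ENNReal.tsum_eq_add_tsum_ite 0, ← Units.val_injective.tsum_eq]
  · simp
  · intro x hx
    refine ⟨Units.mk0 x fun h => hx ?_, rfl⟩
    simp [h]

/-- For representatives `n` of the cokernel of an endomorphism `φ`, every element is uniquely
`n c * φ γ` with `γ` in a set of representatives modulo the kernel. -/
def cokernelProdEquiv {A : Type*} [CommGroup A] (φ : A →* A) (n : A ⧸ φ.range → A)
    (hn : ∀ c, (QuotientGroup.mk (n c) : A ⧸ φ.range) = c) : (A ⧸ φ.range) × (A ⧸ φ.ker) ≃ A :=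
  Equiv.ofBijective (fun p => n p.1 * φ p.2.out) (by
    constructor
    · rintro ⟨c, γ⟩ ⟨c', γ'⟩ h
      have h : n c * φ γ.out = n c' * φ γ'.out := h
      have hc : c = c' := by
        rw [← hn c, ← hn c', QuotientGroup.eq]
        refine ⟨γ.out * γ'.out⁻¹, ?_⟩
        rw [map_mul, map_inv, mul_inv_eq_iff_eq_mul, mul_assoc, ← h, inv_mul_cancel_left]
      subst hc
      have hγ := mul_left_cancel h
      refine Prod.ext rfl ?_
      change γ = γ'
      rw [← QuotientGroup.out_eq' γ, ← QuotientGroup.out_eq' γ', QuotientGroup.eq]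
      rw [MonoidHom.mem_ker, map_mul, map_inv, hγ, inv_mul_cancel]
    · intro m
      obtain ⟨δ, hδ⟩ := QuotientGroup.eq.1 (hn (QuotientGroup.mk m))
      obtain ⟨h, hh⟩ := QuotientGroup.mk_out_eq_mul φ.ker δ
      refine ⟨(QuotientGroup.mk m, QuotientGroup.mk δ), ?_⟩
      change n _ * φ (QuotientGroup.mk δ : A ⧸ φ.ker).out = m
      rw [hh, map_mul, h.2, mul_one, hδ, mul_inv_cancel_left])

end DirectSum

section InducedNorm

theorem PreInduced.enorm_sq {G : Type*} [Group G] [MeasurableSpace G] {H : Subgroup G}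
    {χ : H → Circle} {ν : Measure (RightCosets H)} (p : PreInduced H χ ν) :
    ‖p‖ₑ ^ 2 = ∫⁻ q : RightCosets H, ‖p.fn q.out‖ₑ ^ 2 ∂ν := by
  have h : ‖p‖ ^ 2 = ∫ q : RightCosets H, ‖p.fn q.out‖ ^ 2 ∂ν := by
    have h1 : (fun q : RightCosets H => starRingEnd ℂ (p.fn q.out) * p.fn q.out) =
        fun q => ((‖p.fn q.out‖ ^ 2 : ℝ) : ℂ) := by
      funext q
      rw [← Complex.normSq_eq_conj_mul_self, Complex.normSq_eq_norm_sq]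
    rw [@norm_sq_eq_re_inner ℂ, PreInduced.inner_def, h1, integral_complex_ofReal]
    exact RCLike.ofReal_re (K := ℂ) _
  rw [enorm_sq_eq_ofReal, h, ofReal_integral_eq_lintegral_ofReal p.memLp.integrable_sq
    (Filter.Eventually.of_forall fun q => sq_nonneg _)]
  simp only [enorm_sq_eq_ofReal]

theorem Induced.enorm_mk_sq {G : Type*} [Group G] [MeasurableSpace G] {H : Subgroup G}
    {χ : H → Circle} {ν : Measure (RightCosets H)} (p : PreInduced H χ ν) :
    ‖(SeparationQuotient.mk p : Induced H χ ν)‖ₑ ^ 2 =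
      ∫⁻ q : RightCosets H, ‖p.fn q.out‖ₑ ^ 2 ∂ν := by
  rw [← PreInduced.enorm_sq, enorm_sq_eq_ofReal, enorm_sq_eq_ofReal, SeparationQuotient.norm_mk]

variable {F : Type u} [Field F] [NumberField F] {φ : MultCharacter F}
  {μN : Measure (Adeles F)} {μT : Measure (Ideles F)} {D : Set (Adeles F)} {E : Set (Ideles F)}
  {νW : Measure (RightCosets (subgroupNW φ))} [μN.IsAddHaarMeasure] [μT.IsHaarMeasure]

theorem lintegral_enorm_sq_subgroupNW
    (hνW : IsQuotientMeasure (subgroupNW φ) (rightHaar φ μN μT) (haarNW φ μN) νW)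
    (hD : IsAdeleDomain D) (hfin : μN D < ∞) (hE : IsIdeleDomain E) {n : Fˣ}
    {p : GAdelic φ → ℂ} (hp : Measurable p)
    (hinv : ∀ (h : subgroupNW φ) g, p (h * g) = characterNW φ n h * p g) :
    ∫⁻ q : RightCosets (subgroupNW φ), ‖p q.out‖ₑ ^ 2 ∂νW =
      ∑' γ : Fˣ ⧸ kernelW φ,
        ∫⁻ a in E, ‖p (GAdelic.of φ 0 (principalIdele F γ.out * a))‖ₑ ^ 2 ∂μT :=
  lintegral_rightCosets_subgroupNW hνW hD hfin hE (P := fun g => ‖p g‖ₑ ^ 2)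
    (hp.enorm.pow_const 2) fun h g => by
      have := norm_equivariant hinv h g
      rw [enorm_sq_eq_ofReal, enorm_sq_eq_ofReal, this]

theorem Induced.mk_eq_mk_of_ae
    (hνW : IsQuotientMeasure (subgroupNW φ) (rightHaar φ μN μT) (haarNW φ μN) νW)
    (hD : IsAdeleDomain D) (hfin : μN D < ∞) (hE : IsIdeleDomain E) {n : Fˣ}
    {p p' : PreInduced (subgroupNW φ) (characterNW φ n) νW}
    (h : ∀ᵐ a ∂(μT.restrict E), ∀ γ : Fˣ ⧸ kernelW φ,
      p.fn (GAdelic.of φ 0 (principalIdele F γ.out * a)) =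
        p'.fn (GAdelic.of φ 0 (principalIdele F γ.out * a))) :
    (SeparationQuotient.mk p : Induced (subgroupNW φ) (characterNW φ n) νW) =
      SeparationQuotient.mk p' := by
  rw [← sub_eq_zero, ← SeparationQuotient.mk_sub, ← enorm_eq_zero,
    ← pow_eq_zero_iff (n := 2) two_ne_zero, Induced.enorm_mk_sq,
    lintegral_enorm_sq_subgroupNW hνW hD hfin hE (p - p').measurable_fn (p - p').fn_mul,
    ENNReal.tsum_eq_zero]
  intro γ
  refine (lintegral_congr_ae ?_).trans (lintegral_zero)
  filter_upwards [h] with a ha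
  have : (p - p').fn (GAdelic.of φ 0 (principalIdele F γ.out * a)) =
    p.fn (GAdelic.of φ 0 (principalIdele F γ.out * a)) -
        p'.fn (GAdelic.of φ 0 (principalIdele F γ.out * a)) := rfl
  rw [this, ha γ, sub_self]
  simp

end InducedNorm

section NormIdentity

variable {F : Type u} [Field F] [NumberField F] {φ : MultCharacter F}
  {μN : Measure (Adeles F)} {μT : Measure (Ideles F)} {D : Set (Adeles F)} {E : Set (Ideles F)}
  {νG : Measure (RightCosets (rationalPoints φ))} [μN.IsAddHaarMeasure] [μT.IsHaarMeasure]

/-- The squared norm of a function on `G(F) \ G(𝔸)` in terms of its Fourier coefficients. -/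
theorem lintegral_eq_adelicCoeff
    (hνG : IsQuotientMeasure (rationalPoints φ) (rightHaar φ μN μT) Measure.count νG)
    (hD : IsAdeleDomain D) (hfin : μN D < ∞) (hE : IsIdeleDomain E)
    (n : Fˣ ⧸ (φ.app F).range → Fˣ)
    (hn : ∀ c : Fˣ ⧸ (φ.app F).range, (QuotientGroup.mk (n c) : Fˣ ⧸ (φ.app F).range) = c)
    {f : RightCosets (rationalPoints φ) → ℂ} (hf : Measurable f) (h2 : MemLp f 2 νG) :
    ∫⁻ q, ‖f q‖ₑ ^ 2 ∂νG =
      μN D * (∫⁻ a in E, ‖adelicCoeff (adeleProb μN D) f 0 a‖ₑ ^ 2 ∂μT +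
        ∑' c, ∑' γ : Fˣ ⧸ kernelW φ, ∫⁻ a in E,
          ‖adelicCoeff (adeleProb μN D) f (n c) (principalIdele F γ.out * a)‖ₑ ^ 2 ∂μT) := by
  have := isProbabilityMeasure_adeleProb hD hfin
  have := NumberField.countable F
  have hpar : ∀ᵐ a ∂(μT.restrict E), ∫⁻ x, ‖f (cosetOf φ x a)‖ₑ ^ 2 ∂(adeleProb μN D) =
      ∑' m : F, ‖adelicCoeff (adeleProb μN D) f m a‖ₑ ^ 2 := by
    filter_upwards [ae_memLp_cosetOf hνG hD hfin hE hf h2] with a ha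
    have hm : Measurable fun x => f (cosetOf φ x a) :=
      hf.comp (measurable_cosetOf.comp measurable_prodMk_left)
    exact (tsum_enorm_integral_adeleProb hD hfin hm
      (fun ξ x => by rw [cosetOf_add])
      ((memLp_two_iff_lintegral hm.aestronglyMeasurable).1 ha)).symm
  have hmeas : ∀ m : F, Measurable fun a => ‖adelicCoeff (adeleProb μN D) f m a‖ₑ ^ 2 :=
    fun m => (measurable_adelicCoeff hf m).enorm.pow_const 2
  rw [lintegral_rightCosets_rationalPoints hνG hD hfin hE (hf.enorm.pow_const 2)]
  congr 1
  refine (lintegral_congr_ae hpar).trans ?_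
  rw [lintegral_tsum fun m => (hmeas m).aemeasurable, tsum_eq_zero_add_tsum_units]
  congr 1
  rw [← (cokernelProdEquiv (φ.app F) n hn).tsum_eq, ← ENNReal.tsum_prod (f := fun c
    (γ : Fˣ ⧸ kernelW φ) => ∫⁻ a in E,
      ‖adelicCoeff (adeleProb μN D) f (n c) (principalIdele F γ.out * a)‖ₑ ^ 2 ∂μT)]
  refine tsum_congr fun p => ?_
  simp_rw [adelicCoeff_principalIdele_mul hD hfin, ← Units.val_mul]
  rfl

end NormIdentity

section Components

variable {F : Type u} [Field F] [NumberField F] {φ : MultCharacter F}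
  {μN : Measure (Adeles F)} {μT : Measure (Ideles F)} {D : Set (Adeles F)} {E : Set (Ideles F)}
  {νG : Measure (RightCosets (rationalPoints φ))} {νT : Measure (RightCosets (principalIdeles F))}
  {νW : Measure (RightCosets (subgroupNW φ))}

variable (μN D) in
/-- The square root of the volume of `𝔸 / F`. -/
def adelicScale : ℂ := (Real.sqrt (μN D).toReal : ℝ)

theorem enorm_adelicScale_sq (hfin : μN D < ∞) : ‖adelicScale μN D‖ₑ ^ 2 = μN D := by
  rw [enorm_sq_eq_ofReal, adelicScale, Complex.norm_real, Real.norm_eq_abs, sq_abs,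
    Real.sq_sqrt ENNReal.toReal_nonneg, ENNReal.ofReal_toReal hfin.ne]

variable (μN D) in
/-- The constant term of a function on `G(F) \ G(𝔸)`, as a function on `T(F) \ T(𝔸)`. -/
def constantTerm (f : RightCosets (rationalPoints φ) → ℂ) (q : RightCosets (principalIdeles F)) :
    ℂ :=
  adelicScale μN D * adelicCoeff (adeleProb μN D) f 0 q.out

variable (μN D) in
/-- The function `(x, a) ↦ ψ_n(x) f_n(a)`, for the Fourier coefficient `f_n`. -/
def whittakerTerm (f : RightCosets (rationalPoints φ) → ℂ) (n : F) (g : GAdelic φ) : ℂ :=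
  standardCharacter F (algebraMap F (Adeles F) n * g.x) *
    (adelicScale μN D * adelicCoeff (adeleProb μN D) f n (GAdelic.idele φ g))

theorem app_principalIdele (γ : Fˣ) :
    (φ.app (Adeles F) (principalIdele F γ) : Adeles F) = algebraMap F _ (φ.app F γ : F) :=
  (congrArg Units.val (φ.naturality (Algebra.ofId F (Adeles F)) γ)).symm

theorem whittakerTerm_of_zero (f : RightCosets (rationalPoints φ) → ℂ) (n : F) (a : Ideles F) :
    whittakerTerm μN D f n (GAdelic.of φ 0 a) =
      adelicScale μN D * adelicCoeff (adeleProb μN D) f n a := by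
  have h : (GAdelic.of φ 0 a).x = 0 := rfl
  rw [whittakerTerm, h, mul_zero, standardCharacter_zero, Circle.coe_one, one_mul]
  rfl

theorem ae_rightCosets_eq
    (hνT : IsQuotientMeasure (principalIdeles F) μT Measure.count νT) (hE : IsIdeleDomain E)
    {u v : RightCosets (principalIdeles F) → ℂ} (hu : Measurable u) (hv : Measurable v)
    (h : ∀ᵐ a ∂(μT.restrict E), u (Quotient.mk _ a) = v (Quotient.mk _ a)) : u =ᵐ[νT] v := by
  have hmap : νT = (μT.restrict E).map (Quotient.mk (QuotientGroup.rightRel (principalIdeles F))) :=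
    Measure.ext_of_lintegral _ fun P hP => by
      rw [lintegral_rightCosets_principalIdeles hνT hE hP, lintegral_map hP measurable_quotient_mk'']
  rw [hmap]
  exact (ae_map_iff measurable_quotient_mk''.aemeasurable (measurableSet_eq_fun hu hv)).2 h

variable [μN.IsAddHaarMeasure]

theorem constantTerm_mk (hD : IsAdeleDomain D) (hfin : μN D < ∞)
    (f : RightCosets (rationalPoints φ) → ℂ) (a : Ideles F) :
    constantTerm μN D f (Quotient.mk _ a) =
      adelicScale μN D * adelicCoeff (adeleProb μN D) f 0 a := by
  obtain ⟨⟨_, γ, rfl⟩, h⟩ := RightCosets.exists_out_eq (principalIdeles F) a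
  rw [constantTerm, h, adelicCoeff_principalIdele_mul hD hfin, zero_mul]

theorem measurable_constantTerm (hD : IsAdeleDomain D) (hfin : μN D < ∞)
    {f : RightCosets (rationalPoints φ) → ℂ} (hf : Measurable f) :
    Measurable (constantTerm μN D f) := by
  have := isProbabilityMeasure_adeleProb hD hfin
  refine RightCosets.measurable_comp_out (principalIdeles F)
    (P := fun a => adelicScale μN D * adelicCoeff (adeleProb μN D) f 0 a)
    ((measurable_adelicCoeff hf 0).const_mul _) ?_
  rintro ⟨_, γ, rfl⟩ a
  rw [adelicCoeff_principalIdele_mul hD hfin, zero_mul]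

theorem constantTerm_mulRight (hD : IsAdeleDomain D) (hfin : μN D < ∞)
    (f : RightCosets (rationalPoints φ) → ℂ) (g : GAdelic φ) :
    constantTerm μN D (f ∘ RightCosets.mulRight (rationalPoints φ) g) =
      constantTerm μN D f ∘ RightCosets.mulRight (principalIdeles F) (GAdelic.idele φ g) := by
  funext q
  obtain ⟨a, rfl⟩ := Quotient.exists_rep q
  rw [Function.comp_apply, RightCosets.mulRight_mk, constantTerm_mk hD hfin,
    constantTerm_mk hD hfin, adelicCoeff_mulRight hD hfin, map_zero, zero_mul,
    standardCharacter_zero, Circle.coe_one, one_mul]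

theorem measurable_whittakerTerm (hD : IsAdeleDomain D) (hfin : μN D < ∞)
    {f : RightCosets (rationalPoints φ) → ℂ} (hf : Measurable f) (n : F) :
    Measurable (whittakerTerm μN D f n) := by
  have := isProbabilityMeasure_adeleProb hD hfin
  exact ((continuous_subtype_val.comp (continuous_standardCharacter_mul n)).measurable.comp
    (GAdelic.continuous_x φ).measurable).mul
      (((measurable_adelicCoeff hf n).comp (GAdelic.continuous_idele φ).measurable).const_mul _)

theorem whittakerTerm_mul (hD : IsAdeleDomain D) (hfin : μN D < ∞)
    (f : RightCosets (rationalPoints φ) → ℂ) (n : Fˣ) (h : subgroupNW φ) (g : GAdelic φ) :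
    whittakerTerm μN D f (n : F) (h * g) =
      characterNW φ n h * whittakerTerm μN D f (n : F) g := by
  obtain ⟨⟨x, a⟩, γ, hγ, ha⟩ := h
  have ha : principalIdele F γ = a := ha
  subst ha
  have hγ : φ.app F γ = 1 := hγ
  have hg : (⟨x, principalIdele F γ⟩ : GAdelic φ) * g =
      GAdelic.of φ (x + g.x) (principalIdele F γ * GAdelic.idele φ g) := by
    have h1 := app_principalIdele (φ := φ) γ
    rw [hγ, Units.val_one, map_one] at h1
    refine GPoints.ext ?_ rfl
    change x + (φ.app (Adeles F) (principalIdele F γ) : Adeles F) * g.x = x + g.x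
    rw [h1, one_mul]
  change whittakerTerm μN D f (n : F) (⟨x, principalIdele F γ⟩ * g) = _
  rw [hg]
  change (standardCharacter F (algebraMap F (Adeles F) n * (x + g.x)) : ℂ) * (adelicScale μN D *
    adelicCoeff (adeleProb μN D) f n (principalIdele F γ * GAdelic.idele φ g)) =
      (standardCharacter F (algebraMap F (Adeles F) n * x) : ℂ) *
        ((standardCharacter F (algebraMap F (Adeles F) n * g.x) : ℂ) * (adelicScale μN D *
          adelicCoeff (adeleProb μN D) f n (GAdelic.idele φ g)))
  rw [adelicCoeff_principalIdele_mul hD hfin, hγ, Units.val_one, mul_one, mul_add,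
    standardCharacter_add, Circle.coe_mul, mul_assoc]

theorem whittakerTerm_mulRight (hD : IsAdeleDomain D) (hfin : μN D < ∞)
    (f : RightCosets (rationalPoints φ) → ℂ) (n : F) (g h : GAdelic φ) :
    whittakerTerm μN D (f ∘ RightCosets.mulRight (rationalPoints φ) g) n h =
      whittakerTerm μN D f n (h * g) := by
  have h1 : (h * g).x = h.x + φ.app (Adeles F) (GAdelic.idele φ h) * g.x := rfl
  have h2 : GAdelic.idele φ (h * g) = GAdelic.idele φ h * GAdelic.idele φ g := rfl
  rw [whittakerTerm, whittakerTerm, adelicCoeff_mulRight hD hfin, h1, h2, mul_add,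
    standardCharacter_add, Circle.coe_mul]
  ring

theorem lintegral_enorm_constantTerm
    (hνT : IsQuotientMeasure (principalIdeles F) μT Measure.count νT)
    (hD : IsAdeleDomain D) (hfin : μN D < ∞) (hE : IsIdeleDomain E)
    {f : RightCosets (rationalPoints φ) → ℂ} (hf : Measurable f) :
    ∫⁻ q, ‖constantTerm μN D f q‖ₑ ^ 2 ∂νT =
      μN D * ∫⁻ a in E, ‖adelicCoeff (adeleProb μN D) f 0 a‖ₑ ^ 2 ∂μT := by
  rw [lintegral_rightCosets_principalIdeles hνT hE
    ((measurable_constantTerm hD hfin hf).enorm.pow_const 2), ← lintegral_const_mul' _ _ hfin.ne]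
  refine lintegral_congr fun a => ?_
  rw [constantTerm_mk hD hfin, enorm_mul, mul_pow, enorm_adelicScale_sq hfin]

variable [μT.IsHaarMeasure]

theorem ae_adelicCoeff_congr
    (hνG : IsQuotientMeasure (rationalPoints φ) (rightHaar φ μN μT) Measure.count νG)
    (hD : IsAdeleDomain D) (hfin : μN D < ∞) (hE : IsIdeleDomain E)
    {f f' : RightCosets (rationalPoints φ) → ℂ} (h : f =ᵐ[νG] f') :
    ∀ᵐ a ∂(μT.restrict E), ∀ m : F,
      adelicCoeff (adeleProb μN D) f m a = adelicCoeff (adeleProb μN D) f' m a := by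
  filter_upwards [ae_ae_cosetOf hνG hD hfin hE h] with a ha m
  refine integral_congr_ae ?_
  filter_upwards [ha] with x hx
  rw [hx]

theorem ae_adelicCoeff_add
    (hνG : IsQuotientMeasure (rationalPoints φ) (rightHaar φ μN μT) Measure.count νG)
    (hD : IsAdeleDomain D) (hfin : μN D < ∞) (hE : IsIdeleDomain E) (f f' : Lp ℂ 2 νG) :
    ∀ᵐ a ∂(μT.restrict E), ∀ m : F, adelicCoeff (adeleProb μN D) ⇑(f + f') m a =
      adelicCoeff (adeleProb μN D) f m a + adelicCoeff (adeleProb μN D) f' m a := by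
  have := isProbabilityMeasure_adeleProb hD hfin
  have hint : ∀ (m : F) {u : Adeles F → ℂ}, MemLp u 2 (adeleProb μN D) → Integrable (fun x => u x *
      starRingEnd ℂ (standardCharacter F (algebraMap F (Adeles F) m * x) : ℂ)) (adeleProb μN D) :=
    fun m u hu => (hu.integrable (by norm_num)).mul_bdd (c := 1)
      (measurable_conj_standardCharacter m).aestronglyMeasurable
      (Filter.Eventually.of_forall fun x => by rw [RCLike.norm_conj, Circle.norm_coe])
  filter_upwards [ae_adelicCoeff_congr hνG hD hfin hE (Lp.coeFn_add f f'),
    ae_memLp_cosetOf hνG hD hfin hE (Lp.stronglyMeasurable f).measurable (Lp.memLp f),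
    ae_memLp_cosetOf hνG hD hfin hE (Lp.stronglyMeasurable f').measurable (Lp.memLp f')]
    with a h1 h2 h3 m
  rw [h1, adelicCoeff, adelicCoeff, adelicCoeff, ← integral_add (hint m h2) (hint m h3)]
  simp only [Pi.add_apply, add_mul]

theorem ae_adelicCoeff_smul
    (hνG : IsQuotientMeasure (rationalPoints φ) (rightHaar φ μN μT) Measure.count νG)
    (hD : IsAdeleDomain D) (hfin : μN D < ∞) (hE : IsIdeleDomain E) (k : ℂ) (f : Lp ℂ 2 νG) :
    ∀ᵐ a ∂(μT.restrict E), ∀ m : F, adelicCoeff (adeleProb μN D) ⇑(k • f) m a =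
      k * adelicCoeff (adeleProb μN D) f m a := by
  filter_upwards [ae_adelicCoeff_congr hνG hD hfin hE (Lp.coeFn_smul k f)] with a h1 m
  rw [h1, adelicCoeff, adelicCoeff, ← integral_const_mul]
  simp only [Pi.smul_apply, smul_eq_mul, mul_assoc]

theorem lintegral_enorm_whittakerTerm
    (hνW : IsQuotientMeasure (subgroupNW φ) (rightHaar φ μN μT) (haarNW φ μN) νW)
    (hD : IsAdeleDomain D) (hfin : μN D < ∞) (hE : IsIdeleDomain E)
    {f : RightCosets (rationalPoints φ) → ℂ} (hf : Measurable f) (n : Fˣ) :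
    ∫⁻ q : RightCosets (subgroupNW φ), ‖whittakerTerm μN D f (n : F) q.out‖ₑ ^ 2 ∂νW =
      μN D * ∑' γ : Fˣ ⧸ kernelW φ, ∫⁻ a in E,
        ‖adelicCoeff (adeleProb μN D) f (n : F) (principalIdele F γ.out * a)‖ₑ ^ 2 ∂μT := by
  rw [lintegral_enorm_sq_subgroupNW hνW hD hfin hE (measurable_whittakerTerm hD hfin hf n)
    (whittakerTerm_mul hD hfin f n), ← ENNReal.tsum_mul_left]
  refine tsum_congr fun γ => ?_
  rw [← lintegral_const_mul' _ _ hfin.ne]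
  refine lintegral_congr fun a => ?_
  rw [whittakerTerm_of_zero, enorm_mul, mul_pow, enorm_adelicScale_sq hfin]

/-- The decomposition of the squared norm. -/
theorem lintegral_eq_terms
    (hνG : IsQuotientMeasure (rationalPoints φ) (rightHaar φ μN μT) Measure.count νG)
    (hνT : IsQuotientMeasure (principalIdeles F) μT Measure.count νT)
    (hνW : IsQuotientMeasure (subgroupNW φ) (rightHaar φ μN μT) (haarNW φ μN) νW)
    (hD : IsAdeleDomain D) (hfin : μN D < ∞) (hE : IsIdeleDomain E)
    (n : Fˣ ⧸ (φ.app F).range → Fˣ)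
    (hn : ∀ c : Fˣ ⧸ (φ.app F).range, (QuotientGroup.mk (n c) : Fˣ ⧸ (φ.app F).range) = c)
    {f : RightCosets (rationalPoints φ) → ℂ} (hf : Measurable f) (h2 : MemLp f 2 νG) :
    ∫⁻ q, ‖f q‖ₑ ^ 2 ∂νG = ∫⁻ q, ‖constantTerm μN D f q‖ₑ ^ 2 ∂νT +
      ∑' c, ∫⁻ q : RightCosets (subgroupNW φ), ‖whittakerTerm μN D f (n c : F) q.out‖ₑ ^ 2 ∂νW := by
  rw [lintegral_eq_adelicCoeff hνG hD hfin hE n hn hf h2, mul_add,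
    lintegral_enorm_constantTerm hνT hD hfin hE hf, ← ENNReal.tsum_mul_left]
  simp_rw [lintegral_enorm_whittakerTerm hνW hD hfin hE hf]

/-- The spectral decomposition as an isometry, described by Fourier coefficients. -/
theorem exists_spectral_isometry
    (hνG : IsQuotientMeasure (rationalPoints φ) (rightHaar φ μN μT) Measure.count νG)
    (hνT : IsQuotientMeasure (principalIdeles F) μT Measure.count νT)
    (hνW : IsQuotientMeasure (subgroupNW φ) (rightHaar φ μN μT) (haarNW φ μN) νW)
    (hD : IsAdeleDomain D) (hfin : μN D < ∞) (hE : IsIdeleDomain E)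
    (n : Fˣ ⧸ (φ.app F).range → Fˣ)
    (hn : ∀ c : Fˣ ⧸ (φ.app F).range, (QuotientGroup.mk (n c) : Fˣ ⧸ (φ.app F).range) = c) :
    ∃ U : Lp ℂ 2 νG →ₗᵢ[ℂ] WithLp 2 (Lp ℂ 2 νT × lp (fun c : Fˣ ⧸ (φ.app F).range =>
        Induced (subgroupNW φ) (characterNW φ (n c)) νW) 2),
      ∀ (f : Lp ℂ 2 νG) (u : RightCosets (rationalPoints φ) → ℂ), Measurable u → f =ᵐ[νG] u →
        (U f).fst =ᵐ[νT] constantTerm μN D u ∧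
        ∀ c, ∃ p : PreInduced (subgroupNW φ) (characterNW φ (n c)) νW,
          p.fn = whittakerTerm μN D u (n c : F) ∧ (U f).snd c = SeparationQuotient.mk p := by
  have hm : ∀ f : Lp ℂ 2 νG, Measurable f := fun f => (Lp.stronglyMeasurable f).measurable
  have hlt : ∀ (u : RightCosets (rationalPoints φ) → ℂ), Measurable u → MemLp u 2 νG →
      ∫⁻ q, ‖constantTerm μN D u q‖ₑ ^ 2 ∂νT < ∞ ∧ ∀ c, ∫⁻ q : RightCosets (subgroupNW φ),
        ‖whittakerTerm μN D u (n c : F) q.out‖ₑ ^ 2 ∂νW < ∞ := fun u hu hu2 => by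
    have h := (memLp_two_iff_lintegral hu.aestronglyMeasurable).1 hu2
    rw [lintegral_eq_terms hνG hνT hνW hD hfin hE n hn hu hu2, ENNReal.add_lt_top] at h
    exact ⟨h.1, fun c => (ENNReal.le_tsum c).trans_lt h.2⟩
  have hmem0 : ∀ f : Lp ℂ 2 νG, MemLp (constantTerm μN D f) 2 νT := fun f =>
    (memLp_two_iff_lintegral (measurable_constantTerm hD hfin (hm f)).aestronglyMeasurable).2
      (hlt f (hm f) (Lp.memLp f)).1
  have hmemc : ∀ (u : RightCosets (rationalPoints φ) → ℂ), Measurable u → MemLp u 2 νG → ∀ c,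
      whittakerTerm μN D u (n c : F) ∈
        equivariantFunctions (subgroupNW φ) (characterNW φ (n c)) νW := fun u hu hu2 c => by
    have h1 := measurable_whittakerTerm hD hfin hu (n c : F)
    have h2 := whittakerTerm_mul hD hfin u (n c)
    refine ⟨h1, h2, ?_⟩
    have h3 := RightCosets.measurable_comp_out (subgroupNW φ)
      (P := fun g => ‖whittakerTerm μN D u (n c : F) g‖) h1.norm (norm_equivariant h2)
    refine (memLp_two_iff_lintegral h3.aestronglyMeasurable).2 ?_
    simpa only [enorm_norm] using (hlt u hu hu2).2 c
  let P : ∀ (c : Fˣ ⧸ (φ.app F).range) (u : RightCosets (rationalPoints φ) → ℂ),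
      Measurable u → MemLp u 2 νG → PreInduced (subgroupNW φ) (characterNW φ (n c)) νW :=
    fun c u hu hu2 => ⟨_, hmemc u hu hu2 c⟩

  have hPγ : ∀ c u hu hu2 (γ : Fˣ ⧸ kernelW φ) a,
      (P c u hu hu2).fn (GAdelic.of φ 0 (principalIdele F γ.out * a)) =
        adelicScale μN D * adelicCoeff (adeleProb μN D) u ((n c : F) * φ.app F γ.out) a :=
    fun c u hu hu2 γ a => by
      rw [← adelicCoeff_principalIdele_mul hD hfin, ← whittakerTerm_of_zero]
      rfl
  let T₀ : Lp ℂ 2 νG →ₗ[ℂ] Lp ℂ 2 νT :=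
    { toFun := fun f => (hmem0 f).toLp _
      map_add' := fun f f' => by
        rw [← MemLp.toLp_add]
        refine MemLp.toLp_congr _ _ (ae_rightCosets_eq hνT hE
          (measurable_constantTerm hD hfin (hm _)) ((measurable_constantTerm hD hfin (hm _)).add
            (measurable_constantTerm hD hfin (hm _))) ?_)
        filter_upwards [ae_adelicCoeff_add hνG hD hfin hE f f'] with a ha
        simp only [Pi.add_apply, constantTerm_mk hD hfin]
        rw [ha, mul_add]
      map_smul' := fun k f => by
        rw [RingHom.id_apply, ← MemLp.toLp_const_smul]
        refine MemLp.toLp_congr _ _ (ae_rightCosets_eq hνT hE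
          (measurable_constantTerm hD hfin (hm _))
            ((measurable_constantTerm hD hfin (hm _)).const_smul k) ?_)
        filter_upwards [ae_adelicCoeff_smul hνG hD hfin hE k f] with a ha
        simp only [Pi.smul_apply, smul_eq_mul, constantTerm_mk hD hfin]
        rw [ha, mul_left_comm] }
  let T : ∀ c, Lp ℂ 2 νG →ₗ[ℂ] Induced (subgroupNW φ) (characterNW φ (n c)) νW := fun c =>
    { toFun := fun f => SeparationQuotient.mk (P c f (hm f) (Lp.memLp f))
      map_add' := fun f f' => by
        rw [← SeparationQuotient.mk_add]
        refine Induced.mk_eq_mk_of_ae hνW hD hfin hE ?_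
        filter_upwards [ae_adelicCoeff_add hνG hD hfin hE f f'] with a ha γ
        rw [PreInduced.fn_add, hPγ c _ (hm _) (Lp.memLp _), hPγ c f (hm _) (Lp.memLp _),
          hPγ c f' (hm _) (Lp.memLp _), ha, mul_add]
      map_smul' := fun k f => by
        rw [RingHom.id_apply, ← SeparationQuotient.mk_smul]
        refine Induced.mk_eq_mk_of_ae hνW hD hfin hE ?_
        filter_upwards [ae_adelicCoeff_smul hνG hD hfin hE k f] with a ha γ
        rw [PreInduced.fn_smul, hPγ c _ (hm _) (Lp.memLp _), hPγ c f (hm _) (Lp.memLp _), ha,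
          mul_left_comm] }
  have hT₀ : ∀ f, T₀ f = (hmem0 f).toLp _ := fun _ => rfl
  have hT : ∀ c f, T c f = SeparationQuotient.mk (P c f (hm f) (Lp.memLp f)) := fun _ _ => rfl
  obtain ⟨U, hU⟩ := exists_linearIsometry_hilbertSum T₀ T fun f => by
    rw [enorm_Lp_sq, lintegral_eq_terms hνG hνT hνW hD hfin hE n hn (hm f) (Lp.memLp f), hT₀,
      enorm_Lp_sq]
    congr 1
    · exact lintegral_congr_ae ((hmem0 f).coeFn_toLp.mono fun q hq => by simp only [hq])
    · exact tsum_congr fun c => by rw [hT, Induced.enorm_mk_sq]; rfl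
  refine ⟨U, fun f u hu hfu => ⟨?_, fun c => ⟨P c u hu ((memLp_congr_ae hfu).1 (Lp.memLp f)),
    rfl, ?_⟩⟩⟩
  · rw [(hU f).1, hT₀]
    refine (hmem0 f).coeFn_toLp.trans (ae_rightCosets_eq hνT hE
      (measurable_constantTerm hD hfin (hm f)) (measurable_constantTerm hD hfin hu) ?_)
    filter_upwards [ae_adelicCoeff_congr hνG hD hfin hE hfu] with a ha
    rw [constantTerm_mk hD hfin, constantTerm_mk hD hfin, ha]
  · rw [(hU f).2, hT]
    refine Induced.mk_eq_mk_of_ae hνW hD hfin hE ?_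
    filter_upwards [ae_adelicCoeff_congr hνG hD hfin hE hfu] with a ha γ
    rw [hPγ c f (hm _) (Lp.memLp _), hPγ c u hu ((memLp_congr_ae hfu).1 (Lp.memLp f)), ha]

end Components

section Surjectivity

variable {F : Type u} [Field F] [NumberField F] {φ : MultCharacter F}
  {μN : Measure (Adeles F)} {μT : Measure (Ideles F)} {D : Set (Adeles F)} {E : Set (Ideles F)}
  {νG : Measure (RightCosets (rationalPoints φ))} {νT : Measure (RightCosets (principalIdeles F))}
  {νW : Measure (RightCosets (subgroupNW φ))}

/-- The element of `F^×` that moves an idele into the domain `E`. -/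
def IsIdeleDomain.rep (hE : IsIdeleDomain E) (a : Ideles F) : Fˣ := (hE.2 a).choose

theorem IsIdeleDomain.rep_mem (hE : IsIdeleDomain E) (a : Ideles F) :
    principalIdele F (hE.rep a) * a ∈ E := (hE.2 a).choose_spec.1

theorem IsIdeleDomain.rep_eq (hE : IsIdeleDomain E) {a : Ideles F} {γ : Fˣ}
    (h : principalIdele F γ * a ∈ E) : hE.rep a = γ :=
  ((hE.2 a).choose_spec.2 γ h).symm

theorem IsIdeleDomain.rep_mul (hE : IsIdeleDomain E) (γ : Fˣ) (a : Ideles F) :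
    hE.rep (principalIdele F γ * a) = hE.rep a * γ⁻¹ := by
  refine hE.rep_eq ?_
  rw [← mul_assoc, ← map_mul, inv_mul_cancel_right]
  exact hE.rep_mem a

theorem IsIdeleDomain.rep_of_mem (hE : IsIdeleDomain E) {a : Ideles F} (ha : a ∈ E) :
    hE.rep a = 1 := hE.rep_eq (by rwa [map_one, one_mul])

/-- The function on `G(𝔸)` sending `g` to `p (γ r g)`, for the element `r` of `T(F)` that moves
`g` over `E`. -/
def transport (hE : IsIdeleDomain E) (p : GAdelic φ → ℂ) (γ : Fˣ) (g : GAdelic φ) : ℂ :=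
  p (GAdelic.of φ 0 (principalIdele F (γ * hE.rep (GAdelic.idele φ g))) * g)

theorem measurable_transport (hE : IsIdeleDomain E) {p : GAdelic φ → ℂ} (hp : Measurable p)
    (γ : Fˣ) : Measurable (transport hE p γ) := by
  have := NumberField.countable F
  have : Countable Fˣ := Units.val_injective.countable
  intro s hs
  let A : Fˣ → Set (GAdelic φ) := fun δ => {g | principalIdele F δ * GAdelic.idele φ g ∈ E}
  let q : Fˣ → GAdelic φ → ℂ := fun δ g => p (GAdelic.of φ 0 (principalIdele F (γ * δ)) * g)
  have hA : ∀ δ, MeasurableSet (A δ) := fun δ =>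
    ((measurable_const_mul (principalIdele F δ)).comp (GAdelic.continuous_idele φ).measurable) hE.1
  have hq : ∀ δ, Measurable (q δ) := fun δ => hp.comp (measurable_const_mul _)
  have hrep : ∀ g, g ∈ A (hE.rep (GAdelic.idele φ g)) := fun g => hE.rep_mem _
  have hAq : ∀ δ g, g ∈ A δ → transport hE p γ g = q δ g := fun δ g hg => by
    rw [transport, hE.rep_eq hg]
  have h : transport hE p γ ⁻¹' s = ⋃ δ : Fˣ, (A δ ∩ q δ ⁻¹' s) := by
    ext g
    simp only [Set.mem_iUnion, Set.mem_inter_iff, Set.mem_preimage]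
    constructor
    · intro hg
      refine ⟨_, hrep g, ?_⟩
      rwa [← hAq _ g (hrep g)]
    · rintro ⟨δ, h1, h2⟩
      rwa [hAq δ g h1]
  rw [h]
  exact MeasurableSet.iUnion fun δ => (hA δ).inter (hq δ hs)

theorem equivariant_of_add {n : Fˣ} {p : GAdelic φ → ℂ}
    (hinv : ∀ (h : subgroupNW φ) g, p (h * g) = characterNW φ n h * p g) (x : Adeles F)
    (a : Ideles F) : p (GAdelic.of φ x a) =
      standardCharacter F (algebraMap F (Adeles F) n * x) * p (GAdelic.of φ 0 a) := by
  have h : GAdelic.of φ x a = GAdelic.of φ x 1 * GAdelic.of φ 0 a := by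
    refine GPoints.ext ?_ (one_mul a).symm
    change x = x + _ * (0 : Adeles F)
    rw [mul_zero, add_zero]
  rw [h]
  exact hinv ⟨_, ⟨1, (kernelW φ).one_mem, map_one _⟩⟩ _

theorem of_zero_mul (γ : Fˣ) (x : Adeles F) (a : Ideles F) :
    GAdelic.of φ 0 (principalIdele F γ) * GAdelic.of φ x a =
      GAdelic.of φ (algebraMap F _ (φ.app F γ : F) * x) (principalIdele F γ * a) := by
  refine GPoints.ext ?_ rfl
  rw [← app_principalIdele]
  exact zero_add _

theorem transport_mul (hE : IsIdeleDomain E) {n : Fˣ} {p : GAdelic φ → ℂ}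
    (hinv : ∀ (h : subgroupNW φ) g, p (h * g) = characterNW φ n h * p g) (γ : Fˣ)
    (h : rationalPoints φ) (g : GAdelic φ) :
    transport hE p γ (h * g) = transport hE p γ g := by
  obtain ⟨⟨ξ, δ⟩, rfl⟩ := rationalPointsEquiv.surjective h
  have hg : ∀ a, GAdelic.of φ 0 (principalIdele F a) * g = GAdelic.of φ
      (algebraMap F _ (φ.app F a : F) * g.x) (principalIdele F a * GAdelic.idele φ g) :=
    fun a => of_zero_mul a g.x (GAdelic.idele φ g)
  have hid : GAdelic.idele φ (rationalPointsEquiv (φ := φ) (ξ, δ) * g) =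
      principalIdele F δ * GAdelic.idele φ g := rfl
  rw [transport, transport, hid, hE.rep_mul, rationalPointsEquiv_mul, of_zero_mul, hg]
  generalize hE.rep (GAdelic.idele φ g) = r
  have hδ : γ * (r * δ⁻¹) * δ = γ * r := by rw [mul_assoc, inv_mul_cancel_right]
  have hx : algebraMap F (Adeles F) (φ.app F (γ * (r * δ⁻¹)) : F) *
      (algebraMap F _ ξ + algebraMap F _ (φ.app F δ : F) * g.x) =
      algebraMap F _ (φ.app F (γ * (r * δ⁻¹)) * ξ) + algebraMap F _ (φ.app F (γ * r) : F) * g.x := by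
    rw [mul_add, ← map_mul, ← mul_assoc (algebraMap F (Adeles F) _), ← map_mul, ← Units.val_mul, ← map_mul, hδ]
  have ha : principalIdele F (γ * (r * δ⁻¹)) * (principalIdele F δ * GAdelic.idele φ g) =
      principalIdele F (γ * r) * GAdelic.idele φ g := by
    rw [← mul_assoc, ← map_mul, hδ]
  rw [hx, ha, equivariant_of_add hinv, standardCharacter_mul_add, ← equivariant_of_add hinv]

variable [μN.IsAddHaarMeasure]

theorem integral_adeleProb_mul_conj (hD : IsAdeleDomain D) (hfin : μN D < ∞) (k m : F)
    [Decidable (m = k)] :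
    ∫ x, (standardCharacter F (algebraMap F (Adeles F) k * x) : ℂ) *
      starRingEnd ℂ (standardCharacter F (algebraMap F (Adeles F) m * x) : ℂ) ∂(adeleProb μN D) =
      if m = k then 1 else 0 := by
  classical
  have h : ∀ x, (standardCharacter F (algebraMap F (Adeles F) k * x) : ℂ) *
      starRingEnd ℂ (standardCharacter F (algebraMap F (Adeles F) m * x) : ℂ) =
        standardCharacter F (algebraMap F (Adeles F) (k - m) * x) := fun x => by
    rw [← standardCharacter_neg, ← Circle.coe_mul, ← standardCharacter_add, map_sub, sub_mul,
      sub_eq_add_neg]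
  simp_rw [h]
  rw [integral_adeleProb_character hD hfin]
  simp only [sub_eq_zero, eq_comm]

variable [μT.IsHaarMeasure]

theorem Induced.eq_zero_of_inner_eq_zero
    (hνW : IsQuotientMeasure (subgroupNW φ) (rightHaar φ μN μT) (haarNW φ μN) νW)
    (hD : IsAdeleDomain D) (hfin : μN D < ∞) (hE : IsIdeleDomain E) {n : Fˣ}
    (p : PreInduced (subgroupNW φ) (characterNW φ n) νW)
    (h : ∀ γ : Fˣ ⧸ kernelW φ, ∃ p' : PreInduced (subgroupNW φ) (characterNW φ n) νW,
      (∀ a ∈ E, p'.fn (GAdelic.of φ 0 (principalIdele F γ.out * a)) =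
        p.fn (GAdelic.of φ 0 (principalIdele F γ.out * a))) ∧
      (∀ δ ≠ γ, ∀ a ∈ E, p'.fn (GAdelic.of φ 0 (principalIdele F δ.out * a)) = 0) ∧
      inner ℂ (SeparationQuotient.mk p' : Induced (subgroupNW φ) (characterNW φ n) νW)
        (SeparationQuotient.mk p) = 0) :
    (SeparationQuotient.mk p : Induced (subgroupNW φ) (characterNW φ n) νW) = 0 := by
  rw [← enorm_eq_zero, ← pow_eq_zero_iff (n := 2) two_ne_zero, Induced.enorm_mk_sq,
    lintegral_enorm_sq_subgroupNW hνW hD hfin hE p.measurable_fn p.fn_mul, ENNReal.tsum_eq_zero]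
  intro γ
  obtain ⟨p', h1, h2, h3⟩ := h γ
  have hle : ‖(SeparationQuotient.mk p - SeparationQuotient.mk p' :
      Induced (subgroupNW φ) (characterNW φ n) νW)‖ₑ ^ 2 ≤
        ‖(SeparationQuotient.mk p : Induced (subgroupNW φ) (characterNW φ n) νW)‖ₑ ^ 2 := by
    rw [← SeparationQuotient.mk_sub, Induced.enorm_mk_sq, Induced.enorm_mk_sq,
      lintegral_enorm_sq_subgroupNW hνW hD hfin hE p.measurable_fn p.fn_mul,
      lintegral_enorm_sq_subgroupNW hνW hD hfin hE (p - p').measurable_fn (p - p').fn_mul]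
    refine ENNReal.tsum_le_tsum fun δ => setLIntegral_mono' hE.1 fun a ha => ?_
    have hsub : (p - p').fn (GAdelic.of φ 0 (principalIdele F δ.out * a)) =
      p.fn (GAdelic.of φ 0 (principalIdele F δ.out * a)) -
        p'.fn (GAdelic.of φ 0 (principalIdele F δ.out * a)) := rfl
    rw [hsub]
    by_cases hδ : δ = γ
    · rw [hδ, h1 a ha, sub_self]
      simp
    · rw [h2 δ hδ a ha, sub_zero]
  have hzero : (SeparationQuotient.mk p' : Induced (subgroupNW φ) (characterNW φ n) νW) = 0 := by
    rw [enorm_sq_eq_ofReal, enorm_sq_eq_ofReal, ENNReal.ofReal_le_ofReal_iff (sq_nonneg _),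
      @norm_sub_sq ℂ, inner_eq_zero_symm.1 h3, map_zero] at hle
    rw [← norm_eq_zero, ← pow_eq_zero_iff (n := 2) two_ne_zero]
    refine le_antisymm ?_ (sq_nonneg _)
    linarith
  have h4 : ∑' δ : Fˣ ⧸ kernelW φ,
      ∫⁻ a in E, ‖p'.fn (GAdelic.of φ 0 (principalIdele F δ.out * a))‖ₑ ^ 2 ∂μT = 0 := by
    rw [← lintegral_enorm_sq_subgroupNW hνW hD hfin hE p'.measurable_fn p'.fn_mul,
      ← Induced.enorm_mk_sq, hzero]
    simp
  rw [← ENNReal.tsum_eq_zero.1 h4 γ]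
  exact setLIntegral_congr_fun hE.1 fun a ha => by simp only [h1 a ha]

/-- Every function on `T(F) \ T(𝔸)` is, up to a scalar, a constant term. -/
theorem exists_constantTerm_eq
    (hνG : IsQuotientMeasure (rationalPoints φ) (rightHaar φ μN μT) Measure.count νG)
    (hνT : IsQuotientMeasure (principalIdeles F) μT Measure.count νT)
    (hD : IsAdeleDomain D) (hfin : μN D < ∞) (hE : IsIdeleDomain E) (h : Lp ℂ 2 νT) :
    ∃ u : RightCosets (rationalPoints φ) → ℂ, Measurable u ∧ MemLp u 2 νG ∧
      (∀ a, adelicCoeff (adeleProb μN D) u 0 a = h (Quotient.mk _ a)) ∧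
      ∀ m ≠ 0, ∀ a, adelicCoeff (adeleProb μN D) u m a = 0 := by
  classical
  have := isProbabilityMeasure_adeleProb hD hfin
  have hm : Measurable h := (Lp.stronglyMeasurable h).measurable
  let w : GAdelic φ → ℂ := fun g =>
    h (Quotient.mk (QuotientGroup.rightRel (principalIdeles F)) (GAdelic.idele φ g))
  have hw : Measurable w :=
    hm.comp (measurable_quotient_mk''.comp (GAdelic.continuous_idele φ).measurable)
  have hinv : ∀ (k : rationalPoints φ) g, w (k * g) = w g := fun k g => by
    obtain ⟨⟨ξ, δ⟩, rfl⟩ := rationalPointsEquiv.surjective k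
    refine congrArg h (Quotient.sound (QuotientGroup.rightRel_apply.2 ?_))
    refine (principalIdeles F).inv_mem_iff.1 ?_
    refine ⟨δ, ?_⟩
    change _ = (GAdelic.idele φ g * (principalIdele F δ * GAdelic.idele φ g)⁻¹)⁻¹
    rw [mul_inv_rev, inv_inv, mul_inv_cancel_right]
  let u : RightCosets (rationalPoints φ) → ℂ := fun q => w q.out
  have hu : Measurable u := RightCosets.measurable_comp_out _ hw hinv
  have hval : ∀ x a, u (cosetOf φ x a) = h (Quotient.mk _ a) := fun x a => by
    obtain ⟨k, hk⟩ := RightCosets.exists_out_eq (rationalPoints φ) (GAdelic.of φ x a)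
    change w (Quotient.out (Quotient.mk _ (GAdelic.of φ x a))) = _
    rw [hk, hinv]
    rfl
  have hcoef : ∀ m a, adelicCoeff (adeleProb μN D) u m a =
      h (Quotient.mk _ a) * if m = 0 then 1 else 0 := fun m a => by
    rw [← integral_adeleProb_mul_conj hD hfin 0 m, ← integral_const_mul]
    refine integral_congr_ae (Filter.Eventually.of_forall fun x => ?_)
    simp only [hval, map_zero, zero_mul, standardCharacter_zero, Circle.coe_one, one_mul]
  refine ⟨u, hu, ?_, fun a => by rw [hcoef, if_pos rfl, mul_one],
    fun m hm a => by rw [hcoef, if_neg hm, mul_zero]⟩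
  refine (memLp_two_iff_lintegral hu.aestronglyMeasurable).2 ?_
  rw [lintegral_rightCosets_rationalPoints hνG hD hfin hE (hu.enorm.pow_const 2)]
  refine ENNReal.mul_lt_top hfin ?_
  have h1 := (memLp_two_iff_lintegral (Lp.memLp h).1).1 (Lp.memLp h)
  rw [lintegral_rightCosets_principalIdeles hνT hE (hm.enorm.pow_const 2)] at h1
  refine lt_of_eq_of_lt (lintegral_congr fun a => ?_) h1
  refine (lintegral_congr fun x => congrArg (fun z => ‖z‖ₑ ^ 2) (hval x a)).trans ?_
  rw [lintegral_const, measure_univ, mul_one]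

/-- Every element of the induced representation, restricted to a translate of the domain, is a
Fourier coefficient. -/
theorem exists_adelicCoeff_eq
    (hνG : IsQuotientMeasure (rationalPoints φ) (rightHaar φ μN μT) Measure.count νG)
    (hνW : IsQuotientMeasure (subgroupNW φ) (rightHaar φ μN μT) (haarNW φ μN) νW)
    (hD : IsAdeleDomain D) (hfin : μN D < ∞) (hE : IsIdeleDomain E) {n : Fˣ}
    (p : PreInduced (subgroupNW φ) (characterNW φ n) νW) (γ : Fˣ ⧸ kernelW φ) :
    ∃ u : RightCosets (rationalPoints φ) → ℂ, Measurable u ∧ MemLp u 2 νG ∧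
      (∀ a ∈ E, adelicCoeff (adeleProb μN D) u ((n * φ.app F γ.out : Fˣ) : F) a =
        p.fn (GAdelic.of φ 0 (principalIdele F γ.out * a))) ∧
      ∀ m : F, m ≠ (n * φ.app F γ.out : Fˣ) → ∀ a ∈ E,
        adelicCoeff (adeleProb μN D) u m a = 0 := by
  classical
  have := isProbabilityMeasure_adeleProb hD hfin
  let u : RightCosets (rationalPoints φ) → ℂ := fun q => transport hE p.fn γ.out q.out
  have hinv := transport_mul hE p.fn_mul γ.out
  have hu : Measurable u :=
    RightCosets.measurable_comp_out _ (measurable_transport hE p.measurable_fn γ.out) hinv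
  have hval : ∀ a ∈ E, ∀ x, u (cosetOf φ x a) =
      p.fn (GAdelic.of φ 0 (principalIdele F γ.out * a)) *
        standardCharacter F (algebraMap F _ ((n * φ.app F γ.out : Fˣ) : F) * x) := fun a ha x => by
    obtain ⟨k, hk⟩ := RightCosets.exists_out_eq (rationalPoints φ) (GAdelic.of φ x a)
    change transport hE p.fn γ.out (Quotient.out (Quotient.mk _ (GAdelic.of φ x a))) = _
    have hr : hE.rep (GAdelic.idele φ (GAdelic.of φ x a)) = 1 := hE.rep_of_mem ha
    rw [hk, hinv, transport, hr, mul_one, of_zero_mul, equivariant_of_add p.fn_mul, mul_comm,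
      ← mul_assoc (algebraMap F (Adeles F) _), ← map_mul, Units.val_mul]
  have hcoef : ∀ m, ∀ a ∈ E, adelicCoeff (adeleProb μN D) u m a =
      p.fn (GAdelic.of φ 0 (principalIdele F γ.out * a)) *
        if m = ((n * φ.app F γ.out : Fˣ) : F) then 1 else 0 := fun m a ha => by
    rw [← integral_adeleProb_mul_conj hD hfin, ← integral_const_mul]
    refine integral_congr_ae (Filter.Eventually.of_forall fun x => ?_)
    simp only [hval a ha, mul_assoc]
  refine ⟨u, hu, ?_, fun a ha => by rw [hcoef _ a ha, if_pos rfl, mul_one],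
    fun m hm a ha => by rw [hcoef _ a ha, if_neg hm, mul_zero]⟩
  refine (memLp_two_iff_lintegral hu.aestronglyMeasurable).2 ?_
  rw [lintegral_rightCosets_rationalPoints hνG hD hfin hE (hu.enorm.pow_const 2)]
  refine ENNReal.mul_lt_top hfin ?_
  have h1 : ‖p‖ₑ ^ 2 < ∞ := ENNReal.pow_lt_top enorm_lt_top
  rw [PreInduced.enorm_sq,
    lintegral_enorm_sq_subgroupNW hνW hD hfin hE p.measurable_fn p.fn_mul] at h1
  refine lt_of_le_of_lt ?_ ((ENNReal.le_tsum γ).trans_lt h1)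
  refine setLIntegral_mono' hE.1 fun a ha => le_of_eq ?_
  have h2 : ∀ x, ‖u (Quotient.mk _ (GAdelic.of φ x a))‖ₑ ^ 2 =
      ‖p.fn (GAdelic.of φ 0 (principalIdele F γ.out * a))‖ₑ ^ 2 := fun x => by
    have h3 := hval a ha x
    rw [cosetOf] at h3
    rw [h3, enorm_sq_eq_ofReal, norm_mul, Circle.norm_coe, mul_one, enorm_sq_eq_ofReal]
  simp_rw [h2]
  rw [lintegral_const, measure_univ, mul_one]

end Surjectivity

section SpectralDecomposition

variable {F : Type u} [Field F] [NumberField F] {φ : MultCharacter F}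
  {μN : Measure (Adeles F)} [μN.IsAddHaarMeasure] {μT : Measure (Ideles F)} [μT.IsHaarMeasure]
  {νG : Measure (RightCosets (rationalPoints φ))} {νT : Measure (RightCosets (principalIdeles F))}
  {νW : Measure (RightCosets (subgroupNW φ))} {D : Set (Adeles F)} {E : Set (Ideles F)}

theorem adelicScale_ne_zero (hD : IsAdeleDomain D) (hfin : μN D < ∞) : adelicScale μN D ≠ 0 := by
  intro h
  have h1 := enorm_adelicScale_sq hfin
  rw [h, enorm_zero, zero_pow two_ne_zero] at h1
  exact hD.measure_ne_zero h1.symm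

/-- An isometry given by Fourier coefficients is surjective. -/
theorem surjective_of_spectral_isometry
    (hνG : IsQuotientMeasure (rationalPoints φ) (rightHaar φ μN μT) Measure.count νG)
    (hνT : IsQuotientMeasure (principalIdeles F) μT Measure.count νT)
    (hνW : IsQuotientMeasure (subgroupNW φ) (rightHaar φ μN μT) (haarNW φ μN) νW)
    (hD : IsAdeleDomain D) (hfin : μN D < ∞) (hE : IsIdeleDomain E)
    {n : Fˣ ⧸ (φ.app F).range → Fˣ}
    (hn : ∀ c : Fˣ ⧸ (φ.app F).range, (QuotientGroup.mk (n c) : Fˣ ⧸ (φ.app F).range) = c)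
    (U : Lp ℂ 2 νG →ₗᵢ[ℂ] WithLp 2 (Lp ℂ 2 νT × lp (fun c : Fˣ ⧸ (φ.app F).range =>
        Induced (subgroupNW φ) (characterNW φ (n c)) νW) 2))
    (hU : ∀ (f : Lp ℂ 2 νG) (u : RightCosets (rationalPoints φ) → ℂ), Measurable u → f =ᵐ[νG] u →
      (U f).fst =ᵐ[νT] constantTerm μN D u ∧
      ∀ c, ∃ p : PreInduced (subgroupNW φ) (characterNW φ (n c)) νW,
        p.fn = whittakerTerm μN D u (n c : F) ∧ (U f).snd c = SeparationQuotient.mk p) :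
    Function.Surjective U := by
  have hs := adelicScale_ne_zero (μN := μN) hD hfin
  have hcomplete : CompleteSpace (LinearMap.range U.toLinearMap) :=
    completeSpace_coe_iff_isComplete.2
      (by rw [LinearMap.coe_range]; exact U.isometry.isUniformInducing.isComplete_range)
  rw [← LinearIsometry.coe_toLinearMap, ← LinearMap.range_eq_top, ← Submodule.orthogonal_eq_bot_iff,
    Submodule.eq_bot_iff]
  intro v hv
  have horth : ∀ f, inner ℂ (U f).fst v.fst + inner ℂ (U f).snd v.snd = 0 := fun f => by
    have := (Submodule.mem_orthogonal _ _).1 hv (U f) ⟨f, rfl⟩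
    rwa [WithLp.prod_inner_apply] at this
  have hcoefE : ∀ (u : RightCosets (rationalPoints φ) → ℂ) c
      (p : PreInduced (subgroupNW φ) (characterNW φ (n c)) νW),
      p.fn = whittakerTerm μN D u (n c : F) → ∀ (δ : Fˣ ⧸ kernelW φ) a,
      p.fn (GAdelic.of φ 0 (principalIdele F δ.out * a)) = adelicScale μN D *
        adelicCoeff (adeleProb μN D) u ((n c * φ.app F δ.out : Fˣ) : F) a :=
    fun u c p hp δ a => by
      rw [hp, whittakerTerm_of_zero, adelicCoeff_principalIdele_mul hD hfin, Units.val_mul]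
  have h0 : v.fst = 0 := by
    obtain ⟨u, hu, hu2, hu0, hum⟩ := exists_constantTerm_eq hνG hνT hD hfin hE v.fst
    obtain ⟨h1, h2⟩ := hU (hu2.toLp u) u hu hu2.coeFn_toLp
    have hfst : (U (hu2.toLp u)).fst = adelicScale μN D • v.fst := by
      refine Lp.ext (h1.trans (Filter.EventuallyEq.trans ?_ (Lp.coeFn_smul _ _).symm))
      refine ae_rightCosets_eq hνT hE (measurable_constantTerm hD hfin hu)
        ((Lp.stronglyMeasurable v.fst).measurable.const_smul _)
        (Filter.Eventually.of_forall fun a => ?_)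
      rw [constantTerm_mk hD hfin, hu0]
      rfl
    have hsnd : (U (hu2.toLp u)).snd = 0 := by
      ext c
      obtain ⟨p, hp, hpc⟩ := h2 c
      have hp0 : p = 0 := PreInduced.ext_fn fun g => by
        rw [hp, whittakerTerm, hum _ (n c).ne_zero, mul_zero, mul_zero]
        rfl
      rw [hpc, hp0]
      rfl
    have h := horth (hu2.toLp u)
    rw [hfst, hsnd, inner_zero_left, add_zero, inner_smul_left] at h
    exact inner_self_eq_zero.1 ((mul_eq_zero.1 h).resolve_left (by simpa using hs))
  have hc : ∀ c, v.snd c = 0 := fun c => by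
    obtain ⟨p, hp⟩ := SeparationQuotient.surjective_mk (v.snd c)
    rw [← hp]
    refine Induced.eq_zero_of_inner_eq_zero hνW hD hfin hE p fun γ => ?_
    obtain ⟨u, hu, hu2, hu0, hum⟩ := exists_adelicCoeff_eq hνG hνW hD hfin hE p γ
    obtain ⟨h1, h2⟩ := hU (hu2.toLp u) u hu hu2.coeFn_toLp
    have hinj : ∀ c' (δ : Fˣ ⧸ kernelW φ), (c', δ) ≠ (c, γ) →
        ((n c' * φ.app F δ.out : Fˣ) : F) ≠ ((n c * φ.app F γ.out : Fˣ) : F) := fun c' δ h h' =>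
      h ((cokernelProdEquiv (φ.app F) n hn).injective (Units.ext h'))
    have hsnd : ∀ c' ≠ c, (U (hu2.toLp u)).snd c' = 0 := fun c' hc' => by
      obtain ⟨p', hp', hpc⟩ := h2 c'
      rw [hpc]
      refine Induced.mk_eq_mk_of_ae (p' := 0) hνW hD hfin hE ?_
      refine (ae_restrict_iff' hE.1).2 (Filter.Eventually.of_forall fun a ha δ => ?_)
      rw [hcoefE u c' p' hp', hum _ (hinj c' δ fun h => hc' (congrArg Prod.fst h)) a ha, mul_zero]
      rfl
    obtain ⟨p', hp', hpc⟩ := h2 c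
    refine ⟨(adelicScale μN D)⁻¹ • p', fun a ha => ?_, fun δ hδ a ha => ?_, ?_⟩
    · rw [PreInduced.fn_smul, hcoefE u c p' hp', hu0 a ha, inv_mul_cancel_left₀ hs]
    · rw [PreInduced.fn_smul, hcoefE u c p' hp',
        hum _ (hinj c δ fun h => hδ (congrArg Prod.snd h)) a ha, mul_zero, mul_zero]
    · have h := horth (hu2.toLp u)
      rw [h0, inner_zero_right, zero_add, lp.inner_eq_tsum,
        tsum_eq_single c fun c' hc' => by rw [hsnd c' hc', inner_zero_left], hpc, ← hp] at h
      rw [SeparationQuotient.mk_smul, inner_smul_left, h, mul_zero]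
  refine (WithLp.ofLp_injective 2) (Prod.ext h0 ?_)
  ext c
  exact hc c

theorem exists_spectral_decomposition
    (hνG : IsQuotientMeasure (rationalPoints φ) (rightHaar φ μN μT) Measure.count νG)
    (hνT : IsQuotientMeasure (principalIdeles F) μT Measure.count νT)
    (hνW : IsQuotientMeasure (subgroupNW φ) (rightHaar φ μN μT) (haarNW φ μN) νW)
    (n : Fˣ ⧸ (φ.app F).range → Fˣ)
    (hn : ∀ c : Fˣ ⧸ (φ.app F).range, (QuotientGroup.mk (n c) : Fˣ ⧸ (φ.app F).range) = c) :
    ∃ U : Lp ℂ 2 νG ≃ₗᵢ[ℂ] WithLp 2 (Lp ℂ 2 νT × lp (fun c : Fˣ ⧸ (φ.app F).range =>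
        Induced (subgroupNW φ) (characterNW φ (n c)) νW) 2),
      ∀ (g : GAdelic φ) (f : Lp ℂ 2 νG),
        (U (rightRegular (rationalPoints φ) hνG.invariant g f)).fst =
            torusRep φ hνT.invariant g (U f).fst ∧
          ∀ c : Fˣ ⧸ (φ.app F).range,
            (U (rightRegular (rationalPoints φ) hνG.invariant g f)).snd c =
              inducedRep (characterNW φ (n c)) hνW.invariant g ((U f).snd c) := by
  obtain ⟨D, hD, hfin⟩ := exists_isAdeleDomain μN
  obtain ⟨E, hE⟩ := exists_isIdeleDomain (F := F)
  obtain ⟨U, hU⟩ := exists_spectral_isometry hνG hνT hνW hD hfin hE n hn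
  refine ⟨LinearIsometryEquiv.ofSurjective U
    (surjective_of_spectral_isometry hνG hνT hνW hD hfin hE hn U hU), fun g f => ?_⟩
  change (U (rightRegular (rationalPoints φ) hνG.invariant g f)).fst = _ ∧
    ∀ c : Fˣ ⧸ (φ.app F).range, (U (rightRegular (rationalPoints φ) hνG.invariant g f)).snd c =
      inducedRep (characterNW φ (n c)) hνW.invariant g ((U f).snd c)
  have hf : Measurable f := (Lp.stronglyMeasurable f).measurable
  have hg : rightRegular (rationalPoints φ) hνG.invariant g f =ᵐ[νG]
      f ∘ RightCosets.mulRight (rationalPoints φ) g :=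
    Lp.coeFn_compMeasurePreserving f (hνG.invariant g)
  obtain ⟨h1, h2⟩ := hU f f hf (Filter.EventuallyEq.refl _ _)
  obtain ⟨h1', h2'⟩ := hU _ _ (hf.comp (hνG.invariant g).measurable) hg
  refine ⟨Lp.ext (h1'.trans ?_), fun c => ?_⟩
  · rw [constantTerm_mulRight hD hfin]
    refine Filter.EventuallyEq.trans
      ((hνT.invariant (GAdelic.idele φ g)).quasiMeasurePreserving.ae_eq_comp h1).symm ?_
    exact (Lp.coeFn_compMeasurePreserving (U f).fst (hνT.invariant (GAdelic.idele φ g))).symm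
  · obtain ⟨p, hp, hpc⟩ := h2 c
    obtain ⟨p', hp', hpc'⟩ := h2' c
    rw [hpc, hpc']
    refine congrArg SeparationQuotient.mk (PreInduced.ext_fn fun h => ?_)
    rw [hp', whittakerTerm_mulRight hD hfin, ← hp]
    rfl

end SpectralDecomposition

section Schur

/-- A selfadjoint operator is a scalar if there are no nontrivial closed subspaces invariant
under its commutant. -/
theorem exists_eq_algebraMap_of_commutant {H : Type*} [NormedAddCommGroup H]
    [InnerProductSpace ℂ H] [CompleteSpace H] {S : H →L[ℂ] H} (hS : IsSelfAdjoint S)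
    (h : ∀ K : Submodule ℂ H, IsClosed (K : Set H) →
      (∀ T : H →L[ℂ] H, Commute S T → ∀ x ∈ K, T x ∈ K) → K = ⊥ ∨ K = ⊤) :
    ∃ r : ℝ, S = algebraMap ℝ (H →L[ℂ] H) r := by
  have hker : ∀ f : ℝ → ℝ, LinearMap.ker (cfc f S).toLinearMap = ⊥ ∨
      LinearMap.ker (cfc f S).toLinearMap = ⊤ := fun f => by
    refine h _ (cfc f S).isClosed_ker fun T hT x hx => ?_
    have hc : cfc f S (T x) = T (cfc f S x) :=
      congrArg (fun T : H →L[ℂ] H => T x) (hT.cfc_real f).eq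
    have hx : cfc f S x = 0 := hx
    change cfc f S (T x) = 0
    rw [hc, hx, map_zero]
  have hsub : (spectrum ℝ S).Subsingleton := by
    by_contra hns
    obtain ⟨l, hl, m, hm, hlm⟩ := Set.not_subsingleton_iff.1 hns
    wlog hlt : l < m generalizing l m
    · exact this m hm l hl hlm.symm (lt_of_le_of_ne (not_lt.1 hlt) hlm.symm)
    let k := (l + m) / 2
    have hlk : l < k := by simp only [k]; linarith
    have hkm : k < m := by simp only [k]; linarith
    let f : ℝ → ℝ := fun x => max (k - x) 0
    let g : ℝ → ℝ := fun x => max (x - k) 0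
    have hf : Continuous f := by fun_prop
    have hg : Continuous g := by fun_prop
    have hfg : cfc f S * cfc g S = 0 := by
      rw [← cfc_mul f g S hf.continuousOn hg.continuousOn]
      have h0 : (fun x => f x * g x) = fun _ => 0 := by
        funext x
        rcases le_total x k with hx | hx
        · simp only [g, max_eq_right (sub_nonpos.2 hx), mul_zero]
        · simp only [f, max_eq_right (sub_nonpos.2 hx), zero_mul]
      rw [h0, cfc_const (0 : ℝ) S hS, map_zero]
    have hzero : ∀ (u : ℝ → ℝ), Continuous u → cfc u S = 0 → ∀ x ∈ spectrum ℝ S, u x = 0 :=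
      fun u hu h0 => by
        rw [← cfc_zero ℝ S] at h0
        exact eqOn_of_cfc_eq_cfc h0 hu.continuousOn continuousOn_const hS
    have hgv : ∀ v, cfc f S (cfc g S v) = 0 := fun v => congrArg (fun T : H →L[ℂ] H => T v) hfg
    rcases hker f with hbot | htop
    · have hg0 : cfc g S = 0 := by
        ext v
        have : cfc g S v ∈ LinearMap.ker (cfc f S).toLinearMap := hgv v
        rw [hbot] at this
        exact this
      have := hzero g hg hg0 m hm
      simp only [g, max_eq_left (sub_nonneg.2 hkm.le)] at this
      linarith
    · have hf0 : cfc f S = 0 := by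
        ext v
        have : v ∈ LinearMap.ker (cfc f S).toLinearMap := htop ▸ Submodule.mem_top
        exact this
      have := hzero f hf hf0 l hl
      simp only [f, max_eq_left (sub_nonneg.2 hlk.le)] at this
      linarith
  obtain ⟨r, hr⟩ : ∃ r : ℝ, (spectrum ℝ S).EqOn id fun _ => r := by
    rcases hsub.eq_empty_or_singleton with h0 | ⟨r, hr⟩
    · exact ⟨0, by rw [h0]; exact Set.eqOn_empty _ _⟩
    · exact ⟨r, by rw [hr]; exact fun x hx => hx⟩
  refine ⟨r, ?_⟩
  rw [← cfc_const r S hS, ← cfc_congr hr, cfc_id ℝ S hS]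

/-- **Schur's lemma**: an intertwining operator which does not vanish on an irreducible
subrepresentation embeds it. -/
theorem IsIrreducibleSubrep.embedsInRep {G E E' : Type*} [Group G] [NormedAddCommGroup E]
    [InnerProductSpace ℂ E] [CompleteSpace E] [NormedAddCommGroup E'] [InnerProductSpace ℂ E']
    {ρ : G →* (E ≃ₗᵢ[ℂ] E)} {σ : G →* (E' ≃ₗᵢ[ℂ] E')} {V : Submodule ℂ E}
    (hV : IsIrreducibleSubrep ρ V) (A : E →L[ℂ] E') (hA : ∀ g f, A (ρ g f) = σ g (A f))
    (hne : ∃ f ∈ V, A f ≠ 0) : EmbedsInRep ρ V σ := by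
  have hcomplete : CompleteSpace V := hV.1.1.completeSpace_coe
  let B : V →L[ℂ] UniformSpace.Completion E' :=
    UniformSpace.Completion.toComplL ∘L (A ∘L V.subtypeL)
  have hB : ∀ x y : V, inner ℂ (B x) (B y) = inner ℂ (A x) (A y) := fun x y =>
    UniformSpace.Completion.inner_coe _ _
  let S : V →L[ℂ] V := B.adjoint ∘L B
  have hSB : ∀ x y : V, inner ℂ (S x) y = inner ℂ (A x) (A y) := fun x y => by
    rw [← hB]
    exact ContinuousLinearMap.adjoint_inner_left B y (B x)
  have hS : IsSelfAdjoint S := by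
    rw [ContinuousLinearMap.isSelfAdjoint_iff']
    exact (ContinuousLinearMap.adjoint_comp _ _).trans
      (by rw [ContinuousLinearMap.adjoint_adjoint])
  let τ : G → V →L[ℂ] V := fun g =>
    ((ρ g).toContinuousLinearEquiv.toContinuousLinearMap ∘L V.subtypeL).codRestrict V
      fun x => hV.1.2 g x x.2
  have hτ : ∀ g (x : V), (τ g x : E) = ρ g x := fun _ _ => rfl
  have hτinv : ∀ g (x : V), τ g (τ g⁻¹ x) = x := fun g x => by
    refine Subtype.ext ?_
    have h : ρ g * ρ g⁻¹ = 1 := by rw [← map_mul, mul_inv_cancel, map_one]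
    exact congrArg (fun T : E ≃ₗᵢ[ℂ] E => T x) h
  have hτinner : ∀ g (x y : V), inner ℂ (τ g x) (τ g y) = inner ℂ x y := fun g x y =>
    (ρ g).inner_map_map x y
  have hcomm : ∀ g, Commute S (τ g) := fun g => by
    refine ContinuousLinearMap.ext fun x => ext_inner_right ℂ fun y => ?_
    change inner ℂ (S (τ g x)) y = inner ℂ (τ g (S x)) y
    rw [← hτinv g y, hτinner, hSB, hSB, hτ, hτ, hA, hA, LinearIsometryEquiv.inner_map_map]
  obtain ⟨r, hr⟩ := exists_eq_algebraMap_of_commutant hS fun K hK hKT => by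
    have h := hV.2.2 (K.map V.subtype) (Submodule.map_subtype_le V K) ⟨?_, ?_⟩
    · rcases h with h | h
      · left
        exact Submodule.map_injective_of_injective V.injective_subtype (h.trans (Submodule.map_bot _).symm)
      · right
        exact Submodule.map_injective_of_injective V.injective_subtype
          (h.trans (Submodule.map_subtype_top V).symm)
    · rw [Submodule.map_coe]
      exact hV.1.1.isClosedEmbedding_subtypeVal.isClosedMap _ hK
    · rintro g _ ⟨x, hx, rfl⟩
      exact ⟨τ g x, hKT _ (hcomm g) x hx, rfl⟩
  have hnorm : ∀ x : V, ‖A x‖ ^ 2 = r * ‖x‖ ^ 2 := fun x => by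
    have h := hSB x x
    have hx : S x = (r : ℂ) • x := by rw [hr]; rfl
    rw [hx, inner_smul_left, Complex.conj_ofReal, inner_self_eq_norm_sq_to_K,
      inner_self_eq_norm_sq_to_K] at h
    apply Complex.ofReal_injective
    push_cast
    exact h.symm
  obtain ⟨f, hfV, hf⟩ := hne
  have hr0 : 0 < r := by
    have h := hnorm ⟨f, hfV⟩
    have h1 : 0 < ‖A f‖ ^ 2 := by positivity
    have h2 : 0 ≤ ‖(⟨f, hfV⟩ : V)‖ ^ 2 := sq_nonneg _
    by_contra hneg
    have h3 : ‖A f‖ ^ 2 = r * ‖(⟨f, hfV⟩ : V)‖ ^ 2 := h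
    nlinarith
  refine ⟨⟨(((Real.sqrt r)⁻¹ : ℝ) : ℂ) • (A.toLinearMap ∘ₗ V.subtype), fun x => ?_⟩,
    fun g x x' hx => ?_⟩
  · have h1 : ‖A x‖ = Real.sqrt r * ‖x‖ := by
      rw [← sq_eq_sq₀ (norm_nonneg _) (by positivity), hnorm, mul_pow, Real.sq_sqrt hr0.le]
    change ‖(((Real.sqrt r)⁻¹ : ℝ) : ℂ) • A x‖ = ‖x‖
    rw [norm_smul, h1, Complex.norm_real, Real.norm_eq_abs, abs_of_pos (by positivity),
      inv_mul_cancel_left₀ (by positivity)]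
  · change (((Real.sqrt r)⁻¹ : ℝ) : ℂ) • A x' = σ g ((((Real.sqrt r)⁻¹ : ℝ) : ℂ) • A x)
    rw [hx, hA, map_smul]

end Schur

theorem mainTheorem5 {F : Type u} [Field F] [NumberField F] (φ : MultCharacter F)
    (μN : Measure (Adeles F)) [μN.IsAddHaarMeasure]
    (μT : Measure (Ideles F)) [μT.IsHaarMeasure]
    (νG : Measure (RightCosets (rationalPoints φ)))
    (hνG : IsQuotientMeasure (rationalPoints φ) (rightHaar φ μN μT) Measure.count νG)
    (νT : Measure (RightCosets (principalIdeles F)))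
    (hνT : IsQuotientMeasure (principalIdeles F) μT Measure.count νT)
    (νW : Measure (RightCosets (subgroupNW φ)))
    (hνW : IsQuotientMeasure (subgroupNW φ) (rightHaar φ μN μT) (haarNW φ μN) νW)
    (n : Fˣ ⧸ (φ.app F).range → Fˣ)
    (hn : ∀ c : Fˣ ⧸ (φ.app F).range, (QuotientGroup.mk (n c) : Fˣ ⧸ (φ.app F).range) = c) :
    (∃ U : Lp ℂ 2 νG ≃ₗᵢ[ℂ]
        WithLp 2 (Lp ℂ 2 νT ×
          lp (fun c : Fˣ ⧸ (φ.app F).range =>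
            Induced (subgroupNW φ) (characterNW φ (n c)) νW) 2),
      ∀ (g : GAdelic φ) (f : Lp ℂ 2 νG),
        (U (rightRegular (rationalPoints φ) hνG.invariant g f)).fst =
            torusRep φ hνT.invariant g (U f).fst ∧
          ∀ c : Fˣ ⧸ (φ.app F).range,
            (U (rightRegular (rationalPoints φ) hνG.invariant g f)).snd c =
              inducedRep (characterNW φ (n c)) hνW.invariant g ((U f).snd c)) ∧
      ∀ V : Submodule ℂ (Lp ℂ 2 νG),
        IsIrreducibleSubrep (rightRegular (rationalPoints φ) hνG.invariant) V →
          EmbedsInRep (rightRegular (rationalPoints φ) hνG.invariant) V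
              (torusRep φ hνT.invariant) ∨
            ∃ c : Fˣ ⧸ (φ.app F).range,
              EmbedsInRep (rightRegular (rationalPoints φ) hνG.invariant) V
                (inducedRep (characterNW φ (n c)) hνW.invariant) := by
  obtain ⟨U, hU⟩ := exists_spectral_decomposition hνG hνT hνW n hn
  refine ⟨⟨U, hU⟩, fun V hV => ?_⟩
  by_cases h0 : ∃ f ∈ V, (U f).fst ≠ 0
  · exact Or.inl (hV.embedsInRep
      (WithLp.fstL 2 ℂ _ _ ∘L U.toContinuousLinearEquiv.toContinuousLinearMap)
      (fun g f => (hU g f).1) h0)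
  · right
    push Not at h0
    obtain ⟨f, hf, hfne⟩ := V.ne_bot_iff.1 hV.2.1
    obtain ⟨c, hc⟩ : ∃ c, (U f).snd c ≠ 0 := by
      by_contra! hall
      refine hfne (U.map_eq_zero_iff.1 (WithLp.ofLp_injective 2 (Prod.ext (h0 f hf) ?_)))
      ext c
      exact hall c
    exact ⟨c, hV.embedsInRep (lp.evalCLM ℂ (fun c : Fˣ ⧸ (φ.app F).range =>
      Induced (subgroupNW φ) (characterNW φ (n c)) νW) 2 c ∘L WithLp.sndL 2 ℂ _ _ ∘L
      U.toContinuousLinearEquiv.toContinuousLinearMap) (fun g f => (hU g f).2 c) ⟨f, hf, hc⟩⟩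

end
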